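/- \textbf{2-dimensional grid.} Let $G=(V,E)$ be the grid with $c$ rows and $m$ columns, $n=cm$. For an unknown ground truth $Y\in\{\pm1\}^V$ one observes $X\in\{\pm1\}^E$ and $Z\in\{\pm1\}^V$ with all coordinates independent: $X_{uv}=Y_uY_v$ with probability $1-p$ and $X_{uv}=-Y_uY_v$ otherwise; $Z_v=Y_v$ with probability $1-q$ and $Z_v=-Y_v$ otherwise. Throughout $0<p<q<1/2$, and $\varepsilon=1/2-q$. \emph{Decomposition.} Let $3\le c\le\sqrt n$ and $b\in\{2,3\}$. Cut the rows into $\lfloor c/3\rfloor$ strips of three consecutive rows (the last strip also takes the remaining $c \bmod 3$ rows). Let $E'\subseteq E$ consist of all grid edges, except that of the edges between the $a$-th and the $(a+1)$-st strip ($a=0,1,\dots$) only those in the last $b$ columns ($a$ even), respectively the first $b$ columns ($a$ odd), are kept; so $E'=E$ for $c=3$. Let $T=(\mathcal W,F)$ be the path whose nodes are, along the resulting zig-zag, the blocks formed by all rows of a strip and $b$ consecutive columns, sliding by one column at a time, and, at each turn, the two $3\times b$ blocks in the linking columns obtained by sliding down by one and by two rows. For $W\in\mathcal W$ let $W^\star$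 be $W$ together with its neighbors in $G'=(V,E')$, let $E'(W^\star)$ be the set of edges of $E'$ inside $W^\star$, and let $\mathrm{mincut}^\star(W)$ be the least number of edges of $E'(W^\star)$ between $S$ and $W^\star\setminus S$, over $S\subseteq W^\star$ with $S\cap W\ne\emptyset\ne W\setminus S$. Let $\deg(T)$ be the maximum degree of $T$, $\mathsf{wid}^\star=\max_W|W^\star|-1$, $\deg_E^\star=\max_{e}|\{W: e\in E'(W^\star)\}|$, and, for $\delta\in(0,1)$, $$K_n=2^{\mathsf{wid}^\star+2}\sum_{W}p^{\lceil \mathrm{mincut}^\star(W)/2\rceil}+6\deg_E^\star\max_W|E'(W^\star)|\log(2/\delta),\qquad L_n=\deg(T)K_n .$$ \emph{Algorithm 1} (\textsc{TreeDecompositionDecoder}). For each $W$ choose a minimizer $\widetilde Y^{W^\star}\in\{\pm1\}^{W^\star}$ of $\sum_{uv\in E'(W^\star)}\mathbf 1\{\widetilde Y_u\widetilde Y_v\ne X_{uv}\}$ and let $\widehat Y^{W^\star}$ be its restriction to $W$. For each $(W_1,W_2)\in F$ choose $v\in W_1\cap W_2$ and put $S(W_1,W_2)=\widehat Y^{W_1^\star}_v\widehat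 Y^{W_2^\star}_v$. Let $\hat s\in\{\pm1\}^{\mathcal W}$ minimize $\sum_W\sum_{v\in W}\mathbf 1\{s_W\widehat Y^{W^\star}_v\ne Z_v\}$ subject to $\sum_{(W_1,W_2)\in F}\mathbf 1\{s_{W_1}\ne s_{W_2}S(W_1,W_2)\}\le L_n$. For each $v$ output $\widehat Y_v=\hat s_W\widehat Y^{W^\star}_v$ for some $W\ni v$. \emph{Claim.} There are universal constants $C,c_0>0$ such that the following hold. 1. For all $3\le c\le\sqrt n$ and $b\in\{2,3\}$, $T$ is a non-redundant tree decomposition (a path) of $(V,E')$, the quantities $\deg(T)$, $\deg^\star_E$, $\max_W|E'(W^\star)|$, $\mathsf{wid}^\star$ are at most $C$, and $G'(W^\star)$ is connected for every $W$. 2. For every ground truth $Y$ and every $\delta\in(0,1)$, with probability at least $1-\delta$, every possible output $\widehat Y$ of Algorithm 1 (however its arbitrary choices are made) satisfies $$\sum_{v\in V}\mathbf 1\{\widehat Y_v\ne Y_v\}\le\frac{C}{\varepsilon^2}\bigl(p^2n+\log(2/\delta)\bigr)\log(e/p).$$ In particular ($\delta=1/n$) the Hamming error is $\widetilde O(\lceil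 p^2n\rceil)$ with high probability, where $\widetilde O$ hides factors $\log n$, $\log(1/p)$, $1/\varepsilon$. 3. For each $b\in\{2,3\}$ there is one program for a unit-cost random access machine (integer registers and arrays, addition, subtraction, comparison with zero) which, given $c$, $m$, $\lfloor L_n\rfloor$, $X$ and $Z$, outputs a valid output of Algorithm 1 in at most $C\,(p^2n+\log(2/\delta))\,n$ steps; with $\delta=1/n$ this is $\widetilde O(\lceil p^2n\rceil n)$. 4. For all $3\le c\le\sqrt n$ and every (possibly randomized) estimator there is a ground truth $Y$ for which its expected Hamming error is at least $c_0\,q\,p^2n$. 5. For $c=1$ and every $n\ge1$, every (possibly randomized) estimator has, for some $Y$, expected Hamming error at least $c_0\,q\,p\,n$. -/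

import Mathlib

open MeasureTheory

/-! ## The observation model

Labels are the units `1, -1` of `ℤ`. -/

/-- One edge label per edge of `G` and one vertex label per vertex. -/
abbrev Observation {V : Type} (G : SimpleGraph V) : Type := (G.edgeSet → ℤˣ) × (V → ℤˣ)

/-- The product `Y u * Y v` of the labels at the two ends of the edge `e = s(u, v)`. -/
def edgeSign {V : Type} (Y : V → ℤˣ) (e : Sym2 V) : ℤˣ := (e.map Y).mul

/-- The law of a sign that is equal to `y` with probability `1 - r` and to `-y` with
probability `r`. -/
noncomputable def flipLaw (r : ℝ) (y : ℤˣ) : Measure ℤˣ :=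
  ENNReal.ofReal (1 - r) • Measure.dirac y + ENNReal.ofReal r • Measure.dirac (-y)

open Classical in
/-- The joint law of the edge measurements `X` and the vertex measurements `Z` for the ground
truth `Y`: all measurements are independent, edges are flipped with probability `p`, vertices
with probability `q`. -/
noncomputable def obsLaw {V : Type} [Fintype V] (G : SimpleGraph V) (p q : ℝ) (Y : V → ℤˣ) :
    Measure (Observation G) :=
  (Measure.pi fun e : G.edgeSet => flipLaw p (edgeSign Y e.1)).prod
    (Measure.pi fun v : V => flipLaw q (Y v))

/-- The expected Hamming error, for the ground truth `Y`, of a (possibly randomized) estimator,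
which maps every observation to a probability distribution on labelings. -/
noncomputable def expectedError {V : Type} [Fintype V] [DecidableEq V] (G : SimpleGraph V)
    (p q : ℝ) (est : Observation G → PMF (V → ℤˣ)) (Y : V → ℤˣ) : ℝ :=
  ∫ ω, ∑ y : V → ℤˣ, (est ω y).toReal * (hammingDist y Y : ℝ) ∂(obsLaw G p q Y)

/-! ## Tree decompositions -/

/-- The parameters of the decoder: the graph of probed edges, a tree on the indices of the
components, the components, and the extended components. -/
structure Decomposition (V : Type) where
  numBags : ℕ
  probed : SimpleGraph V
  tree : SimpleGraph (Fin numBags)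
  bag : Fin numBags → Finset V
  ext : Fin numBags → Finset V

namespace Decomposition

variable {V : Type} (D : Decomposition V)

/-- `D.tree`, with the components `D.bag`, is a non-redundant tree decomposition of the graph of
probed edges. -/
structure IsTreeDecomposition : Prop where
  isTree : D.tree.IsTree
  vertex_mem : ∀ v, ∃ i, v ∈ D.bag i
  edge_mem : ∀ u v, D.probed.Adj u v → ∃ i, u ∈ D.bag i ∧ v ∈ D.bag i
  coherent : ∀ (i k : Fin D.numBags) (w : D.tree.Walk i k), w.IsPath →
    ∀ j ∈ w.support, ∀ v, v ∈ D.bag i → v ∈ D.bag k → v ∈ D.bag j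
  nonredundant : ∀ i j, D.tree.Adj i j → ¬ D.bag j ⊆ D.bag i

/-- The maximum degree of the tree. -/
noncomputable def treeDegree : ℕ := Finset.univ.sup fun i => (D.tree.neighborSet i).ncard

/-- The probed edges with both ends in the extended component `i`. -/
def extEdges (i : Fin D.numBags) : Set (Sym2 V) :=
  {e | e ∈ D.probed.edgeSet ∧ ∀ v ∈ e, v ∈ D.ext i}

/-- The width with respect to extended components: the largest size, minus one. -/
def extWidth : ℕ := (Finset.univ.sup fun i => (D.ext i).card) - 1

/-- The largest number of extended components in which one edge lies. -/
noncomputable def extEdgeDegree [Fintype V] [DecidableEq V] : ℕ :=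
  (Finset.univ : Finset (Sym2 V)).sup fun e => {i | e ∈ D.extEdges i}.ncard

/-- The largest number of probed edges in an extended component. -/
noncomputable def maxExtEdges : ℕ := Finset.univ.sup fun i => (D.extEdges i).ncard

/-- The smallest number of probed edges inside the extended component `i` that leave a set `S`
which separates the component `i` into two non-empty parts. -/
noncomputable def mincut (i : Fin D.numBags) : ℕ :=
  sInf {k | ∃ S ⊆ D.ext i, (∃ v ∈ D.bag i, v ∈ S) ∧ (∃ v ∈ D.bag i, v ∉ S) ∧
    k = {e | e ∈ D.extEdges i ∧ (∃ v ∈ e, v ∈ S) ∧ ∃ v ∈ e, v ∉ S}.ncard}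

/-- Admissibility with respect to `G`, with the numerical quantities bounded by `B`. -/
structure IsAdmissible (G : SimpleGraph V) [Fintype V] [DecidableEq V] (B : ℝ) : Prop where
  probed_le : D.probed ≤ G
  bag_subset_ext : ∀ i, D.bag i ⊆ D.ext i
  treeDegree_le : (D.treeDegree : ℝ) ≤ B
  extEdgeDegree_le : (D.extEdgeDegree : ℝ) ≤ B
  maxExtEdges_le : (D.maxExtEdges : ℝ) ≤ B
  extWidth_le : (D.extWidth : ℝ) ≤ B
  connected : ∀ i, (D.probed.induce (D.ext i : Set V)).Connected

/-- The bound `K_n` on the number of failing components, for failure probability `δ`;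
`(k + 1) / 2` is `⌈k / 2⌉`. -/
noncomputable def failureBound [Fintype V] [DecidableEq V] (p δ : ℝ) : ℝ :=
  2 ^ (D.extWidth + 2) * ∑ i, p ^ ((D.mincut i + 1) / 2)
    + 6 * D.extEdgeDegree * D.maxExtEdges * Real.log (2 / δ)

/-- The budget `L_n = deg(T) * K_n` of the decoder. -/
noncomputable def budget [Fintype V] [DecidableEq V] (p δ : ℝ) : ℝ :=
  D.treeDegree * D.failureBound p δ

/-! ## The decoder -/

/-- The number of probed edges in the extended component `i` whose label is violated by `y`. -/
noncomputable def localDisagreement {G : SimpleGraph V} (X : G.edgeSet → ℤˣ)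
    (i : Fin D.numBags) (y : V → ℤˣ) : ℕ :=
  {e : G.edgeSet | e.1 ∈ D.extEdges i ∧ edgeSign y e.1 ≠ X e}.ncard

end Decomposition

/-- The number of edges `s(i, j)` of the tree with `σ i ≠ σ j * S i j`. -/
noncomputable def violations {N : ℕ} (T : SimpleGraph (Fin N)) (S : Fin N → Fin N → ℤˣ)
    (σ : Fin N → ℤˣ) : ℕ :=
  {e | e ∈ T.edgeSet ∧ ∃ i j, e = s(i, j) ∧ σ i ≠ σ j * S i j}.ncard

/-- `σ` solves the constrained minimization over the tree `T`: among the sign vectors with at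
most `L` violated edges it has the least total cost. -/
def IsTreeDecoderOutput {N : ℕ} (T : SimpleGraph (Fin N)) (cost : Fin N → ℤˣ → ℕ)
    (S : Fin N → Fin N → ℤˣ) (L : ℝ) (σ : Fin N → ℤˣ) : Prop :=
  (violations T S σ : ℝ) ≤ L ∧
    ∀ τ : Fin N → ℤˣ, (violations T S τ : ℝ) ≤ L → ∑ i, cost i (σ i) ≤ ∑ i, cost i (τ i)

/-- `y` is a possible output of the tree decomposition decoder with budget `L` on the
observations `X`, `Z`, for some resolution of the arbitrary choices: `Yt i` is the estimator of
component `i` (only its values on the extended component matter), `r s(i, j)` is the vertex shared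
by the components `i` and `j` that is used for their relative sign, and `σ` is the sign vector. -/
def IsDecoderOutput {V : Type} {G : SimpleGraph V} (D : Decomposition V) (L : ℝ)
    (X : G.edgeSet → ℤˣ) (Z : V → ℤˣ) (y : V → ℤˣ) : Prop :=
  ∃ (Yt : Fin D.numBags → V → ℤˣ) (r : Sym2 (Fin D.numBags) → V) (σ : Fin D.numBags → ℤˣ),
    (∀ i y', D.localDisagreement X i (Yt i) ≤ D.localDisagreement X i y') ∧
    (∀ i j, D.tree.Adj i j → r s(i, j) ∈ D.bag i ∧ r s(i, j) ∈ D.bag j) ∧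
    IsTreeDecoderOutput D.tree
      (fun i a => ((D.bag i).filter fun v => a * Yt i v ≠ Z v).card)
      (fun i j => Yt i (r s(i, j)) * Yt j (r s(i, j))) L σ ∧
    ∀ v, ∃ i, v ∈ D.bag i ∧ y v = σ i * Yt i v

/-! ## Grids and their zig-zag decomposition -/

/-- The grid with `c` rows and `m` columns. -/
def grid (c m : ℕ) : SimpleGraph (Fin c × Fin m) :=
  (SimpleGraph.pathGraph c).boxProd (SimpleGraph.pathGraph m)

/-- The rows are cut into `c / 3` strips of three consecutive rows; the last strip also takes the
remaining one or two rows if `c` is not a multiple of three. This is the strip of row `i`. -/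
def stripOf (c i : ℕ) : ℕ := min (i / 3) (c / 3 - 1)

/-- Column `j` is one of the `b` columns where strip `a` stays linked to strip `a + 1`: the last
ones if `a` is even, the first ones if `a` is odd. -/
def IsTurnColumn (m b a j : ℕ) : Prop := if Even a then m ≤ j + b else j < b

/-- The probed edges: all grid edges except those between two strips outside of the turn
columns. -/
def zigzagGraph (c m b : ℕ) : SimpleGraph (Fin c × Fin m) where
  Adj u v := (grid c m).Adj u v ∧
    (stripOf c u.1 = stripOf c v.1 ∨
      (IsTurnColumn m b (min (stripOf c u.1) (stripOf c v.1)) u.2 ∧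
        IsTurnColumn m b (min (stripOf c u.1) (stripOf c v.1)) v.2))
  symm := ⟨by
    rintro u v ⟨h, h'⟩
    refine ⟨h.symm, ?_⟩
    rw [min_comm]
    rcases h' with h' | ⟨h₁, h₂⟩
    · exact Or.inl h'.symm
    · exact Or.inr ⟨h₂, h₁⟩⟩
  loopless := ⟨fun u h => (grid c m).loopless.irrefl u h.1⟩

/-- The vertex `v` lies in block number `t` along the zig-zag path. Strip `a` contributes the
blocks of all its rows and `b` consecutive columns, in the direction of travel, and, unless it is
the last strip, two further blocks of three rows in its turn columns, which slide down to the next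
strip. -/
def InZigzagBlock (c m b t : ℕ) (v : Fin c × Fin m) : Prop :=
  let a := t / (m - b + 3)
  let k := t % (m - b + 3)
  let start := if Even a then k else m - b - k
  if k ≤ m - b then
    stripOf c v.1 = a ∧ start ≤ (v.2 : ℕ) ∧ (v.2 : ℕ) < start + b
  else
    3 * a + (k - (m - b)) ≤ (v.1 : ℕ) ∧ (v.1 : ℕ) ≤ 3 * a + (k - (m - b)) + 2 ∧
      IsTurnColumn m b a v.2

open Classical in
/-- The path decomposition by the zig-zag blocks; the extension of a block adds the neighbors of
its vertices with respect to the probed edges. -/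
noncomputable def zigzagDecomposition (c m b : ℕ) : Decomposition (Fin c × Fin m) where
  numBags := c / 3 * (m - b + 3) - 2
  probed := zigzagGraph c m b
  tree := SimpleGraph.pathGraph _
  bag t := Finset.univ.filter (InZigzagBlock c m b t)
  ext t := Finset.univ.filter fun v =>
    InZigzagBlock c m b t v ∨ ∃ u, InZigzagBlock c m b t u ∧ (zigzagGraph c m b).Adj u v

/-! ## The machine model

A random access machine with integer registers and finitely many integer arrays used by a fixed
program, whose only arithmetic operations are addition and subtraction. Time is the number of
elementary operations: every node of an evaluated expression and every executed command costs
one unit. -/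

structure RamState where
  reg : ℕ → ℤ
  arr : ℕ → ℤ → ℤ

inductive RamExpr where
  | const (z : ℤ)
  | var (x : ℕ)
  | read (a : ℕ) (idx : RamExpr)
  | add (e f : RamExpr)
  | sub (e f : RamExpr)

def RamExpr.eval (s : RamState) : RamExpr → ℤ
  | .const z => z
  | .var x => s.reg x
  | .read a idx => s.arr a (idx.eval s)
  | .add e f => e.eval s + f.eval s
  | .sub e f => e.eval s - f.eval s

def RamExpr.cost : RamExpr → ℕ
  | .const _ => 1
  | .var _ => 1
  | .read _ idx => idx.cost + 1
  | .add e f => e.cost + f.cost + 1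
  | .sub e f => e.cost + f.cost + 1

/-- Programs; a guard `e` holds if its value is positive. -/
inductive RamProg where
  | skip
  | assign (x : ℕ) (e : RamExpr)
  | write (a : ℕ) (idx e : RamExpr)
  | seq (P Q : RamProg)
  | ite (e : RamExpr) (P Q : RamProg)
  | while (e : RamExpr) (P : RamProg)

/-- `RamExec P s s' t`: started in state `s`, the program `P` halts in state `s'` after `t`
steps. -/
inductive RamExec : RamProg → RamState → RamState → ℕ → Prop
  | skip (s : RamState) : RamExec .skip s s 1
  | assign (s : RamState) (x : ℕ) (e : RamExpr) :
      RamExec (.assign x e) s ⟨Function.update s.reg x (e.eval s), s.arr⟩ (e.cost + 1)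
  | write (s : RamState) (a : ℕ) (idx e : RamExpr) :
      RamExec (.write a idx e) s
        ⟨s.reg, Function.update s.arr a (Function.update (s.arr a) (idx.eval s) (e.eval s))⟩
        (idx.cost + e.cost + 1)
  | seq {P Q : RamProg} {s s' s'' : RamState} {t t' : ℕ} :
      RamExec P s s' t → RamExec Q s' s'' t' → RamExec (.seq P Q) s s'' (t + t' + 1)
  | ite_true {e : RamExpr} {P Q : RamProg} {s s' : RamState} {t : ℕ} :
      0 < e.eval s → RamExec P s s' t → RamExec (.ite e P Q) s s' (e.cost + t + 1)
  | ite_false {e : RamExpr} {P Q : RamProg} {s s' : RamState} {t : ℕ} :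
      e.eval s ≤ 0 → RamExec Q s s' t → RamExec (.ite e P Q) s s' (e.cost + t + 1)
  | while_true {e : RamExpr} {P : RamProg} {s s' s'' : RamState} {t t' : ℕ} :
      0 < e.eval s → RamExec P s s' t → RamExec (.while e P) s' s'' t' →
      RamExec (.while e P) s s'' (e.cost + t + t' + 1)
  | while_false {e : RamExpr} {P : RamProg} {s : RamState} :
      e.eval s ≤ 0 → RamExec (.while e P) s s (e.cost + 1)

/-- The row-major address of a grid vertex. -/
def gridAddress {c m : ℕ} (v : Fin c × Fin m) : ℤ := (v.1 : ℤ) * m + (v.2 : ℤ)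

/-- The state `s` holds the input of the decoder: the height, the width and the budget in the
registers `0`, `1`, `2`, the labels of the horizontal and of the vertical edges in the arrays `0`
and `1` (at the address of the left, respectively upper, end), and the vertex labels in array `2`.
Everything else in `s` is arbitrary. -/
structure EncodesInput (c m L : ℕ) (X : (grid c m).edgeSet → ℤˣ) (Z : Fin c × Fin m → ℤˣ)
    (s : RamState) : Prop where
  height : s.reg 0 = c
  width : s.reg 1 = m
  budget : s.reg 2 = L
  horizontal : ∀ u v (h : (grid c m).Adj u v), u.1 = v.1 → u.2 < v.2 →
    s.arr 0 (gridAddress u) = X ⟨s(u, v), h⟩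
  vertical : ∀ u v (h : (grid c m).Adj u v), u.2 = v.2 → u.1 < v.1 →
    s.arr 1 (gridAddress u) = X ⟨s(u, v), h⟩
  side : ∀ v, s.arr 2 (gridAddress v) = Z v

/-- The labeling `y` is stored in array `3`. -/
def HoldsOutput {c m : ℕ} (s : RamState) (y : Fin c × Fin m → ℤˣ) : Prop :=
  ∀ v, s.arr 3 (gridAddress v) = y v

/-! Upper bound on the error. If a local minimizer and the truth disagree on a set `S` that
separates a block, then the edges violated by the minimizer are the symmetric difference of the
flipped edges and the cut of `S`. Minimality therefore forces at least half of the cut to be flipped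
(`exists_sign_of_not_fails`), so a block fails only if `⌈mincut / 2⌉` of its boundedly many edges
are flipped. Away from the ends of a strip the extended block contains three edge-disjoint paths
between any two adjacent vertices of the block, so the cut is at least 3 and the failure probability
is `O(p ^ 2)` (`zigzag_three_le_mincut`). The at most four remaining blocks of each strip fail with
probability `O(p)`. As `c ≤ √n` means `c ≤ m`, their total `O(p * c)` is at most `O(p ^ 2 * n + 1)`
by the inequality between the means (`zigzag_sum_pow_le`). Blocks far apart on the path use disjoint
edges, and a Chernoff bound for such locally dependent events (`sum_prodWeight_local_count`) bounds
the number of failures by `K_n`.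

With at most `K_n` failures, the correct signs violate at most `L_n` tree edges, so they compete in
the decoder's minimization. The signs `τ` of the decoder relative to the truth then change at most
`2 * L_n` times and have excess cost `O(K_n)` (`exists_signs_of_isDecoderOutput`). For a fixed `τ`,
a Chernoff bound in `Z` makes such a small excess unlikely when the part with sign `-1` is large.
The union bound over `τ` weights each vector by `p ^ 2` per sign change: this costs a factor `p ^
(-4 * L_n)`, whence the factor `log (e / p)`, while the weights sum to at most `2 * (1 + p ^ 2) ^
N`, which adds only `O(p ^ 2 * n)` to the exponent (`sum_vertexWeight_exists_le`).

Running time. A block has boundedly many cells, so everything done inside it is a finite decision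
tree; `Computes`, `Observable` and `Evaluable` let such trees be described by their effect instead
of being written out. Normalizing each block labeling to agree with the preceding one on a shared
vertex makes all relative signs 1, so the constraint only counts sign changes. A table indexed by
block and number of changes solves this problem in `O(N * (L + 1))` steps
(`exists_decoder_program`).

Lower bounds. A truth and its modification at one vertex both give laws that dominate a common
multiple of one law, under which half of the incident edges are flipped and the vertex label is
uniform (`vertexError_add_flip`). No estimator can serve both truths there; averaging over all
truths gives the claim. -/

/-! ### Products of finite weights -/

section FiniteProduct

variable {ι Ω : Type*} [Fintype ι]

/-- The weight of a point of a finite product space. -/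
def prodWeight (w : ι → Ω → ℝ) (ω : ι → Ω) : ℝ := ∏ i, w i (ω i)

theorem prodWeight_nonneg {w : ι → Ω → ℝ} (hw : ∀ i x, 0 ≤ w i x) (ω : ι → Ω) :
    0 ≤ prodWeight w ω :=
  Finset.prod_nonneg fun i _ => hw i _

variable [Fintype Ω]

theorem sum_prodWeight_mul_prod [DecidableEq ι] (w f : ι → Ω → ℝ) :
    ∑ ω, prodWeight w ω * ∏ i, f i (ω i) = ∏ i, ∑ x, w i x * f i x := by
  rw [Finset.prod_univ_sum, Fintype.piFinset_univ]
  exact Finset.sum_congr rfl fun ω _ => Finset.prod_mul_distrib.symm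

theorem sum_prodWeight [DecidableEq ι] {w : ι → Ω → ℝ} (hw : ∀ i, ∑ x, w i x = 1) :
    ∑ ω, prodWeight w ω = 1 := by
  simpa [hw] using sum_prodWeight_mul_prod w fun _ _ => 1

/-- Functions of disjoint sets of coordinates are uncorrelated under a product weight. -/
theorem sum_prodWeight_mul_mul [DecidableEq ι] {w : ι → Ω → ℝ} (hw : ∀ i, ∑ x, w i x = 1)
    (A : Set ι) (f g : (ι → Ω) → ℝ)
    (hf : ∀ ω ω', (∀ i ∈ A, ω i = ω' i) → f ω = f ω')
    (hg : ∀ ω ω', (∀ i ∉ A, ω i = ω' i) → g ω = g ω') :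
    ∑ ω, prodWeight w ω * (f ω * g ω) =
      (∑ ω, prodWeight w ω * f ω) * ∑ ω, prodWeight w ω * g ω := by
  classical
  -- Two independent samples exchange their coordinates outside `A`. This involution preserves the
  -- product of their weights, and it turns `f` of one sample times `g` of the other into `f * g` of
  -- a single sample.
  let mix : (ι → Ω) × (ι → Ω) → (ι → Ω) × (ι → Ω) := fun z =>
    (fun i => if i ∈ A then z.1 i else z.2 i, fun i => if i ∈ A then z.2 i else z.1 i)
  have hmix : Function.Involutive mix := by
    rintro ⟨a, b⟩
    ext i <;> simp only [mix] <;> split_ifs <;> rfl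
  have hwt : ∀ z, prodWeight w (mix z).1 * prodWeight w (mix z).2 =
      prodWeight w z.1 * prodWeight w z.2 := by
    intro z
    simp only [prodWeight, ← Finset.prod_mul_distrib, mix]
    refine Finset.prod_congr rfl fun i _ => ?_
    split_ifs
    · rfl
    · ring
  have key : ∀ z : (ι → Ω) × (ι → Ω),
      (prodWeight w z.1 * f z.1) * (prodWeight w z.2 * g z.2) =
        (prodWeight w (mix z).1 * (f (mix z).1 * g (mix z).1)) * prodWeight w (mix z).2 := by
    intro z
    have h₁ : f (mix z).1 = f z.1 := hf _ _ fun i hi => by simp [mix, hi]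
    have h₂ : g (mix z).1 = g z.2 := hg _ _ fun i hi => by simp [mix, hi]
    rw [h₁, h₂]
    linear_combination (-(f z.1 * g z.2)) * hwt z
  rw [Finset.sum_mul_sum, ← Finset.sum_product', Finset.univ_product_univ]
  rw [Finset.sum_congr rfl fun z _ => key z]
  have hperm := Equiv.sum_comp hmix.toPerm fun z : (ι → Ω) × (ι → Ω) =>
    (prodWeight w z.1 * (f z.1 * g z.1)) * prodWeight w z.2
  simp only [Function.Involutive.coe_toPerm] at hperm
  rw [hperm]
  rw [← Finset.univ_product_univ, Finset.sum_product' (f := fun a b =>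
    (prodWeight w a * (f a * g a)) * prodWeight w b), ← Finset.sum_mul_sum, sum_prodWeight hw,
    mul_one]

/-- The two-factor case peels off one factor at a time: by disjointness the remaining factors do not
see the coordinates of the removed one. -/
theorem sum_prodWeight_mul_prod_finset [DecidableEq ι] {κ : Type*} {w : ι → Ω → ℝ}
    (hw : ∀ i, ∑ x, w i x = 1) (A : κ → Set ι) (f : κ → (ι → Ω) → ℝ)
    (hf : ∀ k ω ω', (∀ i ∈ A k, ω i = ω' i) → f k ω = f k ω') (s : Finset κ)
    (hA : ∀ k ∈ s, ∀ l ∈ s, k ≠ l → Disjoint (A k) (A l)) :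
    ∑ ω, prodWeight w ω * ∏ k ∈ s, f k ω = ∏ k ∈ s, ∑ ω, prodWeight w ω * f k ω := by
  classical
  induction s using Finset.induction_on with
  | empty => simpa using sum_prodWeight hw
  | insert a s ha ih =>
    rw [Finset.prod_insert ha, ← ih fun k hk l hl => hA k (Finset.mem_insert_of_mem hk) l
      (Finset.mem_insert_of_mem hl)]
    simp only [Finset.prod_insert ha]
    refine sum_prodWeight_mul_mul hw (A a) (f a) (fun ω => ∏ k ∈ s, f k ω) (hf a) ?_
    intro ω ω' h
    refine Finset.prod_congr rfl fun k hk => hf k _ _ fun i hi => h i fun hi' => ?_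
    have hka : a ≠ k := fun h => ha (h ▸ hk)
    exact Set.disjoint_left.1 (hA a (Finset.mem_insert_self _ _) k (Finset.mem_insert_of_mem hk)
      hka) hi' hi

/-- An upper tail bound for a sum of Boolean functions `B k`, `k : Fin N`, of independent
variables, where `B k` and `B l` depend on disjoint sets of variables if `χ ≤ |k - l|`. -/
theorem sum_prodWeight_local_count [DecidableEq ι] {N : ℕ} {w : ι → Ω → ℝ}
    (hw : ∀ i, ∑ x, w i x = 1) (hw0 : ∀ i x, 0 ≤ w i x) (A : Fin N → Set ι)
    (B : Fin N → (ι → Ω) → Prop) [∀ k ω, Decidable (B k ω)]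
    (hB : ∀ k ω ω', (∀ i ∈ A k, ω i = ω' i) → (B k ω ↔ B k ω')) (χ : ℕ) (hχ : 0 < χ)
    (hA : ∀ k l : Fin N, (k : ℕ) + χ ≤ l → Disjoint (A k) (A l)) (μ : Fin N → ℝ)
    (hμ : ∀ k, ∑ ω, (if B k ω then prodWeight w ω else 0) ≤ μ k) (a : ℝ) :
    ∑ ω, (if 2 * ∑ k, μ k + χ * a < (({k | B k ω} : Finset (Fin N)).card : ℝ)
      then prodWeight w ω else 0) ≤ Real.exp (-a) := by
  classical
  have hμ0 : ∀ k, 0 ≤ μ k := fun k => (Finset.sum_nonneg fun ω _ => by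
    split_ifs
    exacts [prodWeight_nonneg hw0 ω, le_rfl]).trans (hμ k)
  -- Residue classes modulo `χ` serve as colours: distinct indices of one colour differ by at least
  -- `χ`, so their events are independent.
  let col : ℕ → Finset (Fin N) := fun r => Finset.univ.filter fun k => (k : ℕ) % χ = r
  let F : Fin N → (ι → Ω) → ℝ := fun k ω => if B k ω then Real.exp 1 else 1
  have hF0 : ∀ k ω, 0 ≤ F k ω := fun k ω => by
    simp only [F]; split_ifs <;> positivity
  -- The exponential moment is at most `1 + (e - 1) * μ k`, and `e - 1 ≤ 2`; this is the origin of
  -- the factor 2 in the threshold.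
  have hFmean : ∀ k, ∑ ω, prodWeight w ω * F k ω ≤ Real.exp (2 * μ k) := by
    intro k
    have h1 : ∑ ω, prodWeight w ω * F k ω =
        1 + (Real.exp 1 - 1) * ∑ ω, (if B k ω then prodWeight w ω else 0) := by
      have : ∀ ω, prodWeight w ω * F k ω = prodWeight w ω +
          (Real.exp 1 - 1) * if B k ω then prodWeight w ω else 0 := fun ω => by
        simp only [F]; split_ifs <;> ring
      simp_rw [this, Finset.sum_add_distrib, ← Finset.mul_sum, sum_prodWeight hw]
    have h2 : Real.exp 1 - 1 ≤ 2 := by linarith [Real.exp_one_lt_d9]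
    have h3 : 0 ≤ Real.exp 1 - 1 := by linarith [Real.add_one_le_exp (1 : ℝ)]
    have h4 := hμ k
    have h5 := Real.add_one_le_exp (2 * μ k)
    have h6 := hμ0 k
    rw [h1]
    nlinarith [mul_le_mul_of_nonneg_left h4 h3, mul_le_mul_of_nonneg_right h2 h6]
  have hcol : ∀ r, ∑ ω, prodWeight w ω * ∏ k ∈ col r, F k ω ≤
      Real.exp (2 * ∑ k ∈ col r, μ k) := by
    intro r
    rw [sum_prodWeight_mul_prod_finset hw A F _ (col r), Finset.mul_sum, Real.exp_sum]
    · exact Finset.prod_le_prod (fun k _ => Finset.sum_nonneg fun ω _ =>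
        mul_nonneg (prodWeight_nonneg hw0 ω) (hF0 k ω)) fun k _ => hFmean k
    · intro k hk l hl hkl
      simp only [col, Finset.mem_filter, Finset.mem_univ, true_and] at hk hl
      have hne : (k : ℕ) ≠ l := fun h => hkl (Fin.ext h)
      have key : ∀ x y : ℕ, x < y → x % χ = y % χ → x + χ ≤ y := by
        intro x y hxy h
        have : χ ∣ y - x := (Nat.modEq_iff_dvd' hxy.le).1 h
        have := Nat.le_of_dvd (by omega) this
        omega
      rcases lt_or_gt_of_ne hne with h | h
      · exact hA k l (key _ _ h (hk.trans hl.symm))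
      · exact (hA l k (key _ _ h (hl.trans hk.symm))).symm
    · intro k ω ω' h
      simp only [F, hB k ω ω' h]
  have hχ' : (0 : ℝ) < χ := by exact_mod_cast hχ
  have hpart : ∀ g : Fin N → ℝ, ∑ k, g k = ∑ r ∈ Finset.range χ, ∑ k ∈ col r, g k := by
    intro g
    exact (Finset.sum_fiberwise_of_maps_to (fun k _ => Finset.mem_range.2 (Nat.mod_lt _ hχ)) g).symm
  have hpt : ∀ ω, (if 2 * ∑ k, μ k + χ * a < (({k | B k ω} : Finset (Fin N)).card : ℝ)
      then prodWeight w ω else 0) ≤ Real.exp (-a) * ∑ r ∈ Finset.range χ,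
        (1 / χ : ℝ) * (Real.exp (-(2 * ∑ k ∈ col r, μ k)) *
          (prodWeight w ω * ∏ k ∈ col r, F k ω)) := by
    intro ω
    have hprod : ∀ r, ∏ k ∈ col r, F k ω = Real.exp (∑ k ∈ col r, if B k ω then 1 else 0) := by
      intro r
      rw [Real.exp_sum]
      exact Finset.prod_congr rfl fun k _ => by simp only [F]; split_ifs <;> simp
    split_ifs with h
    -- Colours are not independent of each other. Convexity of the exponential, averaged over the
    -- colours, reduces the tail to the mean of the colourwise moments, at the price of the factor
    -- `χ` in front of `a`.
    · have hJ := convexOn_exp.map_sum_le (t := Finset.range χ) (w := fun _ => (1 / χ : ℝ))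
        (p := fun r => (∑ k ∈ col r, if B k ω then (1 : ℝ) else 0) - 2 * ∑ k ∈ col r, μ k)
        (fun _ _ => by positivity) (by simp; field_simp) (fun _ _ => Set.mem_univ _)
      simp only [smul_eq_mul] at hJ
      have hcard : (({k | B k ω} : Finset (Fin N)).card : ℝ) =
          ∑ r ∈ Finset.range χ, ∑ k ∈ col r, if B k ω then (1 : ℝ) else 0 := by
        rw [← hpart, Finset.sum_boole]
      have hlow : Real.exp a ≤ ∑ r ∈ Finset.range χ, (1 / χ : ℝ) *
          Real.exp ((∑ k ∈ col r, if B k ω then (1 : ℝ) else 0) - 2 * ∑ k ∈ col r, μ k) := by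
        refine le_trans (Real.exp_le_exp.2 ?_) hJ
        rw [← Finset.mul_sum, Finset.sum_sub_distrib, ← Finset.mul_sum, ← hcard, ← hpart μ]
        rw [one_div, inv_mul_eq_div, le_div_iff₀ hχ']
        linarith
      have : prodWeight w ω = Real.exp (-a) * (Real.exp a * prodWeight w ω) := by
        rw [← mul_assoc, ← Real.exp_add]; simp
      conv_lhs => rw [this]
      refine mul_le_mul_of_nonneg_left ?_ (Real.exp_pos _).le
      refine (mul_le_mul_of_nonneg_right hlow (prodWeight_nonneg hw0 ω)).trans_eq ?_
      rw [Finset.sum_mul]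
      refine Finset.sum_congr rfl fun r _ => ?_
      rw [hprod, sub_eq_neg_add, Real.exp_add]
      ring
    · refine mul_nonneg (Real.exp_pos _).le (Finset.sum_nonneg fun r _ => ?_)
      have := Finset.prod_nonneg fun k (_ : k ∈ col r) => hF0 k ω
      have := prodWeight_nonneg hw0 ω
      positivity
  refine (Finset.sum_le_sum fun ω _ => hpt ω).trans ?_
  rw [← Finset.mul_sum, Finset.sum_comm]
  refine mul_le_of_le_one_right (Real.exp_pos _).le ?_
  calc _ ≤ ∑ r ∈ Finset.range χ, (1 / χ : ℝ) * 1 := by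
        refine Finset.sum_le_sum fun r _ => ?_
        rw [← Finset.mul_sum, ← Finset.mul_sum]
        refine mul_le_mul_of_nonneg_left ?_ (by positivity)
        refine (mul_le_mul_of_nonneg_left (hcol r) (Real.exp_pos _).le).trans_eq ?_
        rw [← Real.exp_add]; simp
    _ = 1 := by simp; field_simp

end FiniteProduct

/-! ### The observation law as a finite weight -/

section Law

instance : MeasurableSingletonClass ℤˣ :=
  ⟨fun x => ⟨{(x : ℤ)}, measurableSet_singleton _, by ext y; simp [Units.ext_iff]⟩⟩

/-- The weight of `x` under `flipLaw r y`. -/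
def flipWeight (r : ℝ) (y x : ℤˣ) : ℝ := if x = y then 1 - r else r

theorem Int.units_neg_ne (y : ℤˣ) : -y ≠ y := by
  rcases Int.units_eq_one_or y with rfl | rfl <;> decide

theorem Int.units_ne_iff_eq_neg' (x y : ℤˣ) : x ≠ y ↔ x = -y := Int.units_ne_iff_eq_neg

theorem Int.units_sum_univ (y : ℤˣ) (f : ℤˣ → ℝ) : ∑ x, f x = f y + f (-y) := by
  have : (Finset.univ : Finset ℤˣ) = {1, -1} := by decide
  rw [this, Finset.sum_pair (by decide)]
  rcases Int.units_eq_one_or y with rfl | rfl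
  · rfl
  · simp [add_comm]

theorem sum_flipWeight_mul (r : ℝ) (y : ℤˣ) (f : ℤˣ → ℝ) :
    ∑ x, flipWeight r y x * f x = (1 - r) * f y + r * f (-y) := by
  rw [Int.units_sum_univ y]
  simp [flipWeight]

theorem sum_flipWeight (r : ℝ) (y : ℤˣ) : ∑ x, flipWeight r y x = 1 := by
  simpa using sum_flipWeight_mul r y fun _ => 1

theorem flipWeight_nonneg {r : ℝ} (h₀ : 0 ≤ r) (h₁ : r ≤ 1) (y x : ℤˣ) :
    0 ≤ flipWeight r y x := by
  unfold flipWeight; split_ifs <;> linarith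

theorem isProbabilityMeasure_flipLaw {r : ℝ} (h₀ : 0 ≤ r) (h₁ : r ≤ 1) (y : ℤˣ) :
    IsProbabilityMeasure (flipLaw r y) := by
  constructor
  simp only [flipLaw, Measure.coe_add, Measure.coe_smul, Pi.add_apply, Pi.smul_apply,
    measure_univ, smul_eq_mul, mul_one]
  rw [← ENNReal.ofReal_add (by linarith) h₀]
  simp

theorem flipLaw_real_singleton {r : ℝ} (h₀ : 0 ≤ r) (h₁ : r ≤ 1) (y x : ℤˣ) :
    (flipLaw r y).real {x} = flipWeight r y x := by
  unfold Measure.real flipLaw flipWeight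
  simp only [Measure.coe_add, Measure.coe_smul, Pi.add_apply, Pi.smul_apply,
    smul_eq_mul, Measure.dirac_apply' _ (measurableSet_singleton x)]
  split_ifs with h
  · subst h
    simp [h₁]
  · have h' : -y = x := by rw [(Int.units_ne_iff_eq_neg' _ _).1 h]
    have h'' : ¬ y = x := fun h' => h h'.symm
    simp [h', h'', h₀]

variable {V : Type} [Fintype V] (G : SimpleGraph V) {p q : ℝ} (Y : V → ℤˣ)

theorem isProbabilityMeasure_obsLaw (hp : 0 ≤ p) (hp1 : p ≤ 1) (hq : 0 ≤ q) (hq1 : q ≤ 1) :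
    IsProbabilityMeasure (obsLaw G p q Y) := by
  have := fun y => isProbabilityMeasure_flipLaw hp hp1 y
  have := fun y => isProbabilityMeasure_flipLaw hq hq1 y
  unfold obsLaw
  infer_instance

open Classical in
/-- The weight of the edge labels `X`. -/
noncomputable def edgeWeight (p : ℝ) (X : G.edgeSet → ℤˣ) : ℝ :=
  prodWeight (fun e => flipWeight p (edgeSign Y e.1)) X

/-- The weight of the vertex labels `Z`. -/
def vertexWeight (q : ℝ) (Z : V → ℤˣ) : ℝ := prodWeight (fun v => flipWeight q (Y v)) Z

open Classical in
theorem obsLaw_real_singleton (hp : 0 ≤ p) (hp1 : p ≤ 1) (hq : 0 ≤ q) (hq1 : q ≤ 1)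
    (ω : Observation G) :
    (obsLaw G p q Y).real {ω} = edgeWeight G Y p ω.1 * vertexWeight Y q ω.2 := by
  have := fun y => isProbabilityMeasure_flipLaw hp hp1 y
  have := fun y => isProbabilityMeasure_flipLaw hq hq1 y
  obtain ⟨X, Z⟩ := ω
  unfold obsLaw Measure.real
  rw [← Set.singleton_prod_singleton, Measure.prod_prod, Measure.pi_singleton,
    Measure.pi_singleton, ENNReal.toReal_mul, ENNReal.toReal_prod, ENNReal.toReal_prod]
  congr 1
  · exact Finset.prod_congr rfl fun e _ => flipLaw_real_singleton hp hp1 _ _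
  · exact Finset.prod_congr rfl fun e _ => flipLaw_real_singleton hq hq1 _ _

open Classical in
theorem edgeWeight_nonneg (hp : 0 ≤ p) (hp1 : p ≤ 1) (X : G.edgeSet → ℤˣ) :
    0 ≤ edgeWeight G Y p X :=
  prodWeight_nonneg (fun _ _ => flipWeight_nonneg hp hp1 _ _) X

theorem vertexWeight_nonneg (hq : 0 ≤ q) (hq1 : q ≤ 1) (Z : V → ℤˣ) :
    0 ≤ vertexWeight Y q Z :=
  prodWeight_nonneg (fun _ _ => flipWeight_nonneg hq hq1 _ _) Z

variable [DecidableEq V]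

open Classical in
theorem sum_edgeWeight : ∑ X : G.edgeSet → ℤˣ, edgeWeight G Y p X = 1 :=
  sum_prodWeight fun _ => sum_flipWeight _ _

theorem sum_vertexWeight : ∑ Z : V → ℤˣ, vertexWeight Y q Z = 1 :=
  sum_prodWeight fun _ => sum_flipWeight _ _

open Classical in
theorem integral_obsLaw (hp : 0 ≤ p) (hp1 : p ≤ 1) (hq : 0 ≤ q) (hq1 : q ≤ 1)
    (f : Observation G → ℝ) :
    ∫ ω, f ω ∂(obsLaw G p q Y) =
      ∑ X : G.edgeSet → ℤˣ, ∑ Z : V → ℤˣ, edgeWeight G Y p X * vertexWeight Y q Z * f (X, Z) := by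
  have := isProbabilityMeasure_obsLaw G Y hp hp1 hq hq1
  rw [integral_fintype (Integrable.of_finite), Fintype.sum_prod_type]
  simp_rw [obsLaw_real_singleton G Y hp hp1 hq hq1, smul_eq_mul]

open Classical in
-- A union bound: pointwise, the indicator of `good` is at least 1 minus the indicators of `A` and
-- `B`. Each bad event involves only one kind of observation, so the other factor of the weight sums
-- to 1.
theorem obsLaw_real_union_le (hp : 0 ≤ p) (hp1 : p ≤ 1) (hq : 0 ≤ q) (hq1 : q ≤ 1)
    (A : (G.edgeSet → ℤˣ) → Prop) [DecidablePred A]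
    (B : (V → ℤˣ) → Prop) [DecidablePred B] (good : Set (Observation G))
    (h : ∀ X Z, ¬ A X → ¬ B Z → (X, Z) ∈ good) :
    1 - (∑ X, if A X then edgeWeight G Y p X else 0) -
      (∑ Z, if B Z then vertexWeight Y q Z else 0) ≤ (obsLaw G p q Y).real good := by
  have := isProbabilityMeasure_obsLaw G Y hp hp1 hq hq1
  have hind := integral_indicator_one (μ := obsLaw G p q Y) (Set.toFinite good).measurableSet
  rw [← hind, integral_obsLaw G Y hp hp1 hq hq1]
  have e1 : (1 : ℝ) = ∑ X : G.edgeSet → ℤˣ, ∑ Z : V → ℤˣ,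
      edgeWeight G Y p X * vertexWeight Y q Z := by
    rw [← Finset.sum_mul_sum, sum_edgeWeight, sum_vertexWeight, one_mul]
  have e2 : (∑ X, if A X then edgeWeight G Y p X else 0) = ∑ X : G.edgeSet → ℤˣ, ∑ Z : V → ℤˣ,
      (if A X then edgeWeight G Y p X else 0) * vertexWeight Y q Z := by
    rw [← Finset.sum_mul_sum, sum_vertexWeight, mul_one]
  have e3 : (∑ Z, if B Z then vertexWeight Y q Z else 0) = ∑ X : G.edgeSet → ℤˣ, ∑ Z : V → ℤˣ,
      edgeWeight G Y p X * (if B Z then vertexWeight Y q Z else 0) := by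
    rw [← Finset.sum_mul_sum, sum_edgeWeight, one_mul]
  rw [e1, e2, e3, ← Finset.sum_sub_distrib, ← Finset.sum_sub_distrib]
  refine Finset.sum_le_sum fun X _ => ?_
  rw [← Finset.sum_sub_distrib, ← Finset.sum_sub_distrib]
  refine Finset.sum_le_sum fun Z _ => ?_
  have h1 := edgeWeight_nonneg G Y hp hp1 X
  have h2 := vertexWeight_nonneg Y hq hq1 Z
  have h3 := mul_nonneg h1 h2
  have h4 : 0 ≤ good.indicator (1 : Observation G → ℝ) (X, Z) :=
    Set.indicator_nonneg (fun _ _ => zero_le_one) _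
  have h5 := mul_nonneg h3 h4
  by_cases hA : A X <;> by_cases hB : B Z <;> simp only [hA, hB, if_true, if_false]
  · linarith
  · linarith
  · linarith
  · rw [Set.indicator_of_mem (h X Z hA hB)]
    simp
end Law

/-! ### Lower bounds -/

section LowerBound

variable {V : Type} [DecidableEq V] (G : SimpleGraph V) {p q : ℝ}

/-- Domination of product laws may be checked coordinate by coordinate. -/
theorem prod_mul_prodWeight_le {ι Ω : Type*} [Fintype ι] {w w' : ι → Ω → ℝ} {k : ι → ℝ}
    (hk : ∀ i, 0 ≤ k i) (hw' : ∀ i x, 0 ≤ w' i x) (h : ∀ i x, k i * w' i x ≤ w i x) (ω : ι → Ω) :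
    (∏ i, k i) * prodWeight w' ω ≤ prodWeight w ω := by
  unfold prodWeight
  rw [← Finset.prod_mul_distrib]
  exact Finset.prod_le_prod (fun i _ => mul_nonneg (hk i) (hw' i _)) fun i _ => h i _

/-- The labeling with the label of `v` changed. -/
def flipAt (Y : V → ℤˣ) (v : V) : V → ℤˣ := Function.update Y v (-Y v)

theorem flipAt_self (Y : V → ℤˣ) (v : V) : flipAt Y v v = -Y v := by simp [flipAt]

theorem flipAt_of_ne (Y : V → ℤˣ) {u v : V} (h : u ≠ v) : flipAt Y v u = Y u := by
  simp [flipAt, h]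

theorem flipAt_involutive (v : V) : Function.Involutive fun Y : V → ℤˣ => flipAt Y v := by
  intro Y
  funext u
  by_cases h : u = v
  · subst h; simp [flipAt]
  · simp [flipAt, h]

theorem edgeSign_flipAt_of_mem (Y : V → ℤˣ) {v : V} {e : Sym2 V} (he : e ∈ G.edgeSet)
    (hv : v ∈ e) : edgeSign (flipAt Y v) e = -edgeSign Y e := by
  obtain ⟨u, rfl⟩ := Sym2.mem_iff_exists.1 hv
  have : u ≠ v := (G.ne_of_adj ((SimpleGraph.mem_edgeSet G).1 he)).symm
  simp [edgeSign, Sym2.mul, flipAt_self, flipAt_of_ne Y this]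

theorem edgeSign_flipAt_of_notMem (Y : V → ℤˣ) {v : V} {e : Sym2 V} (hv : v ∉ e) :
    edgeSign (flipAt Y v) e = edgeSign Y e := by
  induction e with
  | h a b =>
    simp only [Sym2.mem_iff, not_or] at hv
    simp [edgeSign, Sym2.mul, flipAt_of_ne Y (Ne.symm hv.1), flipAt_of_ne Y (Ne.symm hv.2)]

variable [Fintype V]

/-- The probability, under a randomized estimate, that the label of `v` differs from `a`. -/
noncomputable def labelError (est : Observation G → PMF (V → ℤˣ)) (v : V) (a : ℤˣ)
    (ω : Observation G) : ℝ := ∑ y : V → ℤˣ, (est ω y).toReal * if y v ≠ a then 1 else 0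

theorem labelError_add_neg (est : Observation G → PMF (V → ℤˣ)) (v : V) (a : ℤˣ)
    (ω : Observation G) : labelError G est v a ω + labelError G est v (-a) ω = 1 := by
  have h1 : ∑ y : V → ℤˣ, (est ω y).toReal = 1 := by
    rw [← ENNReal.toReal_sum fun y _ => (est ω).apply_ne_top y, ← tsum_fintype (L := .unconditional _),
      (est ω).tsum_coe, ENNReal.toReal_one]
  rw [← h1]
  unfold labelError
  rw [← Finset.sum_add_distrib]
  refine Finset.sum_congr rfl fun y _ => ?_
  by_cases h : y v = a
  · simp [h, (Int.units_neg_ne a).symm]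
  · have := (Int.units_ne_iff_eq_neg' _ _).1 h
    simp [this, Int.units_neg_ne a]

theorem labelError_nonneg (est : Observation G → PMF (V → ℤˣ)) (v : V) (a : ℤˣ)
    (ω : Observation G) : 0 ≤ labelError G est v a ω :=
  Finset.sum_nonneg fun y _ => by positivity

open Classical in
/-- The probability that the label of `v` is wrong. -/
noncomputable def vertexError (p q : ℝ) (est : Observation G → PMF (V → ℤˣ)) (Y : V → ℤˣ)
    (v : V) : ℝ :=
  ∑ X : G.edgeSet → ℤˣ, ∑ Z : V → ℤˣ,
    edgeWeight G Y p X * vertexWeight Y q Z * labelError G est v (Y v) (X, Z)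

theorem expectedError_eq_sum (hp : 0 ≤ p) (hp1 : p ≤ 1) (hq : 0 ≤ q) (hq1 : q ≤ 1)
    (est : Observation G → PMF (V → ℤˣ)) (Y : V → ℤˣ) :
    expectedError G p q est Y = ∑ v, vertexError G p q est Y v := by
  classical
  have h : ∀ ω, ∑ y : V → ℤˣ, (est ω y).toReal * (hammingDist y Y : ℝ) =
      ∑ v, labelError G est v (Y v) ω := by
    intro ω
    unfold labelError
    rw [Finset.sum_comm]
    refine Finset.sum_congr rfl fun y _ => ?_
    rw [← Finset.mul_sum, hammingDist, Finset.sum_boole]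
  unfold expectedError vertexError
  simp_rw [h]
  rw [integral_obsLaw G Y hp hp1 hq hq1]
  refine Eq.trans (Finset.sum_congr rfl fun X _ => ?_) Finset.sum_comm
  refine Eq.trans (Finset.sum_congr rfl fun Z _ => ?_) Finset.sum_comm
  rw [Finset.mul_sum]

open Classical in
-- A two-point argument. Both laws dominate the same multiple of a common law, and on every
-- observation the probabilities of missing `Y v` and of missing `-Y v` add up to 1.
theorem vertexError_add_flip (hp : 0 < p) (hp2 : p < 1 / 2) (hq : 0 < q) (hq2 : q < 1 / 2)
    (est : Observation G → PMF (V → ℤˣ)) (Y : V → ℤˣ) (v : V) (h : ℕ)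
    (hd : {e : G.edgeSet | v ∈ e.1}.ncard ≤ 2 * h) :
    2 * q * (p ^ h * (1 / 2) ^ h) ≤
      vertexError G p q est Y v + vertexError G p q est (flipAt Y v) v := by
  rw [Set.ncard_eq_toFinset_card', Set.toFinset_ofPred] at hd
  set I := Finset.univ.filter fun e : G.edgeSet => v ∈ e.1 with hI
  -- The common law flips the edges in `A`, half of those at `v`, and no others at `v`. For the
  -- modified truth the roles of `A` and `I \ A` are exchanged, so an even split costs about the
  -- same factor for both truths.
  obtain ⟨A, hAI, hAc⟩ := Finset.exists_subset_card_eq (s := I) (n := I.card / 2) (by omega)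
  have hA : A.card ≤ h := by omega
  have hB : (I \ A).card ≤ h := by rw [Finset.card_sdiff_of_subset hAI]; omega
  let wX : G.edgeSet → ℤˣ → ℝ := fun e x =>
    if e ∈ A then (if x = -edgeSign Y e.1 then 1 else 0)
    else if e ∈ I then (if x = edgeSign Y e.1 then 1 else 0)
    else flipWeight p (edgeSign Y e.1) x
  let wZ : V → ℤˣ → ℝ := fun u x => if u = v then 1 / 2 else flipWeight q (Y u) x
  have hwX0 : ∀ e x, 0 ≤ wX e x := fun e x => by
    have := flipWeight_nonneg hp.le (by linarith : p ≤ 1) (edgeSign Y e.1) x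
    simp only [wX]; split_ifs <;> positivity
  have hwZ0 : ∀ e x, 0 ≤ wZ e x := fun e x => by
    have := flipWeight_nonneg hq.le (by linarith : q ≤ 1) (Y e) x
    simp only [wZ]; split_ifs <;> positivity
  have hwX1 : ∀ e, ∑ x, wX e x = 1 := fun e => by
    simp only [wX]
    split_ifs
    · rw [Finset.sum_ite_eq', if_pos (Finset.mem_univ _)]
    · rw [Finset.sum_ite_eq', if_pos (Finset.mem_univ _)]
    · exact sum_flipWeight _ _
  have hwZ1 : ∀ e, ∑ x, wZ e x = 1 := fun e => by
    simp only [wZ]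
    split_ifs
    · rw [Int.units_sum_univ 1]; norm_num
    · exact sum_flipWeight _ _
  have hdisj : Disjoint A (I \ A) := Finset.disjoint_sdiff
  have hkprod : ∀ (S T : Finset G.edgeSet), Disjoint S T → S.card ≤ h → T.card ≤ h →
      p ^ h * (1 / 2) ^ h ≤ ∏ e, (if e ∈ S then p else if e ∈ T then 1 / 2 else 1 : ℝ) := by
    intro S T hST hS hT
    have : ∏ e, (if e ∈ S then p else if e ∈ T then 1 / 2 else 1 : ℝ) =
        ∏ e, ((if e ∈ S then p else 1) * if e ∈ T then 1 / 2 else 1 : ℝ) := by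
      refine Finset.prod_congr rfl fun e _ => ?_
      by_cases h1 : e ∈ S
      · simp [h1, Finset.disjoint_left.1 hST h1]
      · simp [h1]
    rw [this, Finset.prod_mul_distrib, Finset.prod_ite_mem, Finset.prod_ite_mem,
      Finset.univ_inter, Finset.univ_inter, Finset.prod_const, Finset.prod_const]
    exact mul_le_mul (pow_le_pow_of_le_one hp.le (by linarith) hS)
      (pow_le_pow_of_le_one (by norm_num) (by norm_num) hT) (by positivity) (by positivity)
  have hX : ∀ X : G.edgeSet → ℤˣ, p ^ h * (1 / 2) ^ h * prodWeight wX X ≤ edgeWeight G Y p X := by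
    intro X
    refine (mul_le_mul_of_nonneg_right (hkprod A (I \ A) hdisj hA hB)
      (prodWeight_nonneg hwX0 X)).trans ?_
    refine prod_mul_prodWeight_le (fun e => by split_ifs <;> positivity) hwX0 (fun e x => ?_) X
    simp only [wX, Finset.mem_sdiff, flipWeight]
    by_cases h1 : e ∈ A
    · simp only [h1, if_true]
      by_cases hx : x = -edgeSign Y e.1
      · simp [hx]
      · simp only [hx, if_false]; split_ifs <;> linarith
    · by_cases h2 : e ∈ I
      · simp only [h1, h2, if_true, if_false, not_false_eq_true, and_true]
        split_ifs <;> linarith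
      · simp [h1, h2]
  -- Changing the label of `v` reverses the correct sign of every incident edge, so the edges of `I
  -- \ A` now pay the factor `p` and those of `A` the factor `1 / 2 ≤ 1 - p`.
  have hX' : ∀ X : G.edgeSet → ℤˣ, p ^ h * (1 / 2) ^ h * prodWeight wX X ≤
      edgeWeight G (flipAt Y v) p X := by
    intro X
    refine (mul_le_mul_of_nonneg_right (hkprod (I \ A) A hdisj.symm hB hA)
      (prodWeight_nonneg hwX0 X)).trans ?_
    refine prod_mul_prodWeight_le (fun e => by split_ifs <;> positivity) hwX0 (fun e x => ?_) X
    simp only [wX, Finset.mem_sdiff, flipWeight]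
    by_cases h2 : e ∈ I
    · have hs := edgeSign_flipAt_of_mem G Y e.2 (Finset.mem_filter.1 h2).2
      rw [hs]
      by_cases h1 : e ∈ A
      · simp only [h1, h2, if_true, if_false, not_true_eq_false, and_false]
        split_ifs <;> linarith
      · simp only [h1, h2, if_true, if_false, not_false_eq_true, and_true]
        by_cases hx : x = edgeSign Y e.1
        · simp [hx, (Int.units_neg_ne _).symm]
        · simp only [hx, if_false]; split_ifs <;> linarith
    · have h1 : e ∉ A := fun h => h2 (hAI h)
      have hs := edgeSign_flipAt_of_notMem (v := v) Y (e := e.1) fun hv => h2 (by simp [hI, hv])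
      simp [h1, h2, hs]
  -- The uniform label at `v` has density `1 / 2`, and `2 * q * (1 / 2) = q` is a lower bound for
  -- both `q` and `1 - q`.
  have hZgen : ∀ (Y' : V → ℤˣ), (∀ u, u ≠ v → Y' u = Y u) → ∀ Z,
      2 * q * prodWeight wZ Z ≤ vertexWeight Y' q Z := by
    intro Y' hY' Z
    have hk : ∏ u, (if u = v then 2 * q else 1) = 2 * q := by simp
    rw [← hk]
    refine prod_mul_prodWeight_le (fun e => by split_ifs <;> positivity) hwZ0 (fun u x => ?_) Z
    simp only [wZ, flipWeight]
    by_cases hu : u = v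
    · simp only [hu, if_true]; split_ifs <;> linarith
    · simp [hu, hY' u hu]
  have hZ := hZgen Y fun _ _ => rfl
  have hZ' := hZgen (flipAt Y v) fun u hu => flipAt_of_ne Y hu
  have hone : 2 * q * (p ^ h * (1 / 2) ^ h) = ∑ X : G.edgeSet → ℤˣ, ∑ Z : V → ℤˣ,
      (p ^ h * (1 / 2) ^ h * prodWeight wX X) * (2 * q * prodWeight wZ Z) := by
    rw [← Finset.sum_mul_sum, ← Finset.mul_sum, ← Finset.mul_sum, sum_prodWeight hwX1,
      sum_prodWeight hwZ1]
    ring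
  rw [hone]
  unfold vertexError
  rw [← Finset.sum_add_distrib]
  refine Finset.sum_le_sum fun X _ => ?_
  rw [← Finset.sum_add_distrib]
  refine Finset.sum_le_sum fun Z _ => ?_
  have hx := prodWeight_nonneg hwX0 X
  have hz := prodWeight_nonneg hwZ0 Z
  have a1 := mul_le_mul (hX X) (hZ Z) (by positivity) (edgeWeight_nonneg G Y hp.le (by linarith) X)
  have a2 := mul_le_mul (hX' X) (hZ' Z) (by positivity)
    (edgeWeight_nonneg G (flipAt Y v) hp.le (by linarith) X)
  have e1 := labelError_nonneg G est v (Y v) (X, Z)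
  have e2 := labelError_nonneg G est v (-Y v) (X, Z)
  have e3 := labelError_add_neg G est v (Y v) (X, Z)
  rw [flipAt_self]
  calc _ = (p ^ h * (1 / 2) ^ h * prodWeight wX X) * (2 * q * prodWeight wZ Z) *
        (labelError G est v (Y v) (X, Z) + labelError G est v (-Y v) (X, Z)) := by
        rw [e3, mul_one]
    _ ≤ _ := by
        rw [mul_add]
        exact add_le_add (mul_le_mul_of_nonneg_right a1 e1) (mul_le_mul_of_nonneg_right a2 e2)

/-- In a graph of maximum degree at most `2 * h`, no estimator has an expected error below
`q * (p / 2) ^ h` per vertex for all ground truths. -/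
theorem exists_le_expectedError (hp : 0 < p) (hp2 : p < 1 / 2) (hq : 0 < q) (hq2 : q < 1 / 2)
    (est : Observation G → PMF (V → ℤˣ)) (h : ℕ)
    (hd : ∀ v, {e : G.edgeSet | v ∈ e.1}.ncard ≤ 2 * h) :
    ∃ Y, q * (p ^ h * (1 / 2) ^ h) * Fintype.card V ≤ expectedError G p q est Y := by
  have hsum : ∀ v, (Finset.univ : Finset (V → ℤˣ)).card • (q * (p ^ h * (1 / 2) ^ h)) ≤
      ∑ Y, vertexError G p q est Y v := by
    intro v
    -- Changing the label at `v` permutes the truths, so the sum of the two errors over all truths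
    -- is twice the sum of one of them.
    have h1 := Equiv.sum_comp (flipAt_involutive v).toPerm fun Y => vertexError G p q est Y v
    have h2 := Finset.sum_le_sum fun Y (_ : Y ∈ Finset.univ) =>
      vertexError_add_flip G hp hp2 hq hq2 est Y v h (hd v)
    rw [Finset.sum_add_distrib, Finset.sum_const] at h2
    simp only [Function.Involutive.coe_toPerm] at h1
    rw [h1] at h2
    simp only [nsmul_eq_mul] at h2 ⊢
    linarith
  have hle : ∑ _Y : V → ℤˣ, q * (p ^ h * (1 / 2) ^ h) * Fintype.card V ≤
      ∑ Y, expectedError G p q est Y := by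
    simp_rw [expectedError_eq_sum G hp.le (by linarith : p ≤ 1) hq.le (by linarith : q ≤ 1)]
    rw [Finset.sum_comm]
    refine le_trans (le_of_eq ?_) (Finset.sum_le_sum fun v _ => hsum v)
    simp only [Finset.sum_const, nsmul_eq_mul, Finset.card_univ]
    ring
  obtain ⟨Y, -, hY⟩ := Finset.exists_le_of_sum_le Finset.univ_nonempty hle
  exact ⟨Y, hY⟩

end LowerBound

/-! ### Vertex degrees of the grid and the two lower bounds. -/

section GridLowerBound

theorem grid_adj_iff {c m : ℕ} (u v : Fin c × Fin m) : (grid c m).Adj u v ↔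
    ((u.1 : ℕ) = v.1 ∧ ((u.2 : ℕ) + 1 = v.2 ∨ (v.2 : ℕ) + 1 = u.2)) ∨
      ((u.2 : ℕ) = v.2 ∧ ((u.1 : ℕ) + 1 = v.1 ∨ (v.1 : ℕ) + 1 = u.1)) := by
  simp only [grid, SimpleGraph.boxProd_adj, SimpleGraph.pathGraph_adj, ← Fin.val_inj]
  tauto

theorem card_incident_le {V : Type} [Fintype V] (G : SimpleGraph V) (v : V) {α : Type*}
    (s : Finset α) (f : V → α) (hf : ∀ u, G.Adj v u → f u ∈ s)
    (hinj : ∀ u w, G.Adj v u → G.Adj v w → f u = f w → u = w) :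
    {e : G.edgeSet | v ∈ e.1}.ncard ≤ s.card := by
  have hex : ∀ e : G.edgeSet, v ∈ e.1 → ∃ u, e.1 = s(v, u) ∧ G.Adj v u := by
    rintro ⟨e, he⟩ hv
    obtain ⟨u, rfl⟩ := Sym2.mem_iff_exists.1 hv
    exact ⟨u, rfl, he⟩
  have : Nonempty V := ⟨v⟩
  choose! g hg using hex
  rw [← Set.ncard_coe_finset]
  refine Set.ncard_le_ncard_of_injOn (fun e => f (g e)) (fun e he => ?_) ?_
  · exact hf _ (hg e (by simpa using he)).2
  · intro e he e' he' h
    have h1 := hg e (by simpa using he)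
    have h2 := hg e' (by simpa using he')
    have := hinj _ _ h1.2 h2.2 h
    exact Subtype.ext (by rw [h1.1, h2.1, this])

theorem grid_card_incident_le {c m : ℕ} (v : Fin c × Fin m) :
    {e : (grid c m).edgeSet | v ∈ e.1}.ncard ≤ 4 := by
  refine (card_incident_le (grid c m) v ({(0, 1), (0, -1), (1, 0), (-1, 0)} : Finset (ℤ × ℤ))
    (fun u => ((u.1 : ℤ) - v.1, (u.2 : ℤ) - v.2)) ?_ ?_).trans Finset.card_le_four
  · intro u hu
    rw [grid_adj_iff] at hu
    simp only [Finset.mem_insert, Finset.mem_singleton, Prod.mk.injEq]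
    omega
  · intro u w _ _ h
    simp only [Prod.mk.injEq] at h
    exact Prod.ext (Fin.ext (by omega)) (Fin.ext (by omega))

theorem grid_one_card_incident_le {m : ℕ} (v : Fin 1 × Fin m) :
    {e : (grid 1 m).edgeSet | v ∈ e.1}.ncard ≤ 2 := by
  refine (card_incident_le (grid 1 m) v ({1, -1} : Finset ℤ)
    (fun u => ((u.2 : ℤ) - v.2)) ?_ ?_).trans Finset.card_le_two
  · intro u hu
    rw [grid_adj_iff] at hu
    simp only [Finset.mem_insert, Finset.mem_singleton]
    omega
  · intro u w _ _ h
    exact Prod.ext (Fin.ext (by omega)) (Fin.ext (by omega))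

theorem grid_exists_le_expectedError (c m : ℕ) {p q : ℝ} (hp : 0 < p) (hpq : p < q)
    (hq : q < 1 / 2) (est : Observation (grid c m) → PMF (Fin c × Fin m → ℤˣ)) :
    ∃ Y, 1 / 4 * q * p ^ 2 * ((c : ℝ) * m) ≤ expectedError (grid c m) p q est Y := by
  obtain ⟨Y, hY⟩ := exists_le_expectedError (grid c m) hp (by linarith) (by linarith) hq est 2
    fun v => grid_card_incident_le v
  refine ⟨Y, le_trans (le_of_eq ?_) hY⟩
  simp only [Fintype.card_prod, Fintype.card_fin]
  push_cast
  ring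

theorem grid_one_exists_le_expectedError (n : ℕ) {p q : ℝ} (hp : 0 < p) (hpq : p < q)
    (hq : q < 1 / 2) (est : Observation (grid 1 n) → PMF (Fin 1 × Fin n → ℤˣ)) :
    ∃ Y, 1 / 4 * q * p * (n : ℝ) ≤ expectedError (grid 1 n) p q est Y := by
  obtain ⟨Y, hY⟩ := exists_le_expectedError (grid 1 n) hp (by linarith) (by linarith) hq est 1
    fun v => grid_one_card_incident_le v
  refine ⟨Y, le_trans ?_ hY⟩
  simp only [Fintype.card_prod, Fintype.card_fin]
  have hq0 := hp.trans hpq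
  have : 0 ≤ q * p * n := by positivity
  push_cast
  linarith

end GridLowerBound

/-! ### Sign vectors on a path -/

section PathSigns

/-- Once the first sign is fixed, each of the `n` steps independently keeps the sign, with weight 1,
or changes it, with weight `x`. -/
theorem sum_path_sign_weight (x : ℝ) (n : ℕ) (a : ℤˣ) :
    ∑ τ : Fin (n + 1) → ℤˣ, (if τ 0 = a then
      ∏ j : Fin n, (if τ j.castSucc ≠ τ j.succ then x else 1) else 0) = (1 + x) ^ n := by
  induction n generalizing a with
  | zero =>
    rw [← (Equiv.funUnique (Fin 1) ℤˣ).symm.sum_comp]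
    rw [Int.units_sum_univ a]
    simp [Equiv.funUnique]
  | succ n ih =>
    rw [← (Fin.consEquiv fun _ : Fin (n + 2) => ℤˣ).sum_comp, Fintype.sum_prod_type,
      Finset.sum_eq_single a]
    · have : ∀ τ : Fin (n + 1) → ℤˣ, (if (Fin.consEquiv fun _ : Fin (n + 2) => ℤˣ) (a, τ) 0 = a then
          ∏ j : Fin (n + 1), (if (Fin.consEquiv fun _ : Fin (n + 2) => ℤˣ) (a, τ) j.castSucc ≠
            (Fin.consEquiv fun _ : Fin (n + 2) => ℤˣ) (a, τ) j.succ then x else 1) else 0) =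
          (if τ 0 = a then ∏ j : Fin n, (if τ j.castSucc ≠ τ j.succ then x else 1) else 0) +
          x * (if τ 0 = -a then ∏ j : Fin n, (if τ j.castSucc ≠ τ j.succ then x else 1) else 0) := by
        intro τ
        have h0 : ∀ τ : Fin (n + 1) → ℤˣ,
            (Fin.consEquiv fun _ : Fin (n + 2) => ℤˣ) (a, τ) = Fin.cons a τ := fun _ => rfl
        rw [h0, Fin.prod_univ_succ]
        simp only [Fin.cons_zero, if_true, Fin.castSucc_zero, Fin.cons_succ,
          ← Fin.succ_castSucc]
        by_cases h : τ 0 = a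
        · simp [h, (Int.units_neg_ne a).symm]
        · have h' := (Int.units_ne_iff_eq_neg' _ _).1 h
          simp [h', (Int.units_neg_ne a), (Int.units_neg_ne a).symm]
      simp_rw [this, Finset.sum_add_distrib, ← Finset.mul_sum, ih]
      ring
    · intro b _ hb
      refine Finset.sum_eq_zero fun τ _ => if_neg ?_
      simpa [Fin.consEquiv] using hb
    · exact fun h => absurd (Finset.mem_univ _) h

/-- The generating function of the number of sign changes, used with `x = p ^ 2` as total weight in
a union bound over sign vectors. -/
theorem sum_pow_violations_le {x : ℝ} (hx0 : 0 ≤ x) (hx1 : x ≤ 1) (N : ℕ) :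
    ∑ τ : Fin N → ℤˣ, x ^ violations (SimpleGraph.pathGraph N) (fun _ _ => 1) τ ≤
      2 * (1 + x) ^ N := by
  classical
  rcases N with _ | n
  · refine (Finset.sum_le_sum fun τ _ => pow_le_one₀ hx0 hx1).trans ?_
    simp
  · have hle : ∀ τ : Fin (n + 1) → ℤˣ,
        x ^ violations (SimpleGraph.pathGraph (n + 1)) (fun _ _ => 1) τ ≤
          ∏ j : Fin n, (if τ j.castSucc ≠ τ j.succ then x else 1) := by
      intro τ
      rw [Finset.prod_ite, Finset.prod_const, Finset.prod_const_one, mul_one]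
      refine pow_le_pow_of_le_one hx0 hx1 ?_
      unfold violations
      rw [← Set.ncard_coe_finset]
      refine Set.ncard_le_ncard_of_injOn (fun j : Fin n => s(j.castSucc, j.succ)) ?_ ?_
        (Set.toFinite _)
      · intro j hj
        refine ⟨?_, j.castSucc, j.succ, rfl, ?_⟩
        · rw [SimpleGraph.mem_edgeSet, SimpleGraph.pathGraph_adj]
          simp
        · simpa using hj
      · intro j _ k _ h
        simp only [Sym2.eq_iff, Fin.ext_iff, Fin.val_castSucc, Fin.val_succ] at h
        exact Fin.ext (by omega)
    refine (Finset.sum_le_sum fun τ _ => hle τ).trans ?_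
    have : ∀ τ : Fin (n + 1) → ℤˣ, ∏ j : Fin n, (if τ j.castSucc ≠ τ j.succ then x else 1) =
        (if τ 0 = 1 then ∏ j : Fin n, (if τ j.castSucc ≠ τ j.succ then x else 1) else 0) +
        (if τ 0 = -1 then ∏ j : Fin n, (if τ j.castSucc ≠ τ j.succ then x else 1) else 0) := by
      intro τ
      rcases Int.units_eq_one_or (τ 0) with h | h
      · have h2 : (1 : ℤˣ) ≠ -1 := by decide
        rw [h, if_pos rfl, if_neg h2, add_zero]
      · have h2 : (-1 : ℤˣ) ≠ 1 := by decide
        rw [h, if_pos rfl, if_neg h2, zero_add]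
    rw [Finset.sum_congr rfl fun τ _ => this τ, Finset.sum_add_distrib, sum_path_sign_weight,
      sum_path_sign_weight, pow_succ]
    nlinarith [pow_nonneg (by linarith : 0 ≤ 1 + x) n]

end PathSigns

/-! ### Failing components -/

section Failing

variable {V : Type} [Fintype V] [DecidableEq V] (G : SimpleGraph V) {p q : ℝ} (Y : V → ℤˣ)

open Classical in
/-- If the edge labels are flipped with probability `p`, then at least `h` of the labels in `E`
are flipped with probability at most `(|E| * p) ^ h`. -/
theorem sum_edgeWeight_flips_le (hp : 0 ≤ p) (hp1 : p ≤ 1) (E : Finset G.edgeSet) (h : ℕ) :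
    ∑ X : G.edgeSet → ℤˣ, (if h ≤ (E.filter fun e => X e ≠ edgeSign Y e.1).card
      then edgeWeight G Y p X else 0) ≤ (E.card : ℝ) ^ h * p ^ h := by
  -- The indicator that all edges of `T` are flipped; it factors over the edges. The bound is a
  -- union over the subsets `T` of size `h`.
  let g : Finset G.edgeSet → (G.edgeSet → ℤˣ) → ℝ := fun T X =>
    ∏ e, if e ∈ T ∧ X e = edgeSign Y e.1 then 0 else 1
  have hg0 : ∀ T X, 0 ≤ g T X := fun T X => Finset.prod_nonneg fun e _ => by split_ifs <;> simp
  have hg : ∀ T, ∑ X, edgeWeight G Y p X * g T X = p ^ T.card := by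
    intro T
    simp only [g, edgeWeight]
    rw [sum_prodWeight_mul_prod _
      fun (e : G.edgeSet) x => if e ∈ T ∧ x = edgeSign Y e.1 then (0 : ℝ) else 1]
    simp_rw [sum_flipWeight_mul]
    have : ∀ e : G.edgeSet, (1 - p) * (if e ∈ T ∧ True then (0 : ℝ) else 1) +
        p * (if e ∈ T ∧ -edgeSign Y e.1 = edgeSign Y e.1 then (0 : ℝ) else 1) =
        if e ∈ T then p else 1 := by
      intro e
      by_cases he : e ∈ T <;> simp [he]
    rw [Finset.prod_congr rfl fun e _ => this e, Finset.prod_ite_mem, Finset.univ_inter,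
      Finset.prod_const]
  have hpt : ∀ X, (if h ≤ (E.filter fun e => X e ≠ edgeSign Y e.1).card
      then edgeWeight G Y p X else 0) ≤ ∑ T ∈ E.powersetCard h, edgeWeight G Y p X * g T X := by
    intro X
    have hw := edgeWeight_nonneg G Y hp hp1 X
    split_ifs with hX
    · obtain ⟨T, hT, hTc⟩ := Finset.exists_subset_card_eq hX
      have hmem : T ∈ E.powersetCard h :=
        Finset.mem_powersetCard.2 ⟨hT.trans (Finset.filter_subset _ _), hTc⟩
      refine le_trans ?_ (Finset.single_le_sum (fun T _ => mul_nonneg hw (hg0 T X)) hmem)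
      have : g T X = 1 := Finset.prod_eq_one fun e _ => if_neg fun h =>
        (Finset.mem_filter.1 (hT h.1)).2 h.2
      rw [this, mul_one]
    · exact Finset.sum_nonneg fun T _ => mul_nonneg hw (hg0 T X)
  refine (Finset.sum_le_sum fun X _ => hpt X).trans ?_
  rw [Finset.sum_comm, Finset.sum_congr rfl fun T hT =>
    (hg T).trans (by rw [(Finset.mem_powersetCard.1 hT).2])]
  rw [Finset.sum_const, Finset.card_powersetCard, nsmul_eq_mul]
  exact mul_le_mul_of_nonneg_right (by exact_mod_cast Nat.choose_le_pow E.card h) (by positivity)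

namespace Decomposition

variable (D : Decomposition V)

/-- The flipped edge labels in the extended component `i`. -/
def flips (X : G.edgeSet → ℤˣ) (i : Fin D.numBags) : Set G.edgeSet :=
  {e | e.1 ∈ D.extEdges i ∧ X e ≠ edgeSign Y e.1}

/-- The component `i` fails if at least half of the edges of some cut that separates it may be
flipped. -/
def Fails (X : G.edgeSet → ℤˣ) (i : Fin D.numBags) : Prop :=
  (D.mincut i + 1) / 2 ≤ (D.flips G Y X i).ncard

variable {G}

/-- In a component that does not fail, every local minimizer is correct up to a global sign. -/
theorem exists_sign_of_not_fails (hG : D.probed ≤ G) (hsub : ∀ i, D.bag i ⊆ D.ext i)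
    {X : G.edgeSet → ℤˣ} {i : Fin D.numBags} (hi : ¬ D.Fails G Y X i) {y : V → ℤˣ}
    (hy : ∀ y', D.localDisagreement X i y ≤ D.localDisagreement X i y') :
    ∃ a : ℤˣ, ∀ v ∈ D.bag i, y v = a * Y v := by
  by_contra! hcon
  apply hi
  obtain ⟨v, hv, hv'⟩ := hcon 1
  obtain ⟨u, hu, hu'⟩ := hcon (-1)
  rw [one_mul] at hv'
  have hu'' : y u = Y u := by
    by_contra h
    exact hu' (by rw [(Int.units_ne_iff_eq_neg' _ _).1 h]; simp)
  -- If no global sign works on the block, the set where `y` differs from `Y` separates it, and its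
  -- cut `C` consists of the edges in the extended block on which `y` and `Y` predict different
  -- labels.
  let S : Finset V := (D.ext i).filter fun w => y w ≠ Y w
  let C : Set (Sym2 V) := {e | e ∈ D.extEdges i ∧ (∃ v ∈ e, v ∈ S) ∧ ∃ v ∈ e, v ∉ S}
  have hcut : D.mincut i ≤ C.ncard := Nat.sInf_le
    ⟨S, Finset.filter_subset _ _, ⟨v, hv, Finset.mem_filter.2 ⟨hsub i hv, hv'⟩⟩,
      ⟨u, hu, fun h => (Finset.mem_filter.1 h).2 hu''⟩, rfl⟩
  have hCG : ∀ e ∈ C, e ∈ G.edgeSet := fun e he => SimpleGraph.edgeSet_mono hG he.1.1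
  have hS : ∀ e ∈ D.extEdges i, ∀ v ∈ e, (v ∈ S ↔ y v ≠ Y v) := fun e he v hv => by
    simp [S, he.2 v hv]
  have hsign : ∀ e ∈ D.extEdges i, (edgeSign y e ≠ edgeSign Y e ↔ e ∈ C) := by
    intro e he
    have h1 : e ∈ C ↔ (∃ v ∈ e, y v ≠ Y v) ∧ ∃ v ∈ e, ¬ y v ≠ Y v := by
      simp only [C, Set.mem_ofPred_eq, he, true_and]
      refine and_congr ?_ ?_
      · exact exists_congr fun v => and_congr_right fun hv => hS e he v hv
      · exact exists_congr fun v => and_congr_right fun hv => not_congr (hS e he v hv)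
    rw [h1]
    clear h1
    induction e with
    | h a b =>
      simp only [edgeSign, Sym2.map_mk, Sym2.mul_mk, Sym2.mem_iff]
      by_cases ha : y a = Y a <;> by_cases hb : y b = Y b
      · simp [ha, hb]
      · have := (Int.units_ne_iff_eq_neg' _ _).1 hb
        simp [ha, this]
      · have := (Int.units_ne_iff_eq_neg' _ _).1 ha
        simp [hb, this]
      · simp [(Int.units_ne_iff_eq_neg' _ _).1 ha, (Int.units_ne_iff_eq_neg' _ _).1 hb]
  have hmin := hy Y
  unfold localDisagreement at hmin
  let F : Set G.edgeSet := D.flips G Y X i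
  let C' : Set G.edgeSet := {e | e.1 ∈ C}
  have hE1 : {e : G.edgeSet | e.1 ∈ D.extEdges i ∧ edgeSign Y e.1 ≠ X e} = F := by
    ext e; simp only [F, flips, Set.mem_ofPred_eq, ne_comm]
  -- `y` violates the symmetric difference of flipped edges and cut edges, while `Y` violates the
  -- flipped edges. Comparing sizes gives `|C \ F| ≤ |C ∩ F|`, so at least half of the cut is
  -- flipped.
  have hE2 : {e : G.edgeSet | e.1 ∈ D.extEdges i ∧ edgeSign y e.1 ≠ X e} =
      (F \ C') ∪ (C' \ F) := by
    ext e
    simp only [F, C', flips, Set.mem_ofPred_eq, Set.mem_union, Set.mem_sdiff]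
    by_cases he : e.1 ∈ D.extEdges i
    · have := hsign e.1 he
      by_cases hC : e.1 ∈ C
      · have h3 := this.2 hC
        have h4 := (Int.units_ne_iff_eq_neg' _ _).1 h3
        simp only [he, hC, true_and, not_true_eq_false, and_false, false_or, h4]
        constructor
        · intro h h5
          apply h
          rw [(Int.units_ne_iff_eq_neg' _ _).1 h5]
        · intro h h5
          exact h (h5 ▸ (Int.units_neg_ne _))
      · have h3 : edgeSign y e.1 = edgeSign Y e.1 := by
          by_contra h; exact hC (this.1 h)
        simp only [he, hC, h3, true_and, not_false_eq_true, and_true, false_and, or_false, ne_comm]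
    · have : e.1 ∉ C := fun h => he h.1
      simp [he, this]
  rw [hE1, hE2] at hmin
  have hd : Disjoint (F \ C') (C' \ F) :=
    Set.disjoint_left.2 fun e h1 h2 => h1.2 h2.1
  rw [Set.ncard_union_eq hd (Set.toFinite _) (Set.toFinite _)] at hmin
  have h1 := Set.ncard_inter_add_ncard_sdiff_eq_ncard F C' (Set.toFinite _)
  have h2 := Set.ncard_inter_add_ncard_sdiff_eq_ncard C' F (Set.toFinite _)
  rw [Set.inter_comm] at h2
  have h3 : C'.ncard = C.ncard := by
    rw [← Set.ncard_image_of_injective C' Subtype.val_injective]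
    congr 1
    ext e
    simp only [C', Set.mem_image, Set.mem_ofPred_eq]
    exact ⟨fun ⟨e', h, h'⟩ => h' ▸ h, fun h => ⟨⟨e, hCG e h⟩, h, rfl⟩⟩
  unfold Fails
  change _ ≤ F.ncard
  omega

open Classical in
/-- The number of failing components exceeds `failureBound` with probability at most `δ / 2`. -/
theorem sum_edgeWeight_fails_le (hp : 0 < p) (hp1 : p ≤ 1) (hG : D.probed ≤ G) {δ : ℝ} (hδ : 0 < δ)
    (χ : ℕ) (hχ0 : 0 < χ) (hχ : χ ≤ 6 * D.extEdgeDegree * D.maxExtEdges)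
    (hδ1 : δ < 1) (hfar : ∀ i j : Fin D.numBags, (i : ℕ) + χ ≤ j →
      Disjoint (D.extEdges i) (D.extEdges j))
    (hE : ∀ i, (D.extEdges i).ncard ^ ((D.mincut i + 1) / 2) ≤ 2 ^ (D.extWidth + 1)) :
    ∑ X : G.edgeSet → ℤˣ, (if D.failureBound p δ <
      (({i | D.Fails G Y X i} : Finset (Fin D.numBags)).card : ℝ) then edgeWeight G Y p X else 0) ≤
        δ / 2 := by
  let E : Fin D.numBags → Finset G.edgeSet := fun i => Finset.univ.filter fun e => e.1 ∈ D.extEdges i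
  have hEc : ∀ i, (E i).card = (D.extEdges i).ncard := by
    intro i
    rw [← Set.ncard_coe_finset, ← Set.ncard_image_of_injective _ Subtype.val_injective]
    congr 1
    ext e
    simp only [E, Set.mem_image, Finset.mem_coe, Finset.mem_filter, Finset.mem_univ, true_and]
    exact ⟨fun ⟨e', h, h'⟩ => h' ▸ h, fun h => ⟨⟨e, SimpleGraph.edgeSet_mono hG h.1⟩, h, rfl⟩⟩
  have hF : ∀ i X, (D.flips G Y X i).ncard =
      ((E i).filter fun e => X e ≠ edgeSign Y e.1).card := by
    intro i X
    rw [← Set.ncard_coe_finset]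
    congr 1
    ext e
    simp [E, flips]
  have hmean : ∀ i, ∑ X : G.edgeSet → ℤˣ, (if D.Fails G Y X i then edgeWeight G Y p X else 0) ≤
      2 ^ (D.extWidth + 1) * p ^ ((D.mincut i + 1) / 2) := by
    intro i
    simp only [Fails, hF]
    refine (sum_edgeWeight_flips_le G Y hp.le hp1 (E i) _).trans ?_
    refine mul_le_mul_of_nonneg_right ?_ (by positivity)
    rw [hEc]
    exact_mod_cast hE i
  have key := sum_prodWeight_local_count (w := fun e : G.edgeSet => flipWeight p (edgeSign Y e.1))
    (fun e => sum_flipWeight _ _) (fun e x => flipWeight_nonneg hp.le hp1 _ _)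
    (fun i => {e | e.1 ∈ D.extEdges i}) (fun i X => D.Fails G Y X i) (by
      intro i X X' h
      have : D.flips G Y X i = D.flips G Y X' i := by
        ext e
        simp only [flips, Set.mem_ofPred_eq]
        exact and_congr_right fun he => by rw [h e he]
      simp only [Fails, this]) χ hχ0 (by
      intro i j h
      exact Set.disjoint_left.2 fun e h1 h2 => Set.disjoint_left.1 (hfar i j h) h1 h2)
    (fun i => 2 ^ (D.extWidth + 1) * p ^ ((D.mincut i + 1) / 2)) hmean (Real.log (2 / δ))
  have hl : 0 ≤ Real.log (2 / δ) := Real.log_nonneg (by rw [le_div_iff₀ hδ]; linarith)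
  have he : Real.exp (-Real.log (2 / δ)) = δ / 2 := by
    rw [Real.exp_neg, Real.exp_log (by positivity), inv_div]
  rw [he] at key
  refine (Finset.sum_le_sum fun X _ => ?_).trans key
  -- The factor 2 of the tail bound turns `2 ^ (extWidth + 1)` into the `2 ^ (extWidth + 2)` of
  -- `failureBound`, and the logarithmic term of `failureBound` leaves room for the range `χ` of
  -- dependence.
  have hthr : 2 * ∑ i, 2 ^ (D.extWidth + 1) * p ^ ((D.mincut i + 1) / 2) + χ * Real.log (2 / δ) ≤
      D.failureBound p δ := by
    unfold failureBound
    rw [← Finset.mul_sum]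
    have h1 : (χ : ℝ) * Real.log (2 / δ) ≤
        6 * D.extEdgeDegree * D.maxExtEdges * Real.log (2 / δ) :=
      mul_le_mul_of_nonneg_right (by exact_mod_cast hχ) hl
    have h2 : (2 : ℝ) ^ (D.extWidth + 2) = 2 * 2 ^ (D.extWidth + 1) := by ring
    rw [h2]
    linarith
  have hw := edgeWeight_nonneg G Y hp.le hp1 X
  by_cases h : D.failureBound p δ < (({i | D.Fails G Y X i} : Finset (Fin D.numBags)).card : ℝ)
  · rw [if_pos h, if_pos (hthr.trans_lt h)]
    exact le_rfl
  · rw [if_neg h]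
    split_ifs
    exacts [hw, le_rfl]

end Decomposition

end Failing

/-! ### The error of the decoder -/

section DecoderError

open Classical in
theorem ncard_edges_touching_le {N : ℕ} (T : SimpleGraph (Fin N)) (B : Finset (Fin N)) {d : ℕ}
    (hd : ∀ i, (T.neighborSet i).ncard ≤ d) :
    {e | e ∈ T.edgeSet ∧ ∃ i ∈ B, i ∈ e}.ncard ≤ B.card * d := by
  have hsub : {e | e ∈ T.edgeSet ∧ ∃ i ∈ B, i ∈ e} ⊆
      ((B.biUnion fun i => (T.neighborFinset i).image fun j => s(i, j) : Finset (Sym2 (Fin N))) :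
        Set (Sym2 (Fin N))) := by
    rintro e ⟨he, i, hi, hie⟩
    obtain ⟨j, rfl⟩ := Sym2.mem_iff_exists.1 hie
    simp only [Finset.coe_biUnion, Set.mem_iUnion, Finset.coe_image]
    exact ⟨i, hi, j, by simpa using he, rfl⟩
  refine (Set.ncard_le_ncard hsub (Set.toFinite _)).trans ?_
  rw [Set.ncard_coe_finset]
  refine Finset.card_biUnion_le_card_mul _ _ _ fun i _ => Finset.card_image_le.trans ?_
  refine le_trans (le_of_eq ?_) (hd i)
  rw [← Set.ncard_coe_finset, SimpleGraph.coe_neighborFinset]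

namespace Decomposition

variable {V : Type} (D : Decomposition V) {G : SimpleGraph V} (Y : V → ℤˣ)

/-- The number of vertex labels in the component `i` that `y` violates. -/
def bagCost (Z : V → ℤˣ) (i : Fin D.numBags) (y : V → ℤˣ) : ℕ :=
  ((D.bag i).filter fun v => y v ≠ Z v).card

theorem bagCost_congr (Z : V → ℤˣ) {i : Fin D.numBags} {y y' : V → ℤˣ}
    (h : ∀ v ∈ D.bag i, y v = y' v) : D.bagCost Z i y = D.bagCost Z i y' := by
  unfold bagCost
  congr 1
  exact Finset.filter_congr fun v hv => by rw [h v hv]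

theorem bagCost_le (Z : V → ℤˣ) (i : Fin D.numBags) (y : V → ℤˣ) :
    D.bagCost Z i y ≤ (D.bag i).card := Finset.card_filter_le _ _

/-- The total size of the components with sign `-1`. -/
def negSize (τ : Fin D.numBags → ℤˣ) : ℕ := ∑ i, if τ i = -1 then (D.bag i).card else 0

/-- The excess cost, over that of the ground truth, of changing all signs in the components with
sign `-1`. -/
def negExcess (Z : V → ℤˣ) (τ : Fin D.numBags → ℤˣ) : ℤ :=
  ∑ i, if τ i = -1 then (D.bagCost Z i (-Y) : ℤ) - D.bagCost Z i Y else 0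

theorem neighborSet_ncard_le_treeDegree (i : Fin D.numBags) :
    (D.tree.neighborSet i).ncard ≤ D.treeDegree :=
  Finset.le_sup (f := fun i => (D.tree.neighborSet i).ncard) (Finset.mem_univ i)

open Classical in
-- Outside the failing components the estimators equal `a i * Y`, so `τ = σ * a` records where the
-- decoder is right, with `τ = 1` on failing components by convention. The signs `a` violate only
-- tree edges that touch a failing component, hence are feasible. Optimality of `σ` against `a`
-- bounds the excess, each failing component contributing at most `B`.
theorem exists_signs_of_isDecoderOutput [Fintype V] (hG : D.probed ≤ G)
    (hsub : ∀ i, D.bag i ⊆ D.ext i) {B : ℕ} (hB : ∀ i, (D.bag i).card ≤ B) {L : ℝ}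
    {X : G.edgeSet → ℤˣ} {Z y : V → ℤˣ} (hy : IsDecoderOutput D L X Z y)
    (hL : (D.treeDegree : ℝ) *
      (({i | D.Fails G Y X i} : Finset (Fin D.numBags)).card : ℝ) ≤ L) :
    ∃ τ : Fin D.numBags → ℤˣ, (violations D.tree (fun _ _ => 1) τ : ℝ) ≤ 2 * L ∧
      D.negExcess Y Z τ ≤ B * ({i | D.Fails G Y X i} : Finset (Fin D.numBags)).card ∧
      hammingDist y Y ≤ B * ({i | D.Fails G Y X i} : Finset (Fin D.numBags)).card +
        D.negSize τ := by
  set F : Finset (Fin D.numBags) := {i | D.Fails G Y X i} with hF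
  obtain ⟨Yt, r, σ, hmin, hr, ⟨hviol, hopt⟩, hout⟩ := hy
  have hex : ∀ i, ∃ a : ℤˣ, i ∉ F → ∀ v ∈ D.bag i, Yt i v = a * Y v := by
    intro i
    by_cases hi : i ∈ F
    · exact ⟨1, fun h => absurd hi h⟩
    · obtain ⟨a, ha⟩ := D.exists_sign_of_not_fails Y hG hsub
        (i := i) (X := X) (fun h => hi (by simp [hF, h])) (hmin i)
      exact ⟨a, fun _ => ha⟩
  choose a ha using hex
  let S : Fin D.numBags → Fin D.numBags → ℤˣ := fun i j => Yt i (r s(i, j)) * Yt j (r s(i, j))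
  have hS : ∀ i j, D.tree.Adj i j → i ∉ F → j ∉ F → S i j = a i * a j := by
    intro i j hij hi hj
    obtain ⟨h1, h2⟩ := hr i j hij
    simp only [S]
    rw [ha i hi _ h1, ha j hj _ h2]
    calc _ = a i * a j * (Y (r s(i, j)) * Y (r s(i, j))) := by ac_rfl
      _ = _ := by rw [Int.units_mul_self, mul_one]
  -- The competitor in the decoder's minimization; its value on failing components is irrelevant.
  let τ₀ : Fin D.numBags → ℤˣ := fun i => if i ∈ F then 1 else a i
  let τ : Fin D.numBags → ℤˣ := fun i => if i ∈ F then 1 else σ i * a i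
  let touch : Set (Sym2 (Fin D.numBags)) := {e | e ∈ D.tree.edgeSet ∧ ∃ i ∈ F, i ∈ e}
  have htouch : (touch.ncard : ℝ) ≤ L := by
    refine le_trans ?_ hL
    have := ncard_edges_touching_le D.tree F D.neighborSet_ncard_le_treeDegree
    rw [mul_comm]
    exact_mod_cast this
  have hτ₀ : (violations D.tree S τ₀ : ℝ) ≤ L := by
    refine le_trans ?_ htouch
    unfold violations
    refine Nat.cast_le.2 (Set.ncard_le_ncard ?_ (Set.toFinite _))
    rintro e ⟨he, i, j, rfl, hij⟩
    refine ⟨he, ?_⟩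
    by_contra! hcon
    have hi : i ∉ F := fun h => hcon i h (by simp)
    have hj : j ∉ F := fun h => hcon j h (by simp)
    apply hij
    simp only [τ₀, hi, hj, if_false]
    rw [hS i j he hi hj]
    calc _ = a i * (a j * a j) := by rw [Int.units_mul_self, mul_one]
      _ = _ := by ac_rfl
  refine ⟨τ, ?_, ?_, ?_⟩
  -- Away from failing components a change of `τ` is an edge violated by `σ`, because there `S i j =
  -- a i * a j`. Both kinds of edges number at most `L`, which gives `2 * L`.
  · have : (violations D.tree (fun _ _ => 1) τ : ℝ) ≤ (violations D.tree S σ : ℝ) + touch.ncard := by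
      unfold violations
      have h1 : {e | e ∈ D.tree.edgeSet ∧ ∃ i j, e = s(i, j) ∧ τ i ≠ τ j * 1} ⊆
          {e | e ∈ D.tree.edgeSet ∧ ∃ i j, e = s(i, j) ∧ σ i ≠ σ j * S i j} ∪ touch := by
        rintro e ⟨he, i, j, rfl, hij⟩
        by_cases h : ∃ k ∈ F, k ∈ s(i, j)
        · exact Or.inr ⟨he, h⟩
        · left
          push Not at h
          have hi : i ∉ F := fun h' => h i h' (by simp)
          have hj : j ∉ F := fun h' => h j h' (by simp)
          refine ⟨he, i, j, rfl, fun heq => hij ?_⟩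
          simp only [τ, hi, hj, if_false]
          rw [heq, hS i j he hi hj]
          calc _ = σ j * a j * (a i * a i) := by ac_rfl
            _ = _ := by rw [Int.units_mul_self]
      exact_mod_cast (Set.ncard_le_ncard h1 (Set.toFinite _)).trans (Set.ncard_union_le _ _)
    have h2 : (violations D.tree S σ : ℝ) ≤ L := hviol
    linarith
  · have hcost : ∀ (σ' : Fin D.numBags → ℤˣ) i,
        ((D.bag i).filter fun v => σ' i * Yt i v ≠ Z v).card =
          D.bagCost Z i fun v => σ' i * Yt i v := fun σ' i => rfl
    have h1 := hopt τ₀ hτ₀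
    simp only [hcost] at h1
    have hpt : ∀ i, (if τ i = -1 then (D.bagCost Z i (-Y) : ℤ) - D.bagCost Z i Y else 0) ≤
        (D.bagCost Z i (fun v => σ i * Yt i v) : ℤ) - D.bagCost Z i (fun v => τ₀ i * Yt i v) +
          if i ∈ F then (B : ℤ) else 0 := by
      intro i
      by_cases hi : i ∈ F
      · have h2 : (1 : ℤˣ) ≠ -1 := by decide
        have h3 := (D.bagCost_le Z i fun v => τ₀ i * Yt i v).trans (hB i)
        simp only [τ, hi, if_true, h2, if_false]
        omega
      · have h3 : D.bagCost Z i (fun v => τ₀ i * Yt i v) = D.bagCost Z i Y := by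
          refine D.bagCost_congr Z fun v hv => ?_
          simp only [τ₀, hi, if_false]
          rw [ha i hi v hv, ← mul_assoc, Int.units_mul_self, one_mul]
        have h4 : D.bagCost Z i (fun v => σ i * Yt i v) = D.bagCost Z i (fun v => τ i * Y v) := by
          refine D.bagCost_congr Z fun v hv => ?_
          simp only [τ, hi, if_false]
          rw [ha i hi v hv, ← mul_assoc]
        rw [h3, h4, if_neg hi]
        split_ifs with h
        · have : (fun v => τ i * Y v) = -Y := by funext v; simp [h]
          rw [this, add_zero]
        · have h5 : τ i = 1 := by
            rcases Int.units_eq_one_or (τ i) with h' | h'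
            exacts [h', absurd h' h]
          have : (fun v => τ i * Y v) = Y := by funext v; simp [h5]
          rw [this]; simp
    refine (Finset.sum_le_sum fun i _ => hpt i).trans ?_
    rw [Finset.sum_add_distrib, Finset.sum_sub_distrib, Finset.sum_ite_mem, Finset.univ_inter,
      Finset.sum_const, nsmul_eq_mul]
    have h1' : (∑ i, (D.bagCost Z i (fun v => σ i * Yt i v) : ℤ)) ≤
        ∑ i, (D.bagCost Z i (fun v => τ₀ i * Yt i v) : ℤ) := by exact_mod_cast h1
    linarith [mul_comm (B : ℤ) F.card]
  · have h1 : hammingDist y Y ≤ ∑ i, ((D.bag i).filter fun v => σ i * Yt i v ≠ Y v).card := by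
      unfold hammingDist
      refine le_trans (Finset.card_le_card fun v hv => ?_) Finset.card_biUnion_le
      obtain ⟨i, hi, hvi⟩ := hout v
      refine Finset.mem_biUnion.2 ⟨i, Finset.mem_univ _, Finset.mem_filter.2 ⟨hi, ?_⟩⟩
      rw [← hvi]
      exact (Finset.mem_filter.1 hv).2
    refine h1.trans ?_
    have hpt : ∀ i, ((D.bag i).filter fun v => σ i * Yt i v ≠ Y v).card ≤
        (if i ∈ F then B else 0) + if τ i = -1 then (D.bag i).card else 0 := by
      intro i
      by_cases hi : i ∈ F
      · rw [if_pos hi]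
        exact le_add_right ((Finset.card_filter_le _ _).trans (hB i))
      · rw [if_neg hi, zero_add]
        split_ifs with h
        · exact Finset.card_filter_le _ _
        · have h5 : τ i = 1 := by
            rcases Int.units_eq_one_or (τ i) with h' | h'
            exacts [h', absurd h' h]
          rw [Nat.le_zero, Finset.card_eq_zero, Finset.filter_eq_empty_iff]
          intro v hv
          rw [not_not, ha i hi v hv, ← mul_assoc]
          simp only [τ, hi, if_false] at h5
          rw [h5, one_mul]
    refine (Finset.sum_le_sum fun i _ => hpt i).trans (le_of_eq ?_)
    rw [Finset.sum_add_distrib, Finset.sum_ite_mem, Finset.univ_inter, Finset.sum_const,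
      smul_eq_mul, mul_comm]
    rfl

variable [Fintype V] [DecidableEq V]

/-- The number of components with sign `-1` that contain `v`. -/
def negCount (τ : Fin D.numBags → ℤˣ) (v : V) : ℕ :=
  ((Finset.univ : Finset (Fin D.numBags)).filter fun i => τ i = -1 ∧ v ∈ D.bag i).card

/-- Double counting of incidences turns sums over overlapping components into sums over vertices,
where the labels `Z v` are independent. -/
theorem sum_negCount_mul (τ : Fin D.numBags → ℤˣ) (f : V → ℤ) :
    ∑ v, (D.negCount τ v : ℤ) * f v = ∑ i, if τ i = -1 then ∑ v ∈ D.bag i, f v else 0 := by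
  have : ∀ v, (D.negCount τ v : ℤ) * f v =
      ∑ i, if τ i = -1 then (if v ∈ D.bag i then f v else 0) else 0 := by
    intro v
    unfold negCount
    rw [Finset.card_filter, Nat.cast_sum, Finset.sum_mul]
    refine Finset.sum_congr rfl fun i _ => ?_
    by_cases h1 : τ i = -1 <;> by_cases h2 : v ∈ D.bag i <;> simp [h1, h2]
  rw [Finset.sum_congr rfl fun v _ => this v, Finset.sum_comm]
  refine Finset.sum_congr rfl fun i _ => ?_
  split_ifs
  · rw [Finset.sum_ite_mem, Finset.univ_inter]
  · simp

theorem negSize_eq (τ : Fin D.numBags → ℤˣ) : D.negSize τ = ∑ v, D.negCount τ v := by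
  have := D.sum_negCount_mul τ fun _ => 1
  simp only [mul_one, Finset.sum_const, nsmul_eq_mul] at this
  unfold negSize
  have h2 : ((∑ v, D.negCount τ v : ℕ) : ℤ) =
      ((∑ i, if τ i = -1 then (D.bag i).card else 0 : ℕ) : ℤ) := by
    push_cast
    exact this
  exact_mod_cast h2.symm

theorem negExcess_eq (Z : V → ℤˣ) (τ : Fin D.numBags → ℤˣ) :
    D.negExcess Y Z τ = ∑ v, (D.negCount τ v : ℤ) * if Z v = Y v then 1 else -1 := by
  rw [sum_negCount_mul]
  unfold negExcess
  refine Finset.sum_congr rfl fun i _ => ?_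
  split_ifs
  · unfold bagCost
    rw [Finset.card_filter, Finset.card_filter, Nat.cast_sum, Nat.cast_sum,
      ← Finset.sum_sub_distrib]
    refine Finset.sum_congr rfl fun v _ => ?_
    by_cases h : Z v = Y v
    · simp [h]
    · have := (Int.units_ne_iff_eq_neg' _ _).1 h
      simp [this, (Int.units_neg_ne (Y v)).symm]
  · rfl

/-- Chernoff bound for the excess cost. -/
theorem sum_vertexWeight_negExcess_le {q : ℝ} (hq : 0 ≤ q) (hq2 : q < 1 / 2) {M : ℕ} (hM : 0 < M)
    (τ : Fin D.numBags → ℤˣ) (hcount : ∀ v, D.negCount τ v ≤ M) (A : ℝ) :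
    ∑ Z : V → ℤˣ, (if (D.negExcess Y Z τ : ℝ) ≤ A then vertexWeight Y q Z else 0) ≤
      Real.exp ((1 / 2 - q) / M * A - (1 / 2 - q) ^ 2 / M * D.negSize τ) := by
  set ε := 1 / 2 - q with hε
  have hM' : (0 : ℝ) < M := by exact_mod_cast hM
  have hε0 : 0 < ε := by linarith
  have hpt : ∀ Z, (if (D.negExcess Y Z τ : ℝ) ≤ A then vertexWeight Y q Z else 0) ≤
      Real.exp (ε / M * A) * (vertexWeight Y q Z * ∏ v,
        Real.exp (-(ε / M * D.negCount τ v * if Z v = Y v then 1 else -1))) := by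
    intro Z
    have hw := vertexWeight_nonneg Y hq (by linarith : q ≤ 1) Z
    rw [← Real.exp_sum, mul_left_comm, ← Real.exp_add]
    split_ifs with h
    · refine le_mul_of_one_le_right hw (Real.one_le_exp ?_)
      rw [negExcess_eq] at h
      push_cast at h
      have : ∑ v, -(ε / M * D.negCount τ v * if Z v = Y v then (1 : ℝ) else -1) =
          -(ε / M * ∑ v, (D.negCount τ v : ℝ) * if Z v = Y v then (1 : ℝ) else -1) := by
        rw [Finset.mul_sum, ← Finset.sum_neg_distrib]
        exact Finset.sum_congr rfl fun v _ => by ring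
      rw [this]
      have := mul_le_mul_of_nonneg_left h (by positivity : 0 ≤ ε / M)
      linarith
    · positivity
  refine (Finset.sum_le_sum fun Z _ => hpt Z).trans ?_
  rw [← Finset.mul_sum]
  unfold vertexWeight
  rw [sum_prodWeight_mul_prod _
    fun v z => Real.exp (-(ε / M * D.negCount τ v * if z = Y v then 1 else -1))]
  rw [sub_eq_add_neg, Real.exp_add, negSize_eq]
  refine mul_le_mul_of_nonneg_left ?_ (Real.exp_pos _).le
  have : -(ε ^ 2 / M * ((∑ v, D.negCount τ v : ℕ) : ℝ)) =
      ∑ v, -(ε ^ 2 / M * D.negCount τ v) := by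
    push_cast
    rw [Finset.mul_sum, Finset.sum_neg_distrib]
  rw [this, Real.exp_sum]
  refine Finset.prod_le_prod (fun v _ => Finset.sum_nonneg fun z _ =>
    mul_nonneg (flipWeight_nonneg hq (by linarith) _ _) (Real.exp_pos _).le) fun v _ => ?_
  rw [sum_flipWeight_mul]
  simp only [if_true, Int.units_neg_ne, if_false, mul_one, mul_neg, neg_neg]
  -- The parameter `ε / M` ensures `s ≤ ε`. With `exp x ≤ 1 + x + x ^ 2` for `|x| ≤ 1` and `1 - 2 *
  -- q = 2 * ε`, the factor of `v` is at most `1 - 2 * ε * s + s ^ 2 ≤ 1 - ε * s ≤ exp (-ε * s)`.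
  set s : ℝ := ε / M * D.negCount τ v with hs
  have hn : (D.negCount τ v : ℝ) ≤ M := by exact_mod_cast hcount v
  have hs0 : 0 ≤ s := by positivity
  have hsε : s ≤ ε := by
    rw [hs, div_mul_eq_mul_div, div_le_iff₀ hM']
    exact mul_le_mul_of_nonneg_left hn hε0.le
  have hs1 : |s| ≤ 1 := by rw [abs_of_nonneg hs0]; linarith
  have h1 := (abs_le.1 (Real.abs_exp_sub_one_sub_id_le hs1)).2
  have h2 := (abs_le.1 (Real.abs_exp_sub_one_sub_id_le (x := -s) (by rwa [abs_neg]))).2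
  have h3 : ε ^ 2 / M * D.negCount τ v = ε * s := by rw [hs]; ring
  rw [h3]
  refine le_trans ?_ (Real.add_one_le_exp _)
  have h4 := mul_le_mul_of_nonneg_left h1 hq
  have h5 := mul_le_mul_of_nonneg_left h2 (by linarith : 0 ≤ 1 - q)
  have h6 := mul_le_mul_of_nonneg_right hsε hs0
  have h7 : q = 1 / 2 - ε := by linarith
  rw [h7] at h4 h5 ⊢
  nlinarith

/-- Except with probability `δ / 2`, no sign vector with few violated edges and a large negative
part has a small excess cost. -/
theorem sum_vertexWeight_exists_le {p q δ : ℝ} (hT : D.tree = SimpleGraph.pathGraph D.numBags)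
    (hp : 0 < p) (hp1 : p ≤ 1) (hq : 0 ≤ q) (hq2 : q < 1 / 2) (hδ : 0 < δ) {M : ℕ} (hM : 0 < M)
    (hcount : ∀ v τ, D.negCount τ v ≤ M) (L A : ℝ) (good : (V → ℤˣ) → Prop) [DecidablePred good]
    (hgood : ∀ Z, (∀ τ, (violations D.tree (fun _ _ => 1) τ : ℝ) ≤ L →
      (D.negExcess Y Z τ : ℝ) ≤ A → (D.negSize τ : ℝ) ≤ M / (1 / 2 - q) ^ 2 *
        ((1 / 2 - q) / M * A + 2 * L * Real.log (1 / p) + Real.log 2 + p ^ 2 * D.numBags +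
          Real.log (2 / δ))) → good Z) :
    ∑ Z : V → ℤˣ, (if ¬ good Z then vertexWeight Y q Z else 0) ≤ δ / 2 := by
  classical
  set ε := 1 / 2 - q with hε
  have hM' : (0 : ℝ) < M := by exact_mod_cast hM
  have hε0 : 0 < ε := by linarith
  set s₀ := M / ε ^ 2 * (ε / M * A + 2 * L * Real.log (1 / p) + Real.log 2 + p ^ 2 * D.numBags +
          Real.log (2 / δ)) with hs₀
  have hs₀' : ε ^ 2 / M * s₀ = ε / M * A + 2 * L * Real.log (1 / p) + Real.log 2 +
      p ^ 2 * D.numBags + Real.log (2 / δ) := by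
    rw [hs₀]; field_simp
  let vi : (Fin D.numBags → ℤˣ) → ℕ := fun τ => violations D.tree (fun _ _ => 1) τ
  have hw := vertexWeight_nonneg Y hq (by linarith : q ≤ 1)
  have hpt : ∀ Z, (if ¬ good Z then vertexWeight Y q Z else 0) ≤
      ∑ τ, if (vi τ : ℝ) ≤ L ∧ s₀ < D.negSize τ then
        (if (D.negExcess Y Z τ : ℝ) ≤ A then vertexWeight Y q Z else 0) else 0 := by
    intro Z
    have hnn : ∀ τ : Fin D.numBags → ℤˣ, 0 ≤ if (vi τ : ℝ) ≤ L ∧ s₀ < D.negSize τ then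
        (if (D.negExcess Y Z τ : ℝ) ≤ A then vertexWeight Y q Z else 0) else 0 := fun τ => by
      split_ifs
      exacts [hw Z, le_rfl, le_rfl]
    by_cases h : good Z
    · rw [if_neg (not_not_intro h)]
      exact Finset.sum_nonneg fun τ _ => hnn τ
    · rw [if_pos h]
      have hex : ∃ τ, (vi τ : ℝ) ≤ L ∧ (D.negExcess Y Z τ : ℝ) ≤ A ∧ s₀ < D.negSize τ := by
        by_contra! hcon
        exact h (hgood Z fun τ h1 h2 => hcon τ h1 h2)
      obtain ⟨τ, h1, h2, h3⟩ := hex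
      refine le_trans (le_of_eq ?_) (Finset.single_le_sum (fun τ _ => hnn τ) (Finset.mem_univ τ))
      rw [if_pos ⟨h1, h3⟩, if_pos h2]
  refine (Finset.sum_le_sum fun Z _ => hpt Z).trans ?_
  rw [Finset.sum_comm]
  -- For `vi τ ≤ L` the product of `(p ^ 2) ^ vi τ` and `exp (2 * L * log (1 / p))` is at least 1,
  -- so these weights may replace a count of the sign vectors. The exponent 2 keeps the logarithm of
  -- the total weight at `p ^ 2 * numBags + log 2`.
  have hτ : ∀ τ, ∑ Z, (if (vi τ : ℝ) ≤ L ∧ s₀ < D.negSize τ then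
        (if (D.negExcess Y Z τ : ℝ) ≤ A then vertexWeight Y q Z else 0) else 0) ≤
      (p ^ 2) ^ vi τ * Real.exp (2 * L * Real.log (1 / p) + ε / M * A - ε ^ 2 / M * s₀) := by
    intro τ
    by_cases h : (vi τ : ℝ) ≤ L ∧ s₀ < D.negSize τ
    · simp only [h, and_self, if_true]
      refine (D.sum_vertexWeight_negExcess_le Y hq hq2 hM τ (fun v => hcount v τ) A).trans ?_
      rw [← hε]
      have e1 : (p ^ 2) ^ vi τ = Real.exp (-(2 * vi τ * Real.log (1 / p))) := by
        rw [one_div, Real.log_inv, ← pow_mul, ← Real.rpow_natCast, Real.rpow_def_of_pos hp]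
        push_cast
        congr 1
        ring
      rw [e1, ← Real.exp_add]
      refine Real.exp_le_exp.2 ?_
      have h1 : 0 ≤ Real.log (1 / p) := Real.log_nonneg (by rw [le_div_iff₀ hp]; linarith)
      have h2 := mul_le_mul_of_nonneg_right h.1 h1
      have h3 := mul_le_mul_of_nonneg_left h.2.le (by positivity : 0 ≤ ε ^ 2 / M)
      linarith
    · simp only [h, if_false, Finset.sum_const_zero]
      positivity
  refine (Finset.sum_le_sum fun τ _ => hτ τ).trans ?_
  rw [← Finset.sum_mul]
  have hsum : ∑ τ, (p ^ 2) ^ vi τ ≤ 2 * (1 + p ^ 2) ^ D.numBags := by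
    simp only [vi, hT]
    exact sum_pow_violations_le (by positivity) (by nlinarith) _
  have hexp : (1 + p ^ 2) ^ D.numBags ≤ Real.exp (p ^ 2 * D.numBags) := by
    rw [mul_comm, Real.exp_nat_mul]
    exact pow_le_pow_left₀ (by positivity) (by linarith [Real.add_one_le_exp (p ^ 2)]) _
  refine (mul_le_mul_of_nonneg_right (hsum.trans (mul_le_mul_of_nonneg_left hexp zero_le_two))
    (Real.exp_pos _).le).trans (le_of_eq ?_)
  rw [hs₀', mul_assoc, ← Real.exp_add]
  have e2 : (2 : ℝ) = Real.exp (Real.log 2) := (Real.exp_log (by norm_num)).symm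
  have e3 : δ / 2 = Real.exp (-Real.log (2 / δ)) := by
    rw [Real.exp_neg, Real.exp_log (by positivity), inv_div]
  rw [e3]
  nth_rewrite 1 [e2]
  rw [← Real.exp_add]
  congr 1
  ring

end Decomposition

end DecoderError

/-! ### Combination of the failure bound and the sign bound. -/

section DecoderBound

namespace Decomposition

variable {V : Type} [Fintype V] [DecidableEq V] (D : Decomposition V) {G : SimpleGraph V}

theorem failureBound_nonneg {p δ : ℝ} (hp : 0 ≤ p) (hδ : 0 < δ) (hδ1 : δ < 1) :
    0 ≤ D.failureBound p δ := by
  have : 0 ≤ Real.log (2 / δ) := Real.log_nonneg (by rw [le_div_iff₀ hδ]; linarith)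
  unfold failureBound
  exact add_nonneg (mul_nonneg (by positivity) (Finset.sum_nonneg fun i _ => by positivity))
    (by positivity)

/-- One bad event, too many failing components, depends only on `X`; the other, a deceptively cheap
sign vector, only on `Z`. Each has probability at most `δ / 2`. The second event is uniform over
sign vectors, so it controls whatever signs and arbitrary choices the decoder used. -/
theorem le_obsLaw_real_decoder_error (hT : D.tree = SimpleGraph.pathGraph D.numBags)
    (hG : D.probed ≤ G) (hsub : ∀ i, D.bag i ⊆ D.ext i) {B M : ℕ} (hM : 0 < M)
    (hB : ∀ i, (D.bag i).card ≤ B) (hcount : ∀ v τ, D.negCount τ v ≤ M)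
    (χ : ℕ) (hχ0 : 0 < χ) (hχ : χ ≤ 6 * D.extEdgeDegree * D.maxExtEdges)
    (hfar : ∀ i j : Fin D.numBags, (i : ℕ) + χ ≤ j → Disjoint (D.extEdges i) (D.extEdges j))
    (hE : ∀ i, (D.extEdges i).ncard ^ ((D.mincut i + 1) / 2) ≤ 2 ^ (D.extWidth + 1))
    {p q δ : ℝ} (hp : 0 < p) (hpq : p < q) (hq : q < 1 / 2) (hδ : 0 < δ) (hδ1 : δ < 1)
    (Y : V → ℤˣ) :
    1 - δ ≤ (obsLaw G p q Y).real {ω | ∀ y, IsDecoderOutput D (D.budget p δ) ω.1 ω.2 y →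
      (hammingDist y Y : ℝ) ≤ B * D.failureBound p δ + M / (1 / 2 - q) ^ 2 *
        ((1 / 2 - q) / M * (B * D.failureBound p δ) + 2 * (2 * D.budget p δ) * Real.log (1 / p) +
          Real.log 2 + p ^ 2 * D.numBags + Real.log (2 / δ))} := by
  classical
  set K := D.failureBound p δ with hK
  let A : (G.edgeSet → ℤˣ) → Prop := fun X =>
    K < (({i | D.Fails G Y X i} : Finset (Fin D.numBags)).card : ℝ)
  let good : (V → ℤˣ) → Prop := fun Z => ∀ τ,
    (violations D.tree (fun _ _ => 1) τ : ℝ) ≤ 2 * D.budget p δ →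
      (D.negExcess Y Z τ : ℝ) ≤ B * K → (D.negSize τ : ℝ) ≤ M / (1 / 2 - q) ^ 2 *
        ((1 / 2 - q) / M * (B * K) + 2 * (2 * D.budget p δ) * Real.log (1 / p) +
          Real.log 2 + p ^ 2 * D.numBags + Real.log (2 / δ))
  have h1 := D.sum_edgeWeight_fails_le Y hp (by linarith) hG hδ χ hχ0 hχ hδ1 hfar hE
  have h2 := D.sum_vertexWeight_exists_le Y hT hp (by linarith) (by linarith : 0 ≤ q) hq hδ hM
    hcount (2 * D.budget p δ) (B * K) good fun Z hZ => hZ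
  refine le_trans ?_ (obsLaw_real_union_le G Y hp.le (by linarith) (by linarith : 0 ≤ q)
    (by linarith) A (fun Z => ¬ good Z) _ ?_)
  · have h1' : (∑ X, if A X then edgeWeight G Y p X else 0) ≤ δ / 2 := by convert h1
    linarith
  · intro X Z hX hZ y hy
    simp only [A, not_lt] at hX
    rw [not_not] at hZ
    obtain ⟨τ, hτ1, hτ2, hτ3⟩ := D.exists_signs_of_isDecoderOutput Y hG hsub hB hy
      (mul_le_mul_of_nonneg_left hX (Nat.cast_nonneg _))
    have hBK := mul_le_mul_of_nonneg_left hX (Nat.cast_nonneg (α := ℝ) B)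
    have hτ2' : (D.negExcess Y Z τ : ℝ) ≤ B * K := by
      refine le_trans ?_ hBK
      exact_mod_cast hτ2
    have h3 := hZ τ hτ1 hτ2'
    have h4 : (hammingDist y Y : ℝ) ≤
        B * (({i | D.Fails G Y X i} : Finset (Fin D.numBags)).card : ℝ) + D.negSize τ := by
      exact_mod_cast hτ3
    linarith

end Decomposition

/-- Every term in the bracket is at most a multiple of `Q` or of `Q * log (1 / p)`, and `log (e / p)
= 1 + log (1 / p)` covers both. -/
theorem decoder_error_estimate {B M κ K L n N Q ε l p : ℝ} (hB : 0 ≤ B) (hM : 0 < M) (hκ : 0 ≤ κ)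
    (hp : 0 < p) (hp1 : p ≤ 1) (hε : 0 < ε) (hε1 : ε ≤ 1 / 2)
    (hQ : Q = p ^ 2 * n + l) (hn : 0 ≤ n)
    (hl : Real.log 2 ≤ l) (hK : K ≤ κ * Q) (hL : L ≤ κ * Q) (hN : N ≤ 2 * n) :
    B * K + M / ε ^ 2 * (ε / M * (B * K) + 2 * (2 * L) * Real.log (1 / p) + Real.log 2 +
      p ^ 2 * N + l) ≤ (2 * B * κ + 4 * M * κ + 4 * M) / ε ^ 2 * Q * Real.log (Real.exp 1 / p) := by
  have hlog : Real.log (Real.exp 1 / p) = 1 + Real.log (1 / p) := by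
    rw [Real.log_div (Real.exp_pos 1).ne' hp.ne', Real.log_exp, one_div, Real.log_inv]; ring
  have hlog2 : 0 < Real.log 2 := Real.log_pos (by norm_num)
  have hlp : 0 ≤ Real.log (1 / p) := Real.log_nonneg (by rw [le_div_iff₀ hp]; linarith)
  rw [hlog]
  set w := Real.log (1 / p)
  have hpn : 0 ≤ p ^ 2 * n := by positivity
  have hQ0 : 0 ≤ Q := by linarith
  have hκQ : 0 ≤ κ * Q := by positivity
  have hε2 : 0 < ε ^ 2 := by positivity
  have hεε : ε ^ 2 ≤ ε := by nlinarith
  have hp2N : p ^ 2 * N ≤ 2 * Q := by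
    have := mul_le_mul_of_nonneg_left hN (by positivity : 0 ≤ p ^ 2)
    linarith
  have h1 : B * K ≤ B * (κ * Q) := mul_le_mul_of_nonneg_left hK hB
  have h2 : L * w ≤ κ * Q * w := mul_le_mul_of_nonneg_right hL hlp
  have hlhs : B * K + M / ε ^ 2 * (ε / M * (B * K) + 2 * (2 * L) * w + Real.log 2 +
      p ^ 2 * N + l) = ((ε ^ 2 + ε) * (B * K) + M * (4 * (L * w) + Real.log 2 + p ^ 2 * N + l)) /
        ε ^ 2 := by
    field_simp
    ring
  rw [hlhs, mul_assoc, div_mul_eq_mul_div]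
  refine div_le_div_of_nonneg_right ?_ hε2.le
  have h3 : (ε ^ 2 + ε) * (B * K) ≤ 2 * (B * (κ * Q)) := by
    have a1 := mul_le_mul_of_nonneg_left h1 (by positivity : 0 ≤ ε ^ 2 + ε)
    have a2 : (ε ^ 2 + ε) * (B * (κ * Q)) ≤ 2 * (B * (κ * Q)) :=
      mul_le_mul_of_nonneg_right (by linarith) (by positivity)
    linarith
  have h4 : M * (4 * (L * w) + Real.log 2 + p ^ 2 * N + l) ≤ M * (4 * (κ * Q * w) + 4 * Q) :=
    mul_le_mul_of_nonneg_left (by linarith) hM.le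
  have h5 : 0 ≤ B * κ * Q * w := by positivity
  have h6 : 0 ≤ M * κ * Q := by positivity
  have h7 : 0 ≤ M * Q * w := by positivity
  nlinarith

end DecoderBound

/-! ### The geometry of the zig-zag blocks -/

section Zigzag

/-- The ranges of the height, the width and the block width. -/
structure ZigzagParams (c m b : ℕ) : Prop where
  three_le : 3 ≤ c
  le_width : c ≤ m
  block : b = 2 ∨ b = 3

/-- The first row of block `t`. -/
def blockRow (m b t : ℕ) : ℕ := 3 * (t / (m - b + 3)) + (t % (m - b + 3) - (m - b))

/-- The first column of block `t`. -/
def blockCol (m b t : ℕ) : ℕ :=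
  if t / (m - b + 3) % 2 = 0 then min (t % (m - b + 3)) (m - b) else m - b - t % (m - b + 3)

/-- The number of rows of block `t`. -/
def blockHeight (c m b t : ℕ) : ℕ :=
  if t % (m - b + 3) ≤ m - b ∧ c < 3 * (t / (m - b + 3)) + 6 then c - 3 * (t / (m - b + 3)) else 3

/-- The vertex `v` lies in the rectangle of block `t`. -/
def InRect (c m b t : ℕ) (v : Fin c × Fin m) : Prop :=
  blockRow m b t ≤ v.1 ∧ (v.1 : ℕ) < blockRow m b t + blockHeight c m b t ∧
    blockCol m b t ≤ v.2 ∧ (v.2 : ℕ) < blockCol m b t + b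

variable {c m b t : ℕ}

theorem isTurnColumn_iff (m b a j : ℕ) :
    IsTurnColumn m b a j ↔ (a % 2 = 0 ∧ m ≤ j + b) ∨ (a % 2 = 1 ∧ j < b) := by
  unfold IsTurnColumn
  split_ifs with h
  · rw [Nat.even_iff] at h; omega
  · rw [Nat.even_iff] at h; omega

/-- The last strip has no turn; this is why the number of blocks carries `- 2`. -/
theorem zigzag_index (ht : t < c / 3 * (m - b + 3) - 2) :
    t / (m - b + 3) < c / 3 ∧ (m - b < t % (m - b + 3) → t / (m - b + 3) + 1 < c / 3) := by
  have h1 : t / (m - b + 3) < c / 3 := by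
    rw [Nat.div_lt_iff_lt_mul (by omega)]; omega
  refine ⟨h1, fun h2 => ?_⟩
  by_contra h3
  have h4 : c / 3 = t / (m - b + 3) + 1 := by omega
  rw [h4, Nat.add_mul, one_mul] at ht
  have h5 := Nat.div_add_mod t (m - b + 3)
  rw [mul_comm] at h5
  omega

theorem inZigzagBlock_iff (hp : ZigzagParams c m b) (ht : t < c / 3 * (m - b + 3) - 2)
    (v : Fin c × Fin m) : InZigzagBlock c m b t v ↔ InRect c m b t v := by
  obtain ⟨h1, h2⟩ := zigzag_index ht
  obtain ⟨hc, hm, hb⟩ := hp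
  have hk := Nat.mod_lt t (show 0 < m - b + 3 by omega)
  have hv1 := v.1.2
  have hv2 := v.2.2
  unfold InZigzagBlock InRect blockRow blockCol blockHeight
  simp only [isTurnColumn_iff, stripOf, Nat.even_iff]
  generalize t / (m - b + 3) = a at *
  generalize t % (m - b + 3) = k at *
  by_cases h3 : k ≤ m - b
  · by_cases h4 : c < 3 * a + 6 <;> by_cases h5 : a % 2 = 0 <;>
      simp only [h3, h4, h5, if_true, if_false, true_and, and_true] <;> omega
  · have h6 : m - b - k = 0 := by omega
    have h7 : min k (m - b) = m - b := by omega
    by_cases h5 : a % 2 = 0 <;>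
      simp only [h3, h5, h6, h7, if_true, if_false, true_and, false_and, zero_ne_one, or_false,
        false_or] <;> omega

theorem block_bounds (hp : ZigzagParams c m b) (ht : t < c / 3 * (m - b + 3) - 2) :
    3 ≤ blockHeight c m b t ∧ blockHeight c m b t ≤ 5 ∧
      blockRow m b t + blockHeight c m b t ≤ c ∧ blockCol m b t + b ≤ m := by
  obtain ⟨h1, h2⟩ := zigzag_index ht
  obtain ⟨hc, hm, hb⟩ := hp
  have hk := Nat.mod_lt t (show 0 < m - b + 3 by omega)
  unfold blockRow blockCol blockHeight
  generalize t / (m - b + 3) = a at *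
  generalize t % (m - b + 3) = k at *
  split_ifs <;> omega

theorem div_mod_succ (t B : ℕ) (hB : 0 < B) :
    (t % B + 1 < B ∧ (t + 1) / B = t / B ∧ (t + 1) % B = t % B + 1) ∨
      (t % B + 1 = B ∧ (t + 1) / B = t / B + 1 ∧ (t + 1) % B = 0) := by
  have h1 := Nat.div_add_mod t B
  have h2 := Nat.mod_lt t hB
  by_cases h : t % B + 1 < B
  · have h3 : t + 1 = (t % B + 1) + B * (t / B) := by omega
    refine Or.inl ⟨h, ?_, ?_⟩
    · rw [h3, Nat.add_mul_div_left _ _ hB, Nat.div_eq_of_lt h, zero_add]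
    · rw [h3, Nat.add_mul_mod_self_left, Nat.mod_eq_of_lt h]
  · have h3 : t + 1 = 0 + B * (t / B + 1) := by rw [Nat.mul_add]; omega
    refine Or.inr ⟨by omega, ?_, ?_⟩
    · rw [h3, Nat.add_mul_div_left _ _ hB, Nat.zero_div, zero_add]
    · rw [h3, Nat.add_mul_mod_self_left, Nat.zero_mod]

/-- The step from block `t` to block `t + 1`. -/
theorem block_step (m b t : ℕ) :
    (t % (m - b + 3) < m - b → blockRow m b (t + 1) = blockRow m b t ∧
      (t / (m - b + 3) % 2 = 0 → blockCol m b (t + 1) = blockCol m b t + 1) ∧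
      (t / (m - b + 3) % 2 = 1 → blockCol m b (t + 1) + 1 = blockCol m b t)) ∧
    (m - b ≤ t % (m - b + 3) → blockRow m b (t + 1) = blockRow m b t + 1 ∧
      blockCol m b (t + 1) = blockCol m b t) := by
  have h := div_mod_succ t (m - b + 3) (by omega)
  unfold blockRow blockCol
  rcases h with ⟨h1, h2, h3⟩ | ⟨h1, h2, h3⟩
  · rw [h2, h3]
    generalize t / (m - b + 3) = a at *
    generalize t % (m - b + 3) = k at *
    split_ifs <;> omega
  · rw [h2, h3]
    generalize t / (m - b + 3) = a at *
    generalize t % (m - b + 3) = k at *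
    split_ifs <;> omega

/-- Blocks whose strip numbers differ by two or more share no row. Within a strip, or across one
turn, a block can slide only a few positions before it leaves a given vertex. The constant 6 is a
convenient bound. -/
theorem inRect_dist (hp : ZigzagParams c m b) {t t' : ℕ} (ht : t < c / 3 * (m - b + 3) - 2)
    (ht' : t' < c / 3 * (m - b + 3) - 2) {v : Fin c × Fin m} (hv : InRect c m b t v)
    (hv' : InRect c m b t' v) : t ≤ t' + 6 := by
  obtain ⟨h1, h2⟩ := zigzag_index ht
  obtain ⟨h1', h2'⟩ := zigzag_index ht'
  obtain ⟨hc, hm, hb⟩ := hp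
  have hk := Nat.mod_lt t (show 0 < m - b + 3 by omega)
  have hk' := Nat.mod_lt t' (show 0 < m - b + 3 by omega)
  have e := Nat.div_add_mod t (m - b + 3)
  have e' := Nat.div_add_mod t' (m - b + 3)
  unfold InRect blockRow blockCol blockHeight at hv hv'
  have hle : t / (m - b + 3) ≤ t' / (m - b + 3) + 1 := by
    generalize t / (m - b + 3) = a at *
    generalize t % (m - b + 3) = k at *
    generalize t' / (m - b + 3) = a' at *
    generalize t' % (m - b + 3) = k' at *
    clear e e'
    by_contra hcon
    split_ifs at hv hv' <;> omega
  have hcase : t / (m - b + 3) < t' / (m - b + 3) ∨ t / (m - b + 3) = t' / (m - b + 3) ∨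
    t / (m - b + 3) = t' / (m - b + 3) + 1 := by omega
  rcases hcase with h | h | h
  · have : t < t' := by
      by_contra hcon
      exact absurd (Nat.div_le_div_right (c := m - b + 3) (not_lt.1 hcon)) (by omega)
    omega
  · rw [h] at e hv h1 h2
    generalize t' / (m - b + 3) = a' at *
    generalize t % (m - b + 3) = k at *
    generalize t' % (m - b + 3) = k' at *
    generalize (m - b + 3) * a' = x at *
    split_ifs at hv hv' <;> omega
  · rw [h] at e hv h1 h2
    rw [Nat.mul_add, mul_one] at e
    generalize t' / (m - b + 3) = a' at *
    generalize t % (m - b + 3) = k at *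
    generalize t' % (m - b + 3) = k' at *
    generalize (m - b + 3) * a' = x at *
    split_ifs at hv hv' <;> omega

/-- A form without conditionals, in which the larger height appears only as a property of the last
strip; it is suited to linear arithmetic. -/
theorem inRect_iff (hp : ZigzagParams c m b) (ht : t < c / 3 * (m - b + 3) - 2)
    (v : Fin c × Fin m) : InRect c m b t v ↔
      3 * (t / (m - b + 3)) + (t % (m - b + 3) - (m - b)) ≤ v.1 ∧
      ((v.1 : ℕ) < 3 * (t / (m - b + 3)) + (t % (m - b + 3) - (m - b)) + 3 ∨
        (t % (m - b + 3) ≤ m - b ∧ t / (m - b + 3) + 1 = c / 3)) ∧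
      ((t / (m - b + 3) % 2 = 0 ∧ min (t % (m - b + 3)) (m - b) ≤ v.2 ∧
        (v.2 : ℕ) < min (t % (m - b + 3)) (m - b) + b) ∨
        (t / (m - b + 3) % 2 = 1 ∧ m - b - t % (m - b + 3) ≤ v.2 ∧
          (v.2 : ℕ) < m - b - t % (m - b + 3) + b)) := by
  obtain ⟨g, g'⟩ := zigzag_index ht
  have hvc := v.1.2
  unfold InRect blockRow blockCol blockHeight
  generalize t / (m - b + 3) = a at *
  generalize t % (m - b + 3) = k at *
  have hp := hp.three_le
  split_ifs <;> omega

/-- Along the zig-zag each vertex is entered and left only once; this is the coherence of the path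
decomposition. The outer blocks lie in the same or in consecutive strips. In the latter case the
earlier one is already sliding down in the turn columns, which remain the common columns of the
blocks around the turn. -/
theorem inRect_between (hp : ZigzagParams c m b) {t₁ t₂ t₃ : ℕ}
    (ht₃ : t₃ < c / 3 * (m - b + 3) - 2) (h₁₂ : t₁ ≤ t₂) (h₂₃ : t₂ ≤ t₃) {v : Fin c × Fin m}
    (hv₁ : InRect c m b t₁ v) (hv₃ : InRect c m b t₃ v) : InRect c m b t₂ v := by
  have ht₂ := h₂₃.trans_lt ht₃
  have ht₁ := h₁₂.trans_lt ht₂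
  rw [inRect_iff hp ‹_›] at *
  obtain ⟨g₁, g₁'⟩ := zigzag_index ht₁
  obtain ⟨g₂, g₂'⟩ := zigzag_index ht₂
  obtain ⟨g₃, g₃'⟩ := zigzag_index ht₃
  clear ht₁ ht₂ ht₃
  obtain ⟨hc, hm, hb⟩ := hp
  have hB : 0 < m - b + 3 := by omega
  have k₁ := Nat.mod_lt t₁ hB
  have k₂ := Nat.mod_lt t₂ hB
  have k₃ := Nat.mod_lt t₃ hB
  have e₁ := Nat.div_add_mod t₁ (m - b + 3)
  have e₂ := Nat.div_add_mod t₂ (m - b + 3)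
  have e₃ := Nat.div_add_mod t₃ (m - b + 3)
  have d₁₂ := Nat.div_le_div_right (c := m - b + 3) h₁₂
  have d₂₃ := Nat.div_le_div_right (c := m - b + 3) h₂₃
  have hvc := v.1.2
  have hvm := v.2.2
  obtain ⟨r₁, s₁, q₁⟩ := hv₁
  obtain ⟨r₃, s₃, q₃⟩ := hv₃
  have hle : t₃ / (m - b + 3) ≤ t₁ / (m - b + 3) + 1 := by
    clear e₁ e₂ e₃ q₁ q₃ s₃
    omega
  have hcase : (t₃ / (m - b + 3) = t₁ / (m - b + 3) ∧ t₂ / (m - b + 3) = t₁ / (m - b + 3)) ∨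
      (t₃ / (m - b + 3) = t₁ / (m - b + 3) + 1 ∧ t₂ / (m - b + 3) = t₁ / (m - b + 3)) ∨
      (t₃ / (m - b + 3) = t₁ / (m - b + 3) + 1 ∧ t₂ / (m - b + 3) = t₁ / (m - b + 3) + 1) := by
    clear q₁ q₃ s₁ s₃
    omega
  rcases hcase with ⟨h, h'⟩ | ⟨h, h'⟩ | ⟨h, h'⟩
  · rw [h] at e₃ r₃ s₃ q₃ g₃ g₃'
    rw [h'] at e₂ g₂ g₂' ⊢
    generalize t₁ / (m - b + 3) = a at *
    generalize t₁ % (m - b + 3) = l₁ at *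
    generalize t₂ % (m - b + 3) = l₂ at *
    generalize t₃ % (m - b + 3) = l₃ at *
    have i₁ : l₁ ≤ l₂ := by clear q₁ q₃ s₁ s₃; omega
    have i₂ : l₂ ≤ l₃ := by clear q₁ q₃ s₁ s₃; omega
    clear e₁ e₂ e₃ h h' d₁₂ d₂₃ hle h₁₂ h₂₃ g₃'
    refine ⟨by clear q₁ q₃; omega, by clear q₁ q₃; omega, ?_⟩
    clear s₁ s₃ r₁ r₃ g₁ g₂ g₁' g₂' g₃ hvc
    rcases Nat.mod_two_eq_zero_or_one a with ha | ha
    · simp only [ha, true_and, zero_ne_one, false_and, or_false] at q₁ q₃ ⊢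
      omega
    · simp only [ha, true_and, one_ne_zero, false_and, false_or] at q₁ q₃ ⊢
      omega
  · rw [h] at e₃ r₃ s₃ q₃ g₃ g₃'
    rw [h'] at e₂ g₂ g₂' ⊢
    generalize t₁ / (m - b + 3) = a at *
    generalize t₁ % (m - b + 3) = l₁ at *
    generalize t₂ % (m - b + 3) = l₂ at *
    generalize t₃ % (m - b + 3) = l₃ at *
    have i₁ : l₁ ≤ l₂ := by clear q₁ q₃ s₁ s₃; omega
    have i₂ : m - b < l₁ := by clear q₁ q₃ e₁ e₂ e₃ s₃; omega
    clear e₁ e₂ e₃ h h' d₁₂ d₂₃ hle h₁₂ h₂₃ g₃'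
    refine ⟨by clear q₁ q₃; omega, by clear q₁ q₃; omega, ?_⟩
    clear s₁ s₃ r₁ r₃ g₁ g₂ g₁' g₂' g₃ hvc
    rcases Nat.mod_two_eq_zero_or_one a with ha | ha
    · simp only [ha, true_and, zero_ne_one, false_and, or_false] at q₁ ⊢
      clear q₃
      omega
    · simp only [ha, true_and, one_ne_zero, false_and, false_or] at q₁ ⊢
      clear q₃
      omega
  · rw [h] at e₃ r₃ s₃ q₃ g₃ g₃'
    rw [h'] at e₂ g₂ g₂' ⊢
    rw [Nat.mul_add, mul_one] at e₂ e₃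
    generalize t₁ / (m - b + 3) = a at *
    generalize t₁ % (m - b + 3) = l₁ at *
    generalize t₂ % (m - b + 3) = l₂ at *
    generalize t₃ % (m - b + 3) = l₃ at *
    have i₁ : l₂ ≤ l₃ := by clear q₁ q₃ s₁ s₃; omega
    have i₂ : m - b < l₁ := by clear q₁ q₃ e₁ e₂ e₃ s₃; omega
    clear e₁ e₂ e₃ h h' d₁₂ d₂₃ hle h₁₂ h₂₃ g₃'
    refine ⟨by clear q₁ q₃; omega, by clear q₁ q₃; omega, ?_⟩
    clear s₁ s₃ r₁ r₃ g₁ g₂ g₁' g₂' g₃ hvc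
    rcases Nat.mod_two_eq_zero_or_one a with ha | ha
    · have ha' : (a + 1) % 2 = 1 := by omega
      simp only [ha, ha', true_and, one_ne_zero, zero_ne_one, false_and, or_false,
        false_or] at q₁ q₃ ⊢
      omega
    · have ha' : (a + 1) % 2 = 0 := by omega
      simp only [ha, ha', true_and, one_ne_zero, zero_ne_one, false_and, or_false,
        false_or] at q₁ q₃ ⊢
      omega

theorem zigzag_adj_iff (u v : Fin c × Fin m) : (zigzagGraph c m b).Adj u v ↔
    (grid c m).Adj u v ∧ (stripOf c u.1 = stripOf c v.1 ∨
      (IsTurnColumn m b (min (stripOf c u.1) (stripOf c v.1)) u.2 ∧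
        IsTurnColumn m b (min (stripOf c u.1) (stripOf c v.1)) v.2)) := Iff.rfl

theorem zigzag_adj_right {u v : Fin c × Fin m} (h₁ : (u.1 : ℕ) = v.1)
    (h₂ : (u.2 : ℕ) + 1 = v.2) : (zigzagGraph c m b).Adj u v := by
  rw [zigzag_adj_iff, grid_adj_iff, h₁]
  exact ⟨Or.inl ⟨rfl, Or.inl h₂⟩, Or.inl rfl⟩

theorem zigzag_adj_down_iff {u v : Fin c × Fin m} (h₁ : (u.1 : ℕ) + 1 = v.1)
    (h₂ : (u.2 : ℕ) = v.2) : (zigzagGraph c m b).Adj u v ↔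
      (stripOf c u.1 = stripOf c v.1 ∨ IsTurnColumn m b (stripOf c u.1) u.2) := by
  have : min (stripOf c u.1) (stripOf c v.1) = stripOf c u.1 := by
    unfold stripOf; omega
  rw [zigzag_adj_iff, grid_adj_iff, this, ← h₂, and_self]
  exact and_iff_right (Or.inr ⟨rfl, Or.inl h₁⟩)

/-- No edge is lost inside a block: only the sliding blocks cross a strip boundary, and they lie in
turn columns. -/
theorem zigzag_adj_of_inRect (hp : ZigzagParams c m b) (ht : t < c / 3 * (m - b + 3) - 2)
    {u v : Fin c × Fin m} (hu : InRect c m b t u) (hv : InRect c m b t v)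
    (huv : (grid c m).Adj u v) : (zigzagGraph c m b).Adj u v := by
  have key : ∀ {u v : Fin c × Fin m}, InRect c m b t u → InRect c m b t v →
      (u.1 : ℕ) + 1 = v.1 → (u.2 : ℕ) = v.2 → (zigzagGraph c m b).Adj u v := by
    intro u v hu hv h₁ h₂
    rw [zigzag_adj_down_iff h₁ h₂, isTurnColumn_iff]
    obtain ⟨g₁, g₁'⟩ := zigzag_index ht
    obtain ⟨hc, hm, hb⟩ := hp
    have hk := Nat.mod_lt t (show 0 < m - b + 3 by omega)
    have hvc := v.1.2
    unfold InRect blockRow blockCol blockHeight at hu hv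
    unfold stripOf
    generalize t / (m - b + 3) = a at *
    generalize t % (m - b + 3) = k at *
    split_ifs at hu hv <;> omega
  rcases (grid_adj_iff u v).1 huv with ⟨h₁, h₂ | h₂⟩ | ⟨h₁, h₂ | h₂⟩
  · exact zigzag_adj_right h₁ h₂
  · exact (zigzag_adj_right h₁.symm h₂).symm
  · exact key hu hv h₂ h₁
  · exact (key hv hu h₂ h₁.symm).symm

end Zigzag

/-! ### The zig-zag decomposition is an admissible tree decomposition -/

section PathGraph

theorem pathGraph_isTree (n : ℕ) : (SimpleGraph.pathGraph (n + 1)).IsTree := by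
  rw [SimpleGraph.isTree_iff_connected_and_card]
  refine ⟨SimpleGraph.pathGraph_connected n, ?_⟩
  have hinj : Function.Injective fun j : Fin n => s(j.castSucc, j.succ) := by
    intro j k h
    simp only [Sym2.eq_iff, Fin.ext_iff, Fin.val_castSucc, Fin.val_succ] at h
    exact Fin.ext (by omega)
  have : (SimpleGraph.pathGraph (n + 1)).edgeSet = Set.range fun j : Fin n => s(j.castSucc, j.succ) := by
    ext e
    induction e with
    | h a b =>
      simp only [SimpleGraph.mem_edgeSet, SimpleGraph.pathGraph_adj, Set.mem_range, Sym2.eq_iff,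
        Fin.ext_iff, Fin.val_castSucc, Fin.val_succ]
      constructor
      · rintro (h | h)
        · exact ⟨⟨a, by omega⟩, Or.inl ⟨rfl, h⟩⟩
        · exact ⟨⟨b, by omega⟩, Or.inr ⟨rfl, h⟩⟩
      · rintro ⟨j, h | h⟩ <;> omega
  rw [this, Nat.card_range_of_injective hinj]
  simp

/-- A discrete intermediate value theorem: positions change by one at each step. -/
theorem pathGraph_mem_support {N : ℕ} {u v : Fin N} (w : (SimpleGraph.pathGraph N).Walk u v)
    {x : Fin N} (h : (u ≤ x ∧ x ≤ v) ∨ (v ≤ x ∧ x ≤ u)) : x ∈ w.support := by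
  induction w with
  | nil =>
    have : x = _ := le_antisymm (h.elim And.right And.right) (h.elim And.left And.left)
    simp [this]
  | @cons a b e hab w ih =>
    rw [SimpleGraph.Walk.support_cons, List.mem_cons]
    by_cases hx : x = a
    · exact Or.inl hx
    · right
      apply ih
      rw [SimpleGraph.pathGraph_adj] at hab
      have hx' : (x : ℕ) ≠ a := fun h => hx (Fin.ext h)
      simp only [Fin.le_def] at h ⊢
      omega

/-- If `j` were beyond `k`, the part of the walk before `j` would already pass `k`, which is visited
again at the end. If `j` were beyond `i`, the part after `j` would return to `i`. -/
theorem pathGraph_isPath_between {N : ℕ} {i k : Fin N} (w : (SimpleGraph.pathGraph N).Walk i k)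
    (hw : w.IsPath) {j : Fin N} (hj : j ∈ w.support) : (i ≤ j ∧ j ≤ k) ∨ (k ≤ j ∧ j ≤ i) := by
  have hnd : (w.takeUntil j hj).support.Disjoint (w.dropUntil j hj).support.tail := by
    have h := hw.support_nodup
    rw [← SimpleGraph.Walk.take_spec w hj, SimpleGraph.Walk.support_append] at h
    exact List.disjoint_of_nodup_append h
  have key : ∀ x, x ≠ j → x ∈ (w.takeUntil j hj).support → x ∉ (w.dropUntil j hj).support := by
    intro x hx h1 h2
    rw [← SimpleGraph.Walk.cons_tail_support, List.mem_cons] at h2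
    exact hnd h1 (h2.resolve_left hx)
  by_contra hcon
  have hij : i ≠ j := by rintro rfl; exact hcon (by have := le_total i k; tauto)
  have hkj : k ≠ j := by rintro rfl; exact hcon (by have := le_total i k; tauto)
  have hij' : (i : ℕ) ≠ j := fun h => hij (Fin.ext h)
  have hkj' : (k : ℕ) ≠ j := fun h => hkj (Fin.ext h)
  by_cases h : ((i : ℕ) ≤ k ∧ (k : ℕ) ≤ j) ∨ ((j : ℕ) ≤ k ∧ (k : ℕ) ≤ i)
  · exact key k hkj (pathGraph_mem_support _ (by simp only [Fin.le_def]; omega))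
      (SimpleGraph.Walk.end_mem_support _)
  · refine key i hij (SimpleGraph.Walk.start_mem_support _) (pathGraph_mem_support _ ?_)
    simp only [Fin.le_def] at hcon ⊢
    omega

theorem pathGraph_neighborSet_ncard_le {N : ℕ} (i : Fin N) :
    ((SimpleGraph.pathGraph N).neighborSet i).ncard ≤ 2 := by
  have : ((SimpleGraph.pathGraph N).neighborSet i).ncard ≤ ({1, -1} : Set ℤ).ncard := by
    refine Set.ncard_le_ncard_of_injOn (fun j => (j : ℤ) - i) ?_ ?_ (Set.toFinite _)
    · intro j hj
      rw [SimpleGraph.mem_neighborSet, SimpleGraph.pathGraph_adj] at hj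
      simp only [Set.mem_insert_iff, Set.mem_singleton_iff]
      omega
    · intro j _ k _ h
      simp only at h
      exact Fin.ext (by omega)
  exact this.trans ((Set.ncard_insert_le _ _).trans (by simp))

end PathGraph

/-! ### The zig-zag blocks form a non-redundant path decomposition. -/

section ZigzagDecomposition

variable {c m b : ℕ}

theorem numBags_pos (hp : ZigzagParams c m b) : 0 < (zigzagDecomposition c m b).numBags := by
  have := hp.three_le
  have h : 1 ≤ c / 3 := by omega
  change 0 < c / 3 * (m - b + 3) - 2
  have := Nat.mul_le_mul_right (m - b + 3) h
  omega

theorem mem_zigzag_bag (hp : ZigzagParams c m b) (t : Fin (zigzagDecomposition c m b).numBags)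
    (v : Fin c × Fin m) : v ∈ (zigzagDecomposition c m b).bag t ↔ InRect c m b t v := by
  rw [← inZigzagBlock_iff hp t.2]
  simp [zigzagDecomposition]

theorem mem_zigzag_ext (hp : ZigzagParams c m b) (t : Fin (zigzagDecomposition c m b).numBags)
    (v : Fin c × Fin m) : v ∈ (zigzagDecomposition c m b).ext t ↔
      InRect c m b t v ∨ ∃ u, InRect c m b t u ∧ (zigzagGraph c m b).Adj u v := by
  simp_rw [← inZigzagBlock_iff hp t.2]
  simp [zigzagDecomposition]

theorem zigzag_bag_subset_ext (hp : ZigzagParams c m b)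
    (t : Fin (zigzagDecomposition c m b).numBags) :
    (zigzagDecomposition c m b).bag t ⊆ (zigzagDecomposition c m b).ext t := fun v hv =>
  (mem_zigzag_ext hp t v).2 (Or.inl ((mem_zigzag_bag hp t v).1 hv))

theorem zigzag_probed_le : (zigzagDecomposition c m b).probed ≤ grid c m := fun _ _ h => h.1

/-- Besides the covering of edges, this locates the neighbors added to an extended block in blocks
that are near it on the path. -/
theorem exists_inRect_of_adj (hp : ZigzagParams c m b) {u v : Fin c × Fin m}
    (h : (zigzagGraph c m b).Adj u v) :
    ∃ t < c / 3 * (m - b + 3) - 2, InRect c m b t u ∧ InRect c m b t v := by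
  have key : ∀ a k, a < c / 3 → k < m - b + 3 → (m - b < k → a + 1 < c / 3) →
      a * (m - b + 3) + k < c / 3 * (m - b + 3) - 2 := by
    intro a k ha hk hak
    by_cases h : a + 1 < c / 3
    · have := Nat.mul_le_mul_right (m - b + 3) (show a + 2 ≤ c / 3 by omega)
      rw [Nat.add_mul] at this
      omega
    · have h4 : c / 3 = a + 1 := by omega
      rw [h4, Nat.add_mul]
      have : k ≤ m - b := by by_contra hcon; exact h (hak (by omega))
      omega
  have main : ∀ a k, a < c / 3 → k < m - b + 3 → (m - b < k → a + 1 < c / 3) →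
      (∀ w : Fin c × Fin m, w = u ∨ w = v →
        3 * a + (k - (m - b)) ≤ w.1 ∧
        ((w.1 : ℕ) < 3 * a + (k - (m - b)) + 3 ∨ (k ≤ m - b ∧ a + 1 = c / 3)) ∧
        ((a % 2 = 0 ∧ min k (m - b) ≤ w.2 ∧ (w.2 : ℕ) < min k (m - b) + b) ∨
          (a % 2 = 1 ∧ m - b - k ≤ w.2 ∧ (w.2 : ℕ) < m - b - k + b))) →
      ∃ t < c / 3 * (m - b + 3) - 2, InRect c m b t u ∧ InRect c m b t v := by
    intro a k ha hk hak hw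
    have hB : 0 < m - b + 3 := by omega
    have e1 : (a * (m - b + 3) + k) / (m - b + 3) = a := by
      rw [mul_comm, Nat.mul_add_div hB, Nat.div_eq_of_lt hk, add_zero]
    have e2 : (a * (m - b + 3) + k) % (m - b + 3) = k := by
      rw [mul_comm, Nat.mul_add_mod, Nat.mod_eq_of_lt hk]
    refine ⟨_, key a k ha hk hak, ?_, ?_⟩
    · rw [inRect_iff hp (key a k ha hk hak), e1, e2]; exact hw u (Or.inl rfl)
    · rw [inRect_iff hp (key a k ha hk hak), e1, e2]; exact hw v (Or.inr rfl)
  wlog hle : (u.1 : ℕ) ≤ v.1 ∧ (u.2 : ℕ) ≤ v.2 generalizing u v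
  · obtain ⟨t, ht, h1, h2⟩ := this h.symm (fun a k ha hk hak hw => by
      obtain ⟨t, ht, h1, h2⟩ := main a k ha hk hak fun w hw' => hw w hw'.symm
      exact ⟨t, ht, h2, h1⟩) (by have := (grid_adj_iff u v).1 h.1; omega)
    exact ⟨t, ht, h2, h1⟩
  obtain ⟨hadj, hstrip⟩ := (zigzag_adj_iff u v).1 h
  rw [grid_adj_iff] at hadj
  obtain ⟨hc, hm, hb⟩ := hp
  have hu1 := u.1.2
  have hu2 := u.2.2
  have hv1 := v.1.2
  have hv2 := v.2.2
  clear key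
  by_cases hs : stripOf c u.1 = stripOf c v.1
  · clear hstrip
    obtain ⟨a, ha⟩ : ∃ a, a = stripOf c u.1 := ⟨_, rfl⟩
    have ha' := hs
    rw [← ha] at ha'
    unfold stripOf at ha ha'
    -- The block starting at the left end of the edge, shifted back if it would leave the grid. As
    -- `b ≥ 2`, it also contains the next column.
    obtain ⟨j, hj⟩ : ∃ j, j = min (u.2 : ℕ) (m - b) := ⟨_, rfl⟩
    rcases Nat.mod_two_eq_zero_or_one a with hpar | hpar
    · refine main a j (by omega) (by omega) (fun h => by omega) fun w hw => ?_
      have hw' : ((w.1 : ℕ) = u.1 ∧ (w.2 : ℕ) = u.2) ∨ ((w.1 : ℕ) = v.1 ∧ (w.2 : ℕ) = v.2) := by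
        rcases hw with rfl | rfl <;> simp
      clear main hw hs h
      refine ⟨by omega, by omega, Or.inl ⟨hpar, ?_, ?_⟩⟩ <;> omega
    · refine main a (m - b - j) (by omega) (by omega) (fun h => by omega) fun w hw => ?_
      have hw' : ((w.1 : ℕ) = u.1 ∧ (w.2 : ℕ) = u.2) ∨ ((w.1 : ℕ) = v.1 ∧ (w.2 : ℕ) = v.2) := by
        rcases hw with rfl | rfl <;> simp
      clear main hw hs h
      refine ⟨by omega, by omega, Or.inr ⟨hpar, ?_, ?_⟩⟩ <;> omega
  · have hstrip' := hstrip.resolve_left hs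
    have hmin : min (stripOf c u.1) (stripOf c v.1) = stripOf c u.1 := by
      unfold stripOf; omega
    rw [hmin, isTurnColumn_iff, isTurnColumn_iff] at hstrip'
    clear hstrip hmin
    obtain ⟨a, ha⟩ : ∃ a, a = stripOf c u.1 := ⟨_, rfl⟩
    rw [← ha] at hstrip' hs
    unfold stripOf at ha hs
    have hrow : (u.1 : ℕ) = 3 * a + 2 ∧ (v.1 : ℕ) = 3 * a + 3 ∧ a + 1 < c / 3 := by omega
    clear hs ha
    -- An edge between two strips lies in the block that has slid down by one row.
    refine main a (m - b + 1) (by omega) (by omega) (fun h => by omega) fun w hw => ?_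
    have hw' : ((w.1 : ℕ) = u.1 ∧ (w.2 : ℕ) = u.2) ∨ ((w.1 : ℕ) = v.1 ∧ (w.2 : ℕ) = v.2) := by
      rcases hw with rfl | rfl <;> simp
    clear main hw h
    refine ⟨by omega, by omega, ?_⟩
    omega

/-- Each step adds one column or row and drops another, so neither of two consecutive blocks
contains the other. -/
theorem block_not_subset (hp : ZigzagParams c m b) {t : ℕ}
    (ht : t + 1 < c / 3 * (m - b + 3) - 2) :
    (∃ v, InRect c m b t v ∧ ¬ InRect c m b (t + 1) v) ∧
      ∃ v, InRect c m b (t + 1) v ∧ ¬ InRect c m b t v := by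
  have s := block_step m b t
  obtain ⟨a₁, a₂, a₃, a₄⟩ := block_bounds hp (show t < c / 3 * (m - b + 3) - 2 by omega)
  obtain ⟨b₁, b₂, b₃, b₄⟩ := block_bounds hp ht
  have hb := hp.block
  unfold InRect
  have mk : ∀ r j, r < c → j < m → ∃ v : Fin c × Fin m, (v.1 : ℕ) = r ∧ (v.2 : ℕ) = j :=
    fun r j hr hj => ⟨(⟨r, hr⟩, ⟨j, hj⟩), rfl, rfl⟩
  by_cases h : t % (m - b + 3) < m - b
  · obtain ⟨s1, s2, s3⟩ := s.1 h
    rcases Nat.mod_two_eq_zero_or_one (t / (m - b + 3)) with hpar | hpar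
    · have s2 := s2 hpar
      constructor
      · obtain ⟨v, h1, h2⟩ := mk (blockRow m b t) (blockCol m b t) (by omega) (by omega)
        exact ⟨v, by omega, by omega⟩
      · obtain ⟨v, h1, h2⟩ := mk (blockRow m b t) (blockCol m b t + b) (by omega) (by omega)
        exact ⟨v, by omega, by omega⟩
    · have s3 := s3 hpar
      constructor
      · obtain ⟨v, h1, h2⟩ := mk (blockRow m b t) (blockCol m b (t + 1) + b) (by omega) (by omega)
        exact ⟨v, by omega, by omega⟩
      · obtain ⟨v, h1, h2⟩ := mk (blockRow m b t) (blockCol m b (t + 1)) (by omega) (by omega)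
        exact ⟨v, by omega, by omega⟩
  · obtain ⟨s1, s2⟩ := s.2 (by omega)
    -- Only blocks of the last strip are taller than three rows, and from there the path never
    -- slides down.
    have hh : blockHeight c m b t = 3 := by
      have h1 := (zigzag_index ht)
      have h2 := div_mod_succ t (m - b + 3) (by omega)
      have h3 := Nat.mod_lt t (show 0 < m - b + 3 by omega)
      unfold blockHeight
      refine if_neg ?_
      have hc := hp.three_le
      omega
    constructor
    · obtain ⟨v, h1, h2⟩ := mk (blockRow m b t) (blockCol m b t) (by omega) (by omega)
      exact ⟨v, by omega, by omega⟩
    · obtain ⟨v, h1, h2⟩ := mk (blockRow m b t + 3) (blockCol m b t) (by omega) (by omega)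
      exact ⟨v, by omega, by omega⟩

theorem zigzag_isTreeDecomposition (hp : ZigzagParams c m b) :
    (zigzagDecomposition c m b).IsTreeDecomposition where
  isTree := by
    obtain ⟨n, hn⟩ := Nat.exists_eq_add_of_lt (numBags_pos hp)
    have h : ∀ N, N = n + 1 → (SimpleGraph.pathGraph N).IsTree := by
      rintro N rfl; exact pathGraph_isTree n
    exact h _ (hn.trans (by omega))
  vertex_mem := by
    intro v
    have hb := hp.block
    have hm := hp.le_width
    have hc := hp.three_le
    -- Every vertex has a horizontal edge, since `m ≥ 3`, and all horizontal edges are probed; so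
    -- the covering of edges covers the vertices.
    by_cases h : (v.2 : ℕ) + 1 < m
    · obtain ⟨t, ht, h1, -⟩ := exists_inRect_of_adj hp
        (zigzag_adj_right (c := c) (m := m) (b := b) (u := v) (v := (v.1, ⟨v.2 + 1, h⟩)) rfl rfl)
      exact ⟨⟨t, ht⟩, (mem_zigzag_bag hp _ _).2 h1⟩
    · have hv := v.2.2
      obtain ⟨t, ht, -, h1⟩ := exists_inRect_of_adj hp
        (zigzag_adj_right (c := c) (m := m) (b := b) (u := (v.1, ⟨v.2 - 1, by omega⟩)) (v := v) rfl
          (by simp only; omega))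
      exact ⟨⟨t, ht⟩, (mem_zigzag_bag hp _ _).2 h1⟩
  edge_mem := by
    intro u v h
    obtain ⟨t, ht, h1, h2⟩ := exists_inRect_of_adj hp h
    exact ⟨⟨t, ht⟩, (mem_zigzag_bag hp _ _).2 h1, (mem_zigzag_bag hp _ _).2 h2⟩
  coherent := by
    intro i k w hw j hj v hi hk
    rw [mem_zigzag_bag hp] at *
    rcases pathGraph_isPath_between w hw hj with ⟨h1, h2⟩ | ⟨h1, h2⟩
    · exact inRect_between hp k.2 h1 h2 hi hk
    · exact inRect_between hp i.2 h1 h2 hk hi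
  nonredundant := by
    intro i j hij hsub
    have hsub' : ∀ v, InRect c m b j v → InRect c m b i v := fun v hv =>
      (mem_zigzag_bag hp _ _).1 (hsub ((mem_zigzag_bag hp _ _).2 hv))
    have hi := i.2
    have hj := j.2
    rcases SimpleGraph.pathGraph_adj.1 hij with h | h
    · rw [← h] at hj hsub'
      obtain ⟨-, v, h1, h2⟩ := block_not_subset hp hj
      exact h2 (hsub' v h1)
    · rw [← h] at hi hsub'
      obtain ⟨⟨v, h1, h2⟩, -⟩ := block_not_subset hp hi
      exact h2 (hsub' v h1)

end ZigzagDecomposition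

/-! ### Overlaps, sizes, connectivity and crude cut bounds of the extended blocks. -/

section ZigzagCounts

variable {c m b : ℕ}

/-- A set of indices with pairwise distances at most `d` has at most `d + 1` elements. -/
theorem ncard_le_of_dist {N : ℕ} (s : Set (Fin N)) (d : ℕ)
    (h : ∀ i ∈ s, ∀ j ∈ s, (i : ℕ) ≤ j + d) : s.ncard ≤ d + 1 := by
  classical
  rcases s.eq_empty_or_nonempty with rfl | hne
  · simp
  · obtain ⟨i, hi, hmin⟩ := s.toFinite.exists_minimalFor (fun i : Fin N => (i : ℕ)) s hne
    have hle : ∀ j ∈ s, (i : ℕ) ≤ j := fun j hj => by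
      by_contra hcon
      exact hcon (hmin hj (le_of_lt (not_le.1 hcon)))
    have : s.ncard ≤ ((Finset.range (d + 1) : Finset ℕ) : Set ℕ).ncard := by
      refine Set.ncard_le_ncard_of_injOn (fun j => (j : ℕ) - i) ?_ ?_ (Set.toFinite _)
      · intro j hj
        have h1 := h j hj i hi
        have h2 := hle j hj
        simp only [Finset.coe_range, Set.mem_Iio]
        omega
      · intro j hj k hk hjk
        have h1 := hle j hj
        have h2 := hle k hk
        simp only at hjk
        exact Fin.ext (by omega)
    rwa [Set.ncard_coe_finset, Finset.card_range] at this

/-- A vertex of an extended block lies in a genuine block at most 6 steps away, namely one that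
contains the connecting edge. Three such distances give `18`, so edge sets of extended blocks at
distance 19 are disjoint. -/
theorem zigzag_ext_dist (hp : ZigzagParams c m b)
    {i j : Fin (zigzagDecomposition c m b).numBags} {v : Fin c × Fin m}
    (hi : v ∈ (zigzagDecomposition c m b).ext i) (hj : v ∈ (zigzagDecomposition c m b).ext j) :
    (i : ℕ) ≤ j + 18 := by
  have key : ∀ k : Fin (zigzagDecomposition c m b).numBags,
      v ∈ (zigzagDecomposition c m b).ext k → ∃ t < c / 3 * (m - b + 3) - 2,
        InRect c m b t v ∧ (k : ℕ) ≤ t + 6 ∧ t ≤ k + 6 := by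
    intro k hk
    rcases (mem_zigzag_ext hp k v).1 hk with h | ⟨u, hu, huv⟩
    · exact ⟨k, k.2, h, by omega, by omega⟩
    · obtain ⟨t, ht, h1, h2⟩ := exists_inRect_of_adj hp huv
      exact ⟨t, ht, h2, inRect_dist hp k.2 ht hu h1, inRect_dist hp ht k.2 h1 hu⟩
  obtain ⟨t, ht, h1, h2, -⟩ := key i hi
  obtain ⟨t', ht', h1', -, h2'⟩ := key j hj
  have := inRect_dist hp ht ht' h1 h1'
  omega

theorem zigzag_extEdges_disjoint (hp : ZigzagParams c m b)
    (i j : Fin (zigzagDecomposition c m b).numBags) (h : (i : ℕ) + 19 ≤ j) :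
    Disjoint ((zigzagDecomposition c m b).extEdges i) ((zigzagDecomposition c m b).extEdges j) := by
  refine Set.disjoint_left.2 fun e h1 h2 => ?_
  have := zigzag_ext_dist hp (h2.2 _ (Sym2.out_fst_mem e)) (h1.2 _ (Sym2.out_fst_mem e))
  omega

theorem zigzag_extEdgeDegree_le (hp : ZigzagParams c m b) :
    (zigzagDecomposition c m b).extEdgeDegree ≤ 19 := by
  refine Finset.sup_le fun e _ => ncard_le_of_dist _ 18 fun i hi j hj => ?_
  exact zigzag_ext_dist hp (hi.2 _ (Sym2.out_fst_mem e)) (hj.2 _ (Sym2.out_fst_mem e))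

theorem zigzag_negCount_le (hp : ZigzagParams c m b) (v : Fin c × Fin m)
    (τ : Fin (zigzagDecomposition c m b).numBags → ℤˣ) :
    (zigzagDecomposition c m b).negCount τ v ≤ 7 := by
  unfold Decomposition.negCount
  rw [← Set.ncard_coe_finset]
  refine ncard_le_of_dist _ 6 fun i hi j hj => ?_
  simp only [Finset.coe_filter, Finset.mem_univ, true_and, Set.mem_ofPred_eq] at hi hj
  exact inRect_dist hp i.2 j.2 ((mem_zigzag_bag hp _ _).1 hi.2) ((mem_zigzag_bag hp _ _).1 hj.2)

/-- The extended block lies in the rectangle enlarged by one. -/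
theorem zigzag_ext_bounds (hp : ZigzagParams c m b)
    (t : Fin (zigzagDecomposition c m b).numBags) {v : Fin c × Fin m}
    (hv : v ∈ (zigzagDecomposition c m b).ext t) :
    blockRow m b t ≤ v.1 + 1 ∧ (v.1 : ℕ) ≤ blockRow m b t + blockHeight c m b t ∧
      blockCol m b t ≤ v.2 + 1 ∧ (v.2 : ℕ) ≤ blockCol m b t + b := by
  rcases (mem_zigzag_ext hp t v).1 hv with h | ⟨u, hu, huv⟩
  · unfold InRect at h; omega
  · have := (grid_adj_iff u v).1 huv.1
    unfold InRect at hu; omega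

theorem zigzag_ext_card_le (hp : ZigzagParams c m b)
    (t : Fin (zigzagDecomposition c m b).numBags) :
    ((zigzagDecomposition c m b).ext t).card ≤ 35 := by
  have h5 := block_bounds hp t.2
  have hb := hp.block
  have : ((zigzagDecomposition c m b).ext t).card ≤ (Finset.range 7 ×ˢ Finset.range 5).card := by
    refine Finset.card_le_card_of_injOn
      (fun v => ((v.1 : ℕ) + 1 - blockRow m b t, (v.2 : ℕ) + 1 - blockCol m b t)) ?_ ?_
    · intro v hv
      have := zigzag_ext_bounds hp t hv
      simp only [Finset.coe_product, Finset.coe_range, Set.mem_prod, Set.mem_Iio]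
      omega
    · intro v hv w hw h
      have h1 := zigzag_ext_bounds hp t hv
      have h2 := zigzag_ext_bounds hp t hw
      simp only [Prod.mk.injEq] at h
      exact Prod.ext (Fin.ext (by omega)) (Fin.ext (by omega))
  simpa using this

theorem zigzag_bag_card_le (hp : ZigzagParams c m b)
    (t : Fin (zigzagDecomposition c m b).numBags) :
    ((zigzagDecomposition c m b).bag t).card ≤ 35 :=
  (Finset.card_le_card (zigzag_bag_subset_ext hp t)).trans (zigzag_ext_card_le hp t)

/-- Each edge is charged to its left or upper end together with its direction. -/
theorem zigzag_extEdges_ncard_le (t : Fin (zigzagDecomposition c m b).numBags) :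
    ((zigzagDecomposition c m b).extEdges t).ncard ≤
      2 * ((zigzagDecomposition c m b).ext t).card := by
  classical
  let E := (zigzagDecomposition c m b).ext t
  have hex : ∀ e ∈ (zigzagDecomposition c m b).extEdges t, ∃ x : Bool × (Fin c × Fin m),
      x.2 ∈ E ∧ ∃ w, e = s(x.2, w) ∧ ((x.1 = true ∧ (x.2.1 : ℕ) = w.1 ∧ (x.2.2 : ℕ) + 1 = w.2) ∨
        (x.1 = false ∧ (x.2.2 : ℕ) = w.2 ∧ (x.2.1 : ℕ) + 1 = w.1)) := by
    rintro e ⟨he, hE⟩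
    induction e with
    | h u v =>
      have hu := hE u (by simp)
      have hv := hE v (by simp)
      have hadj := (grid_adj_iff u v).1 (zigzag_probed_le he)
      rcases hadj with ⟨h1, h2 | h2⟩ | ⟨h1, h2 | h2⟩
      · exact ⟨(true, u), hu, v, rfl, Or.inl ⟨rfl, h1, h2⟩⟩
      · exact ⟨(true, v), hv, u, Sym2.eq_swap, Or.inl ⟨rfl, h1.symm, h2⟩⟩
      · exact ⟨(false, u), hu, v, rfl, Or.inr ⟨rfl, h1, h2⟩⟩
      · exact ⟨(false, v), hv, u, Sym2.eq_swap, Or.inr ⟨rfl, h1.symm, h2⟩⟩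
  rcases ((zigzagDecomposition c m b).extEdges t).eq_empty_or_nonempty with h0 | ⟨e₀, he₀⟩
  · rw [h0]; simp
  have : Nonempty (Bool × (Fin c × Fin m)) := ⟨(hex e₀ he₀).choose⟩
  choose! f hf w hw using hex
  have : ((zigzagDecomposition c m b).extEdges t).ncard ≤
      (((Finset.univ : Finset Bool) ×ˢ E : Finset _) : Set (Bool × (Fin c × Fin m))).ncard := by
    refine Set.ncard_le_ncard_of_injOn f ?_ ?_ (Set.toFinite _)
    · intro e he
      simp only [Finset.coe_product, Finset.coe_univ, Set.mem_prod, Set.mem_univ, true_and]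
      exact hf e he
    · intro e he e' he' h
      obtain ⟨h1, h2⟩ := hw e he
      obtain ⟨h1', h2'⟩ := hw e' he'
      rw [← h] at h1' h2'
      have : w e he = w e' he' := by
        rcases h2 with h2 | h2 <;> rcases h2' with h2' | h2'
        · exact Prod.ext (Fin.ext (by omega)) (Fin.ext (by omega))
        · exact absurd (h2.1.symm.trans h2'.1) (by simp)
        · exact absurd (h2.1.symm.trans h2'.1) (by simp)
        · exact Prod.ext (Fin.ext (by omega)) (Fin.ext (by omega))
      rw [h1, h1', this]
  rw [Set.ncard_coe_finset, Finset.card_product] at this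
  simpa using this

theorem zigzag_extWidth_le (hp : ZigzagParams c m b) :
    (zigzagDecomposition c m b).extWidth ≤ 34 := by
  have : (Finset.univ.sup fun i => ((zigzagDecomposition c m b).ext i).card) ≤ 35 :=
    Finset.sup_le fun t _ => zigzag_ext_card_le hp t
  unfold Decomposition.extWidth
  omega

theorem zigzag_ext_card_le_extWidth (t : Fin (zigzagDecomposition c m b).numBags) :
    ((zigzagDecomposition c m b).ext t).card ≤ (zigzagDecomposition c m b).extWidth + 1 := by
  have := Finset.le_sup (f := fun i => ((zigzagDecomposition c m b).ext i).card)
    (Finset.mem_univ t)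
  unfold Decomposition.extWidth
  omega

theorem zigzag_maxExtEdges_le (hp : ZigzagParams c m b) :
    (zigzagDecomposition c m b).maxExtEdges ≤ 70 :=
  Finset.sup_le fun t _ => by
    have h1 := zigzag_extEdges_ncard_le t
    have h2 := zigzag_ext_card_le hp t
    omega

theorem zigzag_treeDegree_le : (zigzagDecomposition c m b).treeDegree ≤ 2 :=
  Finset.sup_le fun t _ => pathGraph_neighborSet_ncard_le t

theorem exists_vertex {r j : ℕ} (hr : r < c) (hj : j < m) :
    ∃ v : Fin c × Fin m, (v.1 : ℕ) = r ∧ (v.2 : ℕ) = j :=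
  ⟨(⟨r, hr⟩, ⟨j, hj⟩), rfl, rfl⟩

theorem vertex_ext {u v : Fin c × Fin m} (h₁ : (u.1 : ℕ) = v.1) (h₂ : (u.2 : ℕ) = v.2) : u = v :=
  Prod.ext (Fin.ext h₁) (Fin.ext h₂)

/-- From any vertex of the rectangle one walks left and then up to the corner, inside the rectangle;
an added neighbor is one probed edge away. -/
theorem zigzag_connected (hp : ZigzagParams c m b)
    (t : Fin (zigzagDecomposition c m b).numBags) :
    ((zigzagDecomposition c m b).probed.induce
      ((zigzagDecomposition c m b).ext t : Set (Fin c × Fin m))).Connected := by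
  obtain ⟨h₁, -, h₂, h₃⟩ := block_bounds hp t.2
  have hb := hp.block
  have hin : ∀ {v}, InRect c m b t v → v ∈ (zigzagDecomposition c m b).ext t := fun h =>
    (mem_zigzag_ext hp t _).2 (Or.inl h)
  obtain ⟨o, ho1, ho2⟩ := exists_vertex (c := c) (m := m) (r := blockRow m b t) (j := blockCol m b t)
    (by omega) (by omega)
  have ho : InRect c m b t o := by unfold InRect; omega
  rw [SimpleGraph.connected_iff_exists_forall_reachable]
  refine ⟨⟨o, hin ho⟩, ?_⟩
  have hrect : ∀ n, ∀ v (hv : InRect c m b t v), (v.1 : ℕ) + v.2 = n →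
      ((zigzagDecomposition c m b).probed.induce
        ((zigzagDecomposition c m b).ext t : Set (Fin c × Fin m))).Reachable
          ⟨o, hin ho⟩ ⟨v, hin hv⟩ := by
    intro n
    induction n with
    | zero =>
      intro v hv hn
      have : o = v := vertex_ext (by unfold InRect at hv; omega) (by unfold InRect at hv; omega)
      subst this
      exact SimpleGraph.Reachable.refl _
    | succ n ih =>
      intro v hv hn
      have hv' := hv
      unfold InRect at hv'
      have step : ∀ u, InRect c m b t u → (u.1 : ℕ) + u.2 = n → (grid c m).Adj u v →
          ((zigzagDecomposition c m b).probed.induce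
            ((zigzagDecomposition c m b).ext t : Set (Fin c × Fin m))).Reachable
              ⟨o, hin ho⟩ ⟨v, hin hv⟩ := fun u hu hn hadj =>
        (ih u hu hn).trans (SimpleGraph.Adj.reachable
          (SimpleGraph.induce_adj.2 (zigzag_adj_of_inRect hp t.2 hu hv hadj)))
      by_cases hc : (v.2 : ℕ) = blockCol m b t
      · by_cases hr : (v.1 : ℕ) = blockRow m b t
        · have : o = v := vertex_ext (by omega) (by omega)
          subst this
          exact SimpleGraph.Reachable.refl _
        · obtain ⟨u, hu1, hu2⟩ := exists_vertex (c := c) (m := m) (r := v.1 - 1) (j := v.2) (by omega) (by omega)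
          exact step u (by unfold InRect; omega) (by omega) ((grid_adj_iff u v).2 (by omega))
      · obtain ⟨u, hu1, hu2⟩ := exists_vertex (c := c) (m := m) (r := v.1) (j := v.2 - 1) (by omega) (by omega)
        exact step u (by unfold InRect; omega) (by omega) ((grid_adj_iff u v).2 (by omega))
  rintro ⟨v, hv⟩
  rcases (mem_zigzag_ext hp t v).1 hv with h | ⟨u, hu, huv⟩
  · exact hrect _ v h rfl
  · exact (hrect _ u hu rfl).trans (SimpleGraph.Adj.reachable (SimpleGraph.induce_adj.2 huv))

theorem zigzag_isAdmissible (hp : ZigzagParams c m b) {B : ℝ} (hB : 70 ≤ B) :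
    (zigzagDecomposition c m b).IsAdmissible (grid c m) B where
  probed_le := zigzag_probed_le
  bag_subset_ext := zigzag_bag_subset_ext hp
  treeDegree_le := (show ((_ : ℕ) : ℝ) ≤ (2 : ℕ) by
    exact_mod_cast zigzag_treeDegree_le).trans (by norm_num; linarith)
  extEdgeDegree_le := (show ((_ : ℕ) : ℝ) ≤ (19 : ℕ) by
    exact_mod_cast zigzag_extEdgeDegree_le hp).trans (by norm_num; linarith)
  maxExtEdges_le := (show ((_ : ℕ) : ℝ) ≤ (70 : ℕ) by
    exact_mod_cast zigzag_maxExtEdges_le hp).trans (by norm_num; linarith)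
  extWidth_le := (show ((_ : ℕ) : ℝ) ≤ (34 : ℕ) by
    exact_mod_cast zigzag_extWidth_le hp).trans (by norm_num; linarith)
  connected := zigzag_connected hp

/-- The set of cut sizes whose minimum is `mincut`. -/
def Decomposition.cutSizes {V : Type} (D : Decomposition V) (i : Fin D.numBags) : Set ℕ :=
  {k | ∃ S ⊆ D.ext i, (∃ v ∈ D.bag i, v ∈ S) ∧ (∃ v ∈ D.bag i, v ∉ S) ∧
    k = {e | e ∈ D.extEdges i ∧ (∃ v ∈ e, v ∈ S) ∧ ∃ v ∈ e, v ∉ S}.ncard}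

/-- Isolating the corner cuts at most its four edges. Besides bounding `mincut`, this shows that
separating cuts exist, so that the infimum is attained and is not the default value 0. -/
theorem exists_small_cut (hp : ZigzagParams c m b)
    (t : Fin (zigzagDecomposition c m b).numBags) :
    ∃ k ∈ (zigzagDecomposition c m b).cutSizes t, k ≤ 4 := by
  obtain ⟨h₁, -, h₂, h₃⟩ := block_bounds hp t.2
  have hb := hp.block
  obtain ⟨o, ho1, ho2⟩ := exists_vertex (c := c) (m := m) (r := blockRow m b t) (j := blockCol m b t)
    (by omega) (by omega)
  obtain ⟨o', ho1', ho2'⟩ := exists_vertex (c := c) (m := m) (r := blockRow m b t + 1) (j := blockCol m b t)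
    (by omega) (by omega)
  have ho : o ∈ (zigzagDecomposition c m b).bag t :=
    (mem_zigzag_bag hp t o).2 (by unfold InRect; omega)
  have ho' : o' ∈ (zigzagDecomposition c m b).bag t :=
    (mem_zigzag_bag hp t o').2 (by unfold InRect; omega)
  refine ⟨_, ⟨{o}, by simpa using zigzag_bag_subset_ext hp t ho, ⟨o, ho, by simp⟩,
    ⟨o', ho', ?_⟩, rfl⟩, ?_⟩
  · rw [Finset.mem_singleton]
    rintro rfl
    omega
  · refine le_trans ?_ (grid_card_incident_le o)
    rw [← Set.ncard_image_of_injective _ Subtype.val_injective]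
    refine Set.ncard_le_ncard ?_ (Set.toFinite _)
    rintro e ⟨he, ⟨v, hv, hvo⟩, -⟩
    rw [Finset.mem_singleton] at hvo
    subst hvo
    exact ⟨⟨e, SimpleGraph.edgeSet_mono zigzag_probed_le he.1⟩, hv, rfl⟩

theorem zigzag_mincut_le (hp : ZigzagParams c m b)
    (t : Fin (zigzagDecomposition c m b).numBags) :
    (zigzagDecomposition c m b).mincut t ≤ 4 := by
  obtain ⟨k, hk, hk4⟩ := exists_small_cut hp t
  exact (Nat.sInf_le hk).trans hk4

theorem zigzag_mincut_ge (hp : ZigzagParams c m b)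
    (t : Fin (zigzagDecomposition c m b).numBags) (x : ℕ)
    (h : ∀ S : Finset (Fin c × Fin m), (∃ v, InRect c m b t v ∧ v ∈ S) →
      (∃ v, InRect c m b t v ∧ v ∉ S) →
      x ≤ {e | e ∈ (zigzagDecomposition c m b).extEdges t ∧ (∃ v ∈ e, v ∈ S) ∧
        ∃ v ∈ e, v ∉ S}.ncard) :
    x ≤ (zigzagDecomposition c m b).mincut t := by
  obtain ⟨k, hk, -⟩ := exists_small_cut hp t
  obtain ⟨S, -, ⟨v, hv, hvS⟩, ⟨w, hw, hwS⟩, hS⟩ := Nat.sInf_mem (s := _) ⟨k, hk⟩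
  refine (h S ⟨v, (mem_zigzag_bag hp t v).1 hv, hvS⟩ ⟨w, (mem_zigzag_bag hp t w).1 hw, hwS⟩).trans
    (le_of_eq ?_)
  exact hS.symm

/-- A walk inside the connected extended block must cross any separating cut. This crude bound is
all that is used at the ends of the strips. -/
theorem zigzag_one_le_mincut (hp : ZigzagParams c m b)
    (t : Fin (zigzagDecomposition c m b).numBags) :
    1 ≤ (zigzagDecomposition c m b).mincut t := by
  refine zigzag_mincut_ge hp t 1 ?_
  rintro S ⟨v, hv, hvS⟩ ⟨w, hw, hwS⟩
  have hve := (mem_zigzag_ext hp t v).2 (Or.inl hv)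
  have hwe := (mem_zigzag_ext hp t w).2 (Or.inl hw)
  obtain ⟨p⟩ := (zigzag_connected hp t).preconnected ⟨v, hve⟩ ⟨w, hwe⟩
  obtain ⟨d, -, hd1, hd2⟩ := p.exists_boundary_dart {x | x.1 ∈ S} hvS hwS
  rw [Nat.one_le_iff_ne_zero, Ne, Set.ncard_eq_zero (Set.toFinite _), ← Ne,
    ← Set.nonempty_iff_ne_empty]
  refine ⟨s(d.fst.1, d.snd.1), ⟨d.adj, ?_⟩, ⟨_, by simp, hd1⟩, ⟨_, by simp, hd2⟩⟩
  intro x hx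
  rcases Sym2.mem_iff.1 hx with rfl | rfl
  exacts [d.fst.2, d.snd.2]

/-- The first extended block contains a full `3 × 3` grid. The resulting bounds give `19 ≤ 6 * 1 *
4`, the requirement on the range of dependence, and the width 8 needed to compare edge counts with a
power of two. -/
theorem zigzag_four_le_maxExtEdges (hp : ZigzagParams c m b) :
    4 ≤ (zigzagDecomposition c m b).maxExtEdges ∧ 1 ≤ (zigzagDecomposition c m b).extEdgeDegree ∧
      8 ≤ (zigzagDecomposition c m b).extWidth := by
  let t : Fin (zigzagDecomposition c m b).numBags := ⟨0, numBags_pos hp⟩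
  have hc := hp.three_le
  have hm := hp.le_width
  have hb := hp.block
  have h₁ := (block_bounds hp t.2).1
  have hr : blockRow m b 0 = 0 := by simp [blockRow]
  have hcol : blockCol m b 0 = 0 := by simp [blockCol]
  let f : Fin 3 × Fin 3 → Fin c × Fin m := fun x => (⟨x.1, by omega⟩, ⟨x.2, by omega⟩)
  have hrect : ∀ v : Fin c × Fin m, (v.1 : ℕ) < 3 → (v.2 : ℕ) < b → InRect c m b 0 v := by
    intro v h1 h2
    change 3 ≤ blockHeight c m b 0 at h₁
    unfold InRect
    omega
  have hf : ∀ x, f x ∈ (zigzagDecomposition c m b).ext t := by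
    intro x
    rw [mem_zigzag_ext hp]
    have hx1 := x.1.2
    have hx2 := x.2.2
    by_cases h : (x.2 : ℕ) < b
    · exact Or.inl (hrect _ (by simp only [f]; omega) h)
    · right
      refine ⟨(⟨x.1, by omega⟩, ⟨x.2 - 1, by omega⟩), hrect _ (by simp only; omega)
        (by simp only; omega), zigzag_adj_right rfl ?_⟩
      simp only [f]
      omega
  have hinj : Function.Injective f := by
    intro x y h
    simp only [f, Prod.mk.injEq, Fin.mk.injEq] at h
    exact Prod.ext (Fin.ext h.1) (Fin.ext h.2)
  have hcard : 9 ≤ ((zigzagDecomposition c m b).ext t).card := by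
    have := Finset.card_le_card_of_injOn (s := Finset.univ)
      (t := (zigzagDecomposition c m b).ext t) f (fun x _ => hf x) hinj.injOn
    simpa using this
  have hedge : 6 ≤ ((zigzagDecomposition c m b).extEdges t).ncard := by
    have : (Set.univ : Set (Fin 3 × Fin 2)).ncard ≤
        ((zigzagDecomposition c m b).extEdges t).ncard := by
      refine Set.ncard_le_ncard_of_injOn
        (fun x => s(f (x.1, x.2.castSucc), f (x.1, x.2.succ))) ?_ ?_ (Set.toFinite _)
      · intro x _
        refine ⟨zigzag_adj_right rfl rfl, ?_⟩
        intro v hv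
        rcases Sym2.mem_iff.1 hv with rfl | rfl
        exacts [hf _, hf _]
      · intro x _ y _ h
        simp only [Sym2.eq_iff, f, Prod.mk.injEq, Fin.mk.injEq, Fin.val_castSucc,
          Fin.val_succ] at h
        exact Prod.ext (Fin.ext (by omega)) (Fin.ext (by omega))
    simpa [Set.ncard_univ] using this
  refine ⟨?_, ?_, ?_⟩
  · have := Finset.le_sup (f := fun i => ((zigzagDecomposition c m b).extEdges i).ncard)
      (Finset.mem_univ t)
    unfold Decomposition.maxExtEdges
    omega
  · obtain ⟨e, he⟩ := (Set.ncard_pos (Set.toFinite _)).1 (by omega :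
      0 < ((zigzagDecomposition c m b).extEdges t).ncard)
    have h1 : 1 ≤ {i | e ∈ (zigzagDecomposition c m b).extEdges i}.ncard :=
      (Set.ncard_pos (Set.toFinite _)).2 ⟨t, he⟩
    exact h1.trans (Finset.le_sup
      (f := fun e => {i | e ∈ (zigzagDecomposition c m b).extEdges i}.ncard) (Finset.mem_univ e))
  · have := zigzag_ext_card_le_extWidth t
    omega

theorem four_mul_sq_le_two_pow {w : ℕ} (hw : 9 ≤ w) : (2 * w) ^ 2 ≤ 2 ^ w := by
  induction w, hw using Nat.le_induction with
  | base => norm_num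
  | succ n hn ih =>
    rw [pow_succ 2 n]
    nlinarith

/-- `mincut ≤ 4` makes the exponent at most 2, and the square of the edge count is below `2 ^
(extWidth + 1)` once there are nine vertices. Hence the union bound over flipped edges fits the
constant in `failureBound`. -/
theorem zigzag_edge_pow_le (hp : ZigzagParams c m b)
    (t : Fin (zigzagDecomposition c m b).numBags) :
    ((zigzagDecomposition c m b).extEdges t).ncard ^
      (((zigzagDecomposition c m b).mincut t + 1) / 2) ≤
        2 ^ ((zigzagDecomposition c m b).extWidth + 1) := by
  set w := (zigzagDecomposition c m b).extWidth
  have h1 : ((zigzagDecomposition c m b).extEdges t).ncard ≤ 2 * (w + 1) :=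
    (zigzag_extEdges_ncard_le t).trans (Nat.mul_le_mul_left 2 (zigzag_ext_card_le_extWidth t))
  have h2 := zigzag_mincut_le hp t
  have h3 := (zigzag_four_le_maxExtEdges hp).2.2
  calc _ ≤ (2 * (w + 1)) ^ (((zigzagDecomposition c m b).mincut t + 1) / 2) :=
        Nat.pow_le_pow_left h1 _
    _ ≤ (2 * (w + 1)) ^ 2 := Nat.pow_le_pow_right (by omega) (by omega)
    _ ≤ _ := four_mul_sq_le_two_pow (by omega)

end ZigzagCounts

/-! ### Blocks away from the ends of a strip have cuts of size at least three. -/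

section ZigzagMincut

variable {c m b : ℕ}

/-- In a grid with three rows and four columns, any two adjacent vertices of the two inner columns
are joined by three edge-disjoint paths. -/
theorem three_mul_sub_le_cut (x dR dD : ℕ → ℕ → ℤ)
    (hR : ∀ i < 3, ∀ j < 3, x i j - x i (j + 1) ≤ dR i j ∧ x i (j + 1) - x i j ≤ dR i j)
    (hD : ∀ i < 2, ∀ j < 4, x i j - x (i + 1) j ≤ dD i j ∧ x (i + 1) j - x i j ≤ dD i j)
    {t : ℤ} (ht : ∑ i ∈ Finset.range 3, ∑ j ∈ Finset.range 3, dR i j +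
      ∑ i ∈ Finset.range 2, ∑ j ∈ Finset.range 4, dD i j = t) :
    (∀ i < 3, 3 * (x i 1 - x i 2) ≤ t ∧ 3 * (x i 2 - x i 1) ≤ t) ∧
    (∀ i < 2, ∀ j, 1 ≤ j → j ≤ 2 → 3 * (x i j - x (i + 1) j) ≤ t ∧
      3 * (x (i + 1) j - x i j) ≤ t) := by
  simp only [Finset.sum_range_succ, Finset.sum_range_zero, zero_add] at ht
  have r00 := hR 0 (by norm_num) 0 (by norm_num)
  have r01 := hR 0 (by norm_num) 1 (by norm_num)
  have r02 := hR 0 (by norm_num) 2 (by norm_num)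
  have r10 := hR 1 (by norm_num) 0 (by norm_num)
  have r11 := hR 1 (by norm_num) 1 (by norm_num)
  have r12 := hR 1 (by norm_num) 2 (by norm_num)
  have r20 := hR 2 (by norm_num) 0 (by norm_num)
  have r21 := hR 2 (by norm_num) 1 (by norm_num)
  have r22 := hR 2 (by norm_num) 2 (by norm_num)
  have d00 := hD 0 (by norm_num) 0 (by norm_num)
  have d01 := hD 0 (by norm_num) 1 (by norm_num)
  have d02 := hD 0 (by norm_num) 2 (by norm_num)
  have d03 := hD 0 (by norm_num) 3 (by norm_num)
  have d10 := hD 1 (by norm_num) 0 (by norm_num)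
  have d11 := hD 1 (by norm_num) 1 (by norm_num)
  have d12 := hD 1 (by norm_num) 2 (by norm_num)
  have d13 := hD 1 (by norm_num) 3 (by norm_num)
  simp only [zero_add, Nat.reduceAdd] at r00 r01 r02 r10 r11 r12 r20 r21 r22 d00 d01 d02 d03 d10 d11 d12 d13
  clear hR hD
  refine ⟨fun i hi => ?_, fun i hi j h1 h2 => ?_⟩
  · interval_cases i <;> constructor <;> linarith
  · interval_cases i <;> interval_cases j <;> simp only [zero_add, Nat.reduceAdd] <;>
      constructor <;> linarith

open Classical in
/-- A cut in a window of three rows and four columns that separates adjacent vertices of the inner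
columns has at least three edges. -/
theorem window_cut_le (f : ℕ → ℕ → Fin c × Fin m) (r₀ j₀ : ℕ)
    (hf : ∀ i < 3, ∀ j < 4, ((f i j).1 : ℕ) = r₀ + i ∧ ((f i j).2 : ℕ) = j₀ + j)
    (E : Set (Sym2 (Fin c × Fin m))) (S : Finset (Fin c × Fin m))
    (hR : ∀ i < 3, ∀ j < 3, s(f i j, f i (j + 1)) ∈ E)
    (hD : ∀ i < 2, ∀ j < 4, s(f i j, f (i + 1) j) ∈ E)
    (hcut : {e | e ∈ E ∧ (∃ v ∈ e, v ∈ S) ∧ ∃ v ∈ e, v ∉ S}.ncard < 3) :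
    (∀ i < 3, (f i 1 ∈ S ↔ f i 2 ∈ S)) ∧
    (∀ i < 2, ∀ j, 1 ≤ j → j ≤ 2 → (f i j ∈ S ↔ f (i + 1) j ∈ S)) := by
  set C := {e | e ∈ E ∧ (∃ v ∈ e, v ∈ S) ∧ ∃ v ∈ e, v ∉ S} with hC
  let x : ℕ → ℕ → ℤ := fun i j => if f i j ∈ S then 1 else 0
  let dR : ℕ → ℕ → ℤ := fun i j => if s(f i j, f i (j + 1)) ∈ C then 1 else 0
  let dD : ℕ → ℕ → ℤ := fun i j => if s(f i j, f (i + 1) j) ∈ C then 1 else 0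
  have hedge : ∀ u v, s(u, v) ∈ E → (if u ∈ S then (1 : ℤ) else 0) - (if v ∈ S then 1 else 0) ≤
      (if s(u, v) ∈ C then 1 else 0) ∧ (if v ∈ S then (1 : ℤ) else 0) - (if u ∈ S then 1 else 0) ≤
      (if s(u, v) ∈ C then 1 else 0) := by
    intro u v he
    have : s(u, v) ∈ C ↔ (u ∈ S ∨ v ∈ S) ∧ (u ∉ S ∨ v ∉ S) := by
      simp only [hC, Set.mem_ofPred_eq, he, true_and, Sym2.mem_iff, or_and_right, exists_or,
        exists_eq_left]
    simp only [this]
    by_cases hu : u ∈ S <;> by_cases hv : v ∈ S <;> simp [hu, hv]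
  -- Applied to the indicator of `S`: if two adjacent inner vertices were separated, each of three
  -- edge-disjoint paths between them would contain a cut edge.
  obtain ⟨k1, k2⟩ := three_mul_sub_le_cut x dR dD
    (fun i hi j hj => hedge _ _ (hR i hi j hj)) (fun i hi j hj => hedge _ _ (hD i hi j hj)) rfl
  have hsum : ∑ i ∈ Finset.range 3, ∑ j ∈ Finset.range 3, dR i j +
      ∑ i ∈ Finset.range 2, ∑ j ∈ Finset.range 4, dD i j ≤ 2 := by
    let gR : ℕ × ℕ → Sym2 (Fin c × Fin m) := fun z => s(f z.1 z.2, f z.1 (z.2 + 1))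
    let gD : ℕ × ℕ → Sym2 (Fin c × Fin m) := fun z => s(f z.1 z.2, f (z.1 + 1) z.2)
    let A := (Finset.range 3 ×ˢ Finset.range 3).filter fun z => gR z ∈ C
    let B := (Finset.range 2 ×ˢ Finset.range 4).filter fun z => gD z ∈ C
    have hA : ∀ z ∈ A, z.1 < 3 ∧ z.2 < 3 := fun z hz => by
      simpa using (Finset.mem_product.1 (Finset.mem_filter.1 hz).1)
    have hB : ∀ z ∈ B, z.1 < 2 ∧ z.2 < 4 := fun z hz => by
      simpa using (Finset.mem_product.1 (Finset.mem_filter.1 hz).1)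
    have e1 : ∑ i ∈ Finset.range 3, ∑ j ∈ Finset.range 3, dR i j = A.card := by
      rw [← Finset.sum_product', Finset.sum_boole]
    have e2 : ∑ i ∈ Finset.range 2, ∑ j ∈ Finset.range 4, dD i j = B.card := by
      rw [← Finset.sum_product', Finset.sum_boole]
    have coords : ∀ u v : Fin c × Fin m, u = v → (u.1 : ℕ) = v.1 ∧ (u.2 : ℕ) = v.2 := by
      rintro u v rfl; exact ⟨rfl, rfl⟩
    have iA : Set.InjOn gR A := by
      intro z hz w hw h
      have a1 := hA z hz
      have a2 := hA w hw
      have q1 := hf z.1 a1.1 z.2 (by omega)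
      have q2 := hf z.1 a1.1 (z.2 + 1) (by omega)
      have q3 := hf w.1 a2.1 w.2 (by omega)
      have q4 := hf w.1 a2.1 (w.2 + 1) (by omega)
      rcases Sym2.eq_iff.1 h with ⟨h1, h2⟩ | ⟨h1, h2⟩ <;>
        have c1 := coords _ _ h1 <;> have c2 := coords _ _ h2 <;>
        exact Prod.ext (by omega) (by omega)
    have iB : Set.InjOn gD B := by
      intro z hz w hw h
      have a1 := hB z hz
      have a2 := hB w hw
      have q1 := hf z.1 (by omega) z.2 (by omega)
      have q2 := hf (z.1 + 1) (by omega) z.2 (by omega)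
      have q3 := hf w.1 (by omega) w.2 (by omega)
      have q4 := hf (w.1 + 1) (by omega) w.2 (by omega)
      rcases Sym2.eq_iff.1 h with ⟨h1, h2⟩ | ⟨h1, h2⟩ <;>
        have c1 := coords _ _ h1 <;> have c2 := coords _ _ h2 <;>
        exact Prod.ext (by omega) (by omega)
    have hdisj : Disjoint (A.image gR) (B.image gD) := by
      rw [Finset.disjoint_left]
      intro e he he'
      obtain ⟨z, hz, rfl⟩ := Finset.mem_image.1 he
      obtain ⟨w, hw, h⟩ := Finset.mem_image.1 he'
      have a1 := hA z hz
      have a2 := hB w hw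
      have q1 := hf z.1 a1.1 z.2 (by omega)
      have q2 := hf z.1 a1.1 (z.2 + 1) (by omega)
      have q3 := hf w.1 (by omega) w.2 (by omega)
      have q4 := hf (w.1 + 1) (by omega) w.2 (by omega)
      rcases Sym2.eq_iff.1 h with ⟨h1, h2⟩ | ⟨h1, h2⟩ <;>
        have c1 := coords _ _ h1 <;> have c2 := coords _ _ h2 <;> omega
    have hsub : ((A.image gR ∪ B.image gD : Finset _) : Set (Sym2 (Fin c × Fin m))) ⊆ C := by
      intro e he
      simp only [Finset.coe_union, Set.mem_union, Finset.mem_coe, Finset.mem_image] at he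
      rcases he with ⟨z, hz, rfl⟩ | ⟨z, hz, rfl⟩
      · exact (Finset.mem_filter.1 hz).2
      · exact (Finset.mem_filter.1 hz).2
    have hcard := Set.ncard_le_ncard hsub (Set.toFinite _)
    rw [Set.ncard_coe_finset, Finset.card_union_of_disjoint hdisj,
      Finset.card_image_of_injOn iA, Finset.card_image_of_injOn iB] at hcard
    rw [e1, e2]
    omega
  have conv : ∀ u v : Fin c × Fin m, 3 * ((if u ∈ S then (1 : ℤ) else 0) - if v ∈ S then 1 else 0) ≤ 2 →
      3 * ((if v ∈ S then (1 : ℤ) else 0) - if u ∈ S then 1 else 0) ≤ 2 → (u ∈ S ↔ v ∈ S) := by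
    intro u v h1 h2
    by_cases hu : u ∈ S <;> by_cases hv : v ∈ S <;> simp [hu, hv] at h1 h2 ⊢
  refine ⟨fun i hi => conv _ _ ((k1 i hi).1.trans hsum) ((k1 i hi).2.trans hsum),
    fun i hi j h1 h2 => conv _ _ ((k2 i hi j h1 h2).1.trans hsum) ((k2 i hi j h1 h2).2.trans hsum)⟩

/-- The position within the strip guarantees that the extension adds a full column on both sides.
Any edge of the block then lies in the inner columns of some `3 × 4` window of probed edges, so a
cut with at most two edges leaves its ends together, and the block is connected. -/
theorem zigzag_three_le_mincut (hp : ZigzagParams c m b)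
    (t : Fin (zigzagDecomposition c m b).numBags) (h₁ : 1 ≤ (t : ℕ) % (m - b + 3))
    (h₂ : (t : ℕ) % (m - b + 3) < m - b) : 3 ≤ (zigzagDecomposition c m b).mincut t := by
  refine zigzag_mincut_ge hp t 3 ?_
  rintro S ⟨v, hv, hvS⟩ ⟨w, hw, hwS⟩
  by_contra hlt
  rw [not_le] at hlt
  have hb := hp.block
  obtain ⟨a₁, a₂, a₃, a₄⟩ := block_bounds hp t.2
  have hcol : 1 ≤ blockCol m b t ∧ blockCol m b t + b + 1 ≤ m := by
    unfold blockCol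
    split_ifs <;> omega
  have hstrip : ∀ r, blockRow m b t ≤ r → r + 1 < blockRow m b t + blockHeight c m b t →
      stripOf c r = stripOf c (r + 1) := by
    intro r hr1 hr2
    have := zigzag_index t.2
    unfold blockRow blockHeight at *
    unfold stripOf
    generalize (t : ℕ) / (m - b + 3) = a at *
    split_ifs at hr2 <;> omega
  have hext : ∀ u : Fin c × Fin m, blockRow m b t ≤ u.1 →
      (u.1 : ℕ) < blockRow m b t + blockHeight c m b t → blockCol m b t ≤ u.2 + 1 →
      (u.2 : ℕ) ≤ blockCol m b t + b → u ∈ (zigzagDecomposition c m b).ext t := by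
    intro u h1 h2 h3 h4
    rw [mem_zigzag_ext hp]
    by_cases h5 : (u.2 : ℕ) < blockCol m b t
    · obtain ⟨u', e1, e2⟩ := exists_vertex (c := c) (m := m) (r := u.1) (j := u.2 + 1)
        u.1.2 (by omega)
      exact Or.inr ⟨u', by unfold InRect; omega, (zigzag_adj_right e1.symm e2.symm).symm⟩
    · by_cases h6 : (u.2 : ℕ) < blockCol m b t + b
      · exact Or.inl (by unfold InRect; omega)
      · obtain ⟨u', e1, e2⟩ := exists_vertex (c := c) (m := m) (r := u.1) (j := u.2 - 1)
          u.1.2 (by omega)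
        exact Or.inr ⟨u', by unfold InRect; omega, zigzag_adj_right e1 (by omega)⟩
  have hedge : ∀ u v : Fin c × Fin m, (zigzagGraph c m b).Adj u v →
      u ∈ (zigzagDecomposition c m b).ext t → v ∈ (zigzagDecomposition c m b).ext t →
      s(u, v) ∈ (zigzagDecomposition c m b).extEdges t := by
    intro u v h hu hv
    refine ⟨h, fun x hx => ?_⟩
    rcases Sym2.mem_iff.1 hx with rfl | rfl
    exacts [hu, hv]
  have hwin : ∀ r₀ j₀, blockRow m b t ≤ r₀ → r₀ + 3 ≤ blockRow m b t + blockHeight c m b t →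
      blockCol m b t ≤ j₀ + 1 → j₀ + 3 ≤ blockCol m b t + b → ∃ f : ℕ → ℕ → Fin c × Fin m,
        (∀ i < 3, ∀ j < 4, ((f i j).1 : ℕ) = r₀ + i ∧ ((f i j).2 : ℕ) = j₀ + j) ∧
        (∀ i < 3, (f i 1 ∈ S ↔ f i 2 ∈ S)) ∧
        (∀ i < 2, ∀ j, 1 ≤ j → j ≤ 2 → (f i j ∈ S ↔ f (i + 1) j ∈ S)) := by
    intro r₀ j₀ g1 g2 g3 g4
    have hex : ∀ i j, ∃ u : Fin c × Fin m, i < 3 → j < 4 → (u.1 : ℕ) = r₀ + i ∧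
        (u.2 : ℕ) = j₀ + j := by
      intro i j
      by_cases h : i < 3 ∧ j < 4
      · obtain ⟨u, e1, e2⟩ := exists_vertex (c := c) (m := m) (r := r₀ + i) (j := j₀ + j)
          (by omega) (by omega)
        exact ⟨u, fun _ _ => ⟨e1, e2⟩⟩
      · exact ⟨v, fun h1 h2 => absurd ⟨h1, h2⟩ h⟩
    choose f hf using hex
    have hfe : ∀ i < 3, ∀ j < 4, f i j ∈ (zigzagDecomposition c m b).ext t := by
      intro i hi j hj
      have := hf i j hi hj
      exact hext _ (by omega) (by omega) (by omega) (by omega)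
    refine ⟨f, fun i hi j hj => hf i j hi hj, window_cut_le f r₀ j₀
      (fun i hi j hj => hf i j hi hj) ((zigzagDecomposition c m b).extEdges t) S ?_ ?_ hlt⟩
    · intro i hi j hj
      have q1 := hf i j hi (by omega)
      have q2 := hf i (j + 1) hi (by omega)
      exact hedge _ _ (zigzag_adj_right (by omega) (by omega)) (hfe _ hi _ (by omega))
        (hfe _ hi _ (by omega))
    · intro i hi j hj
      have q1 := hf i j (by omega) hj
      have q2 := hf (i + 1) j (by omega) hj
      refine hedge _ _ ((zigzag_adj_down_iff (by omega) (by omega)).2 (Or.inl ?_))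
        (hfe _ (by omega) _ hj) (hfe _ (by omega) _ hj)
      rw [q1.1, q2.1]
      exact hstrip _ (by omega) (by omega)
  have hright : ∀ u u' : Fin c × Fin m, InRect c m b t u → InRect c m b t u' →
      (u.1 : ℕ) = u'.1 → (u.2 : ℕ) + 1 = u'.2 → (u ∈ S ↔ u' ∈ S) := by
    intro u u' hu hu' e1 e2
    unfold InRect at hu hu'
    -- The window begins one column to the left of `u`, so that the edge joins its two inner
    -- columns, and is pushed up if it would leave the block at the bottom.
    obtain ⟨f, hf, k1, -⟩ := hwin (min (u.1 : ℕ) (blockRow m b t + blockHeight c m b t - 3)) (u.2 - 1)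
      (by omega) (by omega) (by omega) (by omega)
    have hi : (u.1 : ℕ) - min (u.1 : ℕ) (blockRow m b t + blockHeight c m b t - 3) < 3 := by omega
    have q1 := hf _ hi 1 (by norm_num)
    have q2 := hf _ hi 2 (by norm_num)
    have := k1 _ hi
    rwa [vertex_ext (u := f _ 1) (v := u) (by omega) (by omega),
      vertex_ext (u := f _ 2) (v := u') (by omega) (by omega)] at this
  have hdown : ∀ u u' : Fin c × Fin m, InRect c m b t u → InRect c m b t u' →
      (u.2 : ℕ) = u'.2 → (u.1 : ℕ) + 1 = u'.1 → (u ∈ S ↔ u' ∈ S) := by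
    intro u u' hu hu' e1 e2
    unfold InRect at hu hu'
    -- In the last column of the block `u` becomes the second inner column, since the window may
    -- extend only one column beyond the block.
    obtain ⟨j₀, hj₀⟩ : ∃ j₀, j₀ = min ((u.2 : ℕ) - 1) (blockCol m b t + b - 3) := ⟨_, rfl⟩
    obtain ⟨f, hf, -, k2⟩ := hwin (min (u.1 : ℕ) (blockRow m b t + blockHeight c m b t - 3)) j₀
      (by omega) (by omega) (by omega) (by omega)
    have hi : (u.1 : ℕ) - min (u.1 : ℕ) (blockRow m b t + blockHeight c m b t - 3) < 2 := by omega
    have q1 := hf _ (hi.trans (by norm_num)) (u.2 - j₀) (by omega)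
    have q2 := hf _ (Nat.add_lt_add_right hi 1) (u.2 - j₀) (by omega)
    have := k2 _ hi (u.2 - j₀) (by omega) (by omega)
    rwa [vertex_ext (u := f _ _) (v := u) (by omega) (by omega),
      vertex_ext (u := f _ _) (v := u') (by omega) (by omega)] at this
  obtain ⟨o, ho1, ho2⟩ := exists_vertex (c := c) (m := m) (r := blockRow m b t)
    (j := blockCol m b t) (by omega) (by omega)
  have hall : ∀ n, ∀ u, InRect c m b t u → (u.1 : ℕ) + u.2 = n → (o ∈ S ↔ u ∈ S) := by
    intro n
    induction n with
    | zero =>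
      intro u hu hn
      have : o = u := vertex_ext (by unfold InRect at hu; omega) (by unfold InRect at hu; omega)
      rw [this]
    | succ n ih =>
      intro u hu hn
      have hu' := hu
      unfold InRect at hu'
      by_cases hc : (u.2 : ℕ) = blockCol m b t
      · by_cases hr : (u.1 : ℕ) = blockRow m b t
        · have : o = u := vertex_ext (by omega) (by omega)
          rw [this]
        · obtain ⟨u', e1, e2⟩ := exists_vertex (c := c) (m := m) (r := u.1 - 1) (j := u.2)
            (by omega) (by omega)
          have hin : InRect c m b t u' := by unfold InRect; omega
          exact (ih u' hin (by omega)).trans (hdown u' u hin hu e2 (by omega))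
      · obtain ⟨u', e1, e2⟩ := exists_vertex (c := c) (m := m) (r := u.1) (j := u.2 - 1)
          (by omega) (by omega)
        have hin : InRect c m b t u' := by unfold InRect; omega
        exact (ih u' hin (by omega)).trans (hright u' u hin hu e1 (by omega))
  exact hwS ((hall _ w hw rfl).1 ((hall _ v hv rfl).2 hvS))

end ZigzagMincut

/-! ### Numerical bounds for the zig-zag and the error bound. -/

section ZigzagBound

variable {c m b : ℕ}

/-- The exceptional positions in each strip are the first one, the last horizontal one and the two
sliding ones. -/
theorem card_turn_blocks_le :
    (Finset.univ.filter fun t : Fin (zigzagDecomposition c m b).numBags =>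
      ¬ (1 ≤ (t : ℕ) % (m - b + 3) ∧ (t : ℕ) % (m - b + 3) < m - b)).card ≤ c / 3 * 4 := by
  have : (c / 3 * 4) = (Finset.range (c / 3) ×ˢ Finset.range 4).card := by simp
  rw [this]
  refine Finset.card_le_card_of_injOn (fun t => ((t : ℕ) / (m - b + 3),
    if (t : ℕ) % (m - b + 3) < m - b then 0 else (t : ℕ) % (m - b + 3) - (m - b) + 1)) ?_ ?_
  · intro t _
    have h := zigzag_index (c := c) (m := m) (b := b) t.2
    have h1 := Nat.mod_lt (t : ℕ) (show 0 < m - b + 3 by omega)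
    simp only [Finset.coe_product, Set.mem_prod, Finset.coe_range, Set.mem_Iio]
    exact ⟨h.1, by split_ifs <;> omega⟩
  · intro t ht t' ht' h
    simp only [Finset.coe_filter, Finset.mem_univ, true_and, Set.mem_ofPred_eq] at ht ht'
    simp only [Prod.mk.injEq] at h
    obtain ⟨h1, h2⟩ := h
    have e1 := Nat.div_add_mod (t : ℕ) (m - b + 3)
    have e2 := Nat.div_add_mod (t' : ℕ) (m - b + 3)
    have h3 : (t : ℕ) % (m - b + 3) = (t' : ℕ) % (m - b + 3) := by
      split_ifs at h2 <;> omega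
    exact Fin.ext (by rw [← e1, ← e2, h1, h3])

theorem zigzag_numBags_le (hp : ZigzagParams c m b) :
    (zigzagDecomposition c m b).numBags + 2 ≤ 2 * (c * m) := by
  have h1 : 3 * (c / 3) ≤ c := Nat.mul_div_le c 3
  have hc := hp.three_le
  have hm := hp.le_width
  have hb := hp.block
  have h2 := numBags_pos hp
  change 0 < c / 3 * (m - b + 3) - 2 at h2
  change c / 3 * (m - b + 3) - 2 + 2 ≤ _
  have h3 : c / 3 * (m - b + 3) ≤ c / 3 * (2 * m) := Nat.mul_le_mul_left _ (by omega)
  have h4 : c / 3 * (2 * m) ≤ c * (2 * m) := Nat.mul_le_mul_right _ (by omega)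
  have h5 : c * (2 * m) = 2 * (c * m) := by ring
  omega

/-- All blocks together contribute at most `2 * p ^ 2 * n`, and the exceptional ones an additional
`2 * c * p`. -/
theorem zigzag_sum_pow_le (hp : ZigzagParams c m b) {p : ℝ} (h0 : 0 < p) (h1 : p ≤ 1) :
    ∑ i, p ^ (((zigzagDecomposition c m b).mincut i + 1) / 2) ≤
      3 * (p ^ 2 * ((c : ℝ) * m)) + 1 := by
  have hterm : ∀ i, p ^ (((zigzagDecomposition c m b).mincut i + 1) / 2) ≤
      p ^ 2 + if ¬ (1 ≤ (i : ℕ) % (m - b + 3) ∧ (i : ℕ) % (m - b + 3) < m - b) then p else 0 := by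
    intro i
    split_ifs with h
    · have := zigzag_three_le_mincut hp i h.1 h.2
      rw [add_zero]
      exact pow_le_pow_of_le_one h0.le h1 (by omega)
    · have := zigzag_one_le_mincut hp i
      have h2 : p ^ (((zigzagDecomposition c m b).mincut i + 1) / 2) ≤ p ^ 1 :=
        pow_le_pow_of_le_one h0.le h1 (by omega)
      have : 0 ≤ p ^ 2 := by positivity
      linarith
  refine (Finset.sum_le_sum fun i _ => hterm i).trans ?_
  rw [Finset.sum_add_distrib, ← Finset.sum_filter, Finset.sum_const, Finset.sum_const,
    Finset.card_univ, Fintype.card_fin, nsmul_eq_mul, nsmul_eq_mul]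
  have hN : ((zigzagDecomposition c m b).numBags : ℝ) ≤ 2 * ((c : ℝ) * m) := by
    exact_mod_cast (Nat.le_add_right _ 2).trans (zigzag_numBags_le hp)
  have hT : ((Finset.univ.filter fun t : Fin (zigzagDecomposition c m b).numBags =>
      ¬ (1 ≤ (t : ℕ) % (m - b + 3) ∧ (t : ℕ) % (m - b + 3) < m - b)).card : ℝ) ≤ 2 * c := by
    exact_mod_cast card_turn_blocks_le.trans (by omega)
  have hcm : (c : ℝ) * c ≤ c * m :=
    mul_le_mul_of_nonneg_left (by exact_mod_cast hp.le_width) (Nat.cast_nonneg c)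
  have a1 := mul_le_mul_of_nonneg_right hN (by positivity : 0 ≤ p ^ 2)
  have a2 := mul_le_mul_of_nonneg_right hT h0.le
  have a3 := mul_le_mul_of_nonneg_right hcm (by positivity : 0 ≤ p ^ 2)
  -- `2 * p * c ≤ p ^ 2 * c ^ 2 + 1`, and `c ^ 2 ≤ c * m`: this is where the height must not exceed
  -- `√n`.
  nlinarith [sq_nonneg (p * c - 1)]

theorem log_two_le_log_two_div {δ : ℝ} (hδ : 0 < δ) (hδ1 : δ < 1) :
    Real.log 2 ≤ Real.log (2 / δ) :=
  Real.log_le_log (by norm_num) (by rw [le_div_iff₀ hδ]; linarith)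

theorem zigzag_failureBound_le (hp : ZigzagParams c m b) {p δ : ℝ} (h0 : 0 < p) (h1 : p ≤ 1)
    (hδ : 0 < δ) (hδ1 : δ < 1) :
    (zigzagDecomposition c m b).failureBound p δ ≤
      2 ^ 39 * (p ^ 2 * ((c : ℝ) * m) + Real.log (2 / δ)) := by
  have hl := log_two_le_log_two_div hδ hδ1
  have hl2 := Real.log_two_gt_d9
  have hs := zigzag_sum_pow_le hp h0 h1
  have hw : (2 : ℝ) ^ ((zigzagDecomposition c m b).extWidth + 2) ≤ 2 ^ 36 :=
    pow_le_pow_right₀ (by norm_num) (by have := zigzag_extWidth_le hp; omega)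
  have hd : ((zigzagDecomposition c m b).extEdgeDegree : ℝ) ≤ 19 := by
    exact_mod_cast zigzag_extEdgeDegree_le hp
  have hE : ((zigzagDecomposition c m b).maxExtEdges : ℝ) ≤ 70 := by
    exact_mod_cast zigzag_maxExtEdges_le hp
  have hp0 : 0 ≤ p ^ 2 * ((c : ℝ) * m) := by positivity
  unfold Decomposition.failureBound
  have a1 : (2 : ℝ) ^ ((zigzagDecomposition c m b).extWidth + 2) *
      ∑ i, p ^ (((zigzagDecomposition c m b).mincut i + 1) / 2) ≤
        2 ^ 36 * (3 * (p ^ 2 * ((c : ℝ) * m)) + 1) :=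
    mul_le_mul hw hs (Finset.sum_nonneg fun i _ => by positivity) (by positivity)
  have a2 : 6 * ((zigzagDecomposition c m b).extEdgeDegree : ℝ) *
      (zigzagDecomposition c m b).maxExtEdges ≤ 6 * 19 * 70 :=
    mul_le_mul (by linarith) hE (Nat.cast_nonneg _) (by norm_num)
  have a3 := mul_le_mul_of_nonneg_right a2 (by linarith : 0 ≤ Real.log (2 / δ))
  linarith

theorem zigzag_budget_le (hp : ZigzagParams c m b) {p δ : ℝ} (h0 : 0 < p) (h1 : p ≤ 1)
    (hδ : 0 < δ) (hδ1 : δ < 1) :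
    (zigzagDecomposition c m b).budget p δ ≤
      2 ^ 40 * (p ^ 2 * ((c : ℝ) * m) + Real.log (2 / δ)) := by
  have hd : ((zigzagDecomposition c m b).treeDegree : ℝ) ≤ 2 := by
    exact_mod_cast zigzag_treeDegree_le
  have := mul_le_mul hd (zigzag_failureBound_le hp h0 h1 hδ hδ1)
    (Decomposition.failureBound_nonneg _ h0.le hδ hδ1) (by norm_num)
  unfold Decomposition.budget
  linarith

theorem zigzag_budget_nonneg {p δ : ℝ} (h0 : 0 < p) (hδ : 0 < δ) (hδ1 : δ < 1) :
    0 ≤ (zigzagDecomposition c m b).budget p δ :=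
  mul_nonneg (Nat.cast_nonneg _) (Decomposition.failureBound_nonneg _ h0.le hδ hδ1)

theorem zigzag_decoder_error (hp : ZigzagParams c m b) {p q δ C : ℝ} (h0 : 0 < p) (hpq : p < q)
    (hq : q < 1 / 2) (hδ : 0 < δ) (hδ1 : δ < 1) (hC : 2 ^ 48 ≤ C) (Y : Fin c × Fin m → ℤˣ) :
    1 - δ ≤ (obsLaw (grid c m) p q Y).real
      {ω | ∀ y, IsDecoderOutput (zigzagDecomposition c m b)
          ((zigzagDecomposition c m b).budget p δ) ω.1 ω.2 y →
        (hammingDist y Y : ℝ) ≤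
          C / (1 / 2 - q) ^ 2 * (p ^ 2 * ((c : ℝ) * m) + Real.log (2 / δ))
            * Real.log (Real.exp 1 / p)} := by
  obtain ⟨hE, hd, -⟩ := zigzag_four_le_maxExtEdges hp
  have hχ : 19 ≤ 6 * (zigzagDecomposition c m b).extEdgeDegree *
      (zigzagDecomposition c m b).maxExtEdges :=
    le_trans (by norm_num) (Nat.mul_le_mul (Nat.mul_le_mul_left 6 hd) hE)
  have hcount : ∀ (v : Fin c × Fin m) (τ : Fin (zigzagDecomposition c m b).numBags → ℤˣ),
      (zigzagDecomposition c m b).negCount τ v ≤ 7 := zigzag_negCount_le hp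
  have hl := log_two_le_log_two_div hδ hδ1
  have hl2 := Real.log_two_gt_d9
  have hQ0 : 0 ≤ p ^ 2 * ((c : ℝ) * m) + Real.log (2 / δ) := by
    have : 0 ≤ p ^ 2 * ((c : ℝ) * m) := by positivity
    linarith
  have hlog : 0 ≤ Real.log (Real.exp 1 / p) :=
    Real.log_nonneg (by rw [le_div_iff₀ h0]; have := Real.add_one_le_exp (1 : ℝ); linarith)
  have hε : 0 < (1 / 2 - q) ^ 2 := pow_pos (by linarith) 2
  -- A block has at most 35 vertices, a vertex lies in at most 7 blocks, and 19 is the range of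
  -- dependence.
  have key := (zigzagDecomposition c m b).le_obsLaw_real_decoder_error (G := grid c m)
    (B := 35) (M := 7) rfl zigzag_probed_le (zigzag_bag_subset_ext hp) (by norm_num)
    (zigzag_bag_card_le hp) hcount 19 (by norm_num) hχ (zigzag_extEdges_disjoint hp)
    (zigzag_edge_pow_le hp) h0 hpq hq hδ hδ1 Y
  refine key.trans ?_
  refine measureReal_mono (fun ω hω y hy => (hω y hy).trans ?_) ?_
  · refine (decoder_error_estimate (κ := 2 ^ 40) (by positivity) (by positivity) (by positivity) h0
      (by linarith) (by linarith) (by linarith) rfl (by positivity) hl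
      ((zigzag_failureBound_le hp h0 (by linarith) hδ hδ1).trans
        (mul_le_mul_of_nonneg_right (by norm_num) hQ0))
      (zigzag_budget_le hp h0 (by linarith) hδ hδ1)
      (by exact_mod_cast (Nat.le_add_right _ 2).trans (zigzag_numBags_le hp))).trans ?_
    refine mul_le_mul_of_nonneg_right (mul_le_mul_of_nonneg_right
      (div_le_div_of_nonneg_right (le_trans (by norm_num) hC) hε.le) hQ0) hlog
  · have := isProbabilityMeasure_obsLaw (grid c m) Y h0.le (by linarith : p ≤ 1)
      (by linarith : 0 ≤ q) (by linarith)
    exact measure_ne_top _ _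

end ZigzagBound

/-! ### Loop-free computations of the random access machine -/

section RandomAccessMachine

namespace RamState

/-- Assign the value `z` to register `x`. -/
def set (s : RamState) (x : ℕ) (z : ℤ) : RamState := ⟨Function.update s.reg x z, s.arr⟩

/-- Store the value `z` at index `i` of array `a`. -/
def put (s : RamState) (a : ℕ) (i z : ℤ) : RamState :=
  ⟨s.reg, Function.update s.arr a (Function.update (s.arr a) i z)⟩

@[simp] theorem set_reg (s : RamState) (x y : ℕ) (z : ℤ) :
    (s.set x z).reg y = if y = x then z else s.reg y := by
  simp [set, Function.update_apply]

@[simp] theorem set_arr (s : RamState) (x : ℕ) (z : ℤ) : (s.set x z).arr = s.arr := rfl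

@[simp] theorem put_reg (s : RamState) (a : ℕ) (i z : ℤ) : (s.put a i z).reg = s.reg := rfl

theorem put_arr_same (s : RamState) (a : ℕ) (i z j : ℤ) :
    (s.put a i z).arr a j = if j = i then z else s.arr a j := by
  simp [put, Function.update_apply]

theorem put_arr_of_ne (s : RamState) {a a' : ℕ} (h : a' ≠ a) (i z : ℤ) :
    (s.put a i z).arr a' = s.arr a' := by
  simp [put, h]

end RamState

/-- The state transformation `f` is computed by a program in bounded time. -/
def Computes (f : RamState → RamState) : Prop :=
  ∃ (P : RamProg) (T : ℕ), ∀ s, ∃ t ≤ T, RamExec P s (f s) t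

/-- The value `o s` can be found by a bounded number of tests on `s`, so that computations may
depend on it. -/
def Observable {α : Type} (o : RamState → α) : Prop :=
  ∀ g : α → RamState → RamState, (∀ x, Computes (g x)) → Computes fun s => g (o s) s

/-- The integer `v s` is the value of one of finitely many expressions, chosen by tests. -/
def Evaluable (v : RamState → ℤ) : Prop :=
  ∃ o : RamState → RamExpr, Observable o ∧ ∀ s, v s = (o s).eval s

namespace Computes

theorem id : Computes fun s => s := ⟨.skip, 1, fun s => ⟨1, le_rfl, .skip s⟩⟩

theorem comp {f g : RamState → RamState} (hg : Computes g) (hf : Computes f) :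
    Computes fun s => g (f s) := by
  obtain ⟨P, T, hP⟩ := hf
  obtain ⟨Q, U, hQ⟩ := hg
  refine ⟨.seq P Q, T + U + 1, fun s => ?_⟩
  obtain ⟨t, ht, h⟩ := hP s
  obtain ⟨u, hu, h'⟩ := hQ (f s)
  exact ⟨t + u + 1, by omega, .seq h h'⟩

end Computes

namespace Observable

variable {α β γ : Type}

theorem const (x : α) : Observable fun _ => x := fun _ hg => hg x

/-- Observations nest without interference because tests do not change the state. -/
theorem map₂ {o₁ : RamState → α} {o₂ : RamState → β} (h₁ : Observable o₁) (h₂ : Observable o₂)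
    (h : α → β → γ) : Observable fun s => h (o₁ s) (o₂ s) := fun g hg =>
  h₁ (fun x s => g (h x (o₂ s)) s) fun x => h₂ (fun y => g (h x y)) fun _ => hg _

theorem map {o : RamState → α} (ho : Observable o) (h : α → β) : Observable fun s => h (o s) :=
  fun g hg => ho (fun x => g (h x)) fun _ => hg _

theorem and {φ ψ : RamState → Prop} (h₁ : Observable φ) (h₂ : Observable ψ) :
    Observable fun s => φ s ∧ ψ s := h₁.map₂ h₂ And

theorem or {φ ψ : RamState → Prop} (h₁ : Observable φ) (h₂ : Observable ψ) :
    Observable fun s => φ s ∨ ψ s := h₁.map₂ h₂ Or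

theorem not {φ : RamState → Prop} (h₁ : Observable φ) : Observable fun s => ¬ φ s := h₁.map Not

theorem imp {φ ψ : RamState → Prop} (h₁ : Observable φ) (h₂ : Observable ψ) :
    Observable fun s => φ s → ψ s := h₁.map₂ h₂ fun P Q => P → Q

theorem ite {φ : RamState → Prop} [∀ s, Decidable (φ s)] {o₁ o₂ : RamState → α}
    (h : Observable φ) (h₁ : Observable o₁) (h₂ : Observable o₂) :
    Observable fun s => if φ s then o₁ s else o₂ s := by
  classical
  have := (h.map₂ (h₁.map₂ h₂ Prod.mk) fun (P : Prop) (x : α × α) => if P then x.1 else x.2)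
  convert this

theorem sum {ι M : Type} [AddCommMonoid M] (S : Finset ι) {o : ι → RamState → M}
    (h : ∀ i, Observable (o i)) : Observable fun s => ∑ i ∈ S, o i s := by
  classical
  induction S using Finset.induction_on with
  | empty => simpa using const (0 : M)
  | insert i S hi ih =>
    simp only [Finset.sum_insert hi]
    exact (h i).map₂ ih (· + ·)

end Observable

namespace Evaluable

/-- After the tests the value is known, so it may be written as a literal constant. -/
theorem of_observable {v : RamState → ℤ} (h : Observable v) : Evaluable v :=
  ⟨fun s => .const (v s), h.map _, fun _ => rfl⟩

theorem const (z : ℤ) : Evaluable fun _ => z := of_observable (.const z)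

theorem reg (x : ℕ) : Evaluable fun s => s.reg x := ⟨fun _ => .var x, .const _, fun _ => rfl⟩

theorem read (a : ℕ) {v : RamState → ℤ} : Evaluable v → Evaluable fun s => s.arr a (v s) := by
  rintro ⟨o, ho, h⟩
  exact ⟨fun s => .read a (o s), ho.map _, fun s => by simp only [h, RamExpr.eval]⟩

theorem add {v w : RamState → ℤ} : Evaluable v → Evaluable w → Evaluable fun s => v s + w s := by
  rintro ⟨o, ho, h⟩ ⟨o', ho', h'⟩
  exact ⟨fun s => .add (o s) (o' s), ho.map₂ ho' _, fun s => by simp only [h, h', RamExpr.eval]⟩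

theorem sub {v w : RamState → ℤ} : Evaluable v → Evaluable w → Evaluable fun s => v s - w s := by
  rintro ⟨o, ho, h⟩ ⟨o', ho', h'⟩
  exact ⟨fun s => .sub (o s) (o' s), ho.map₂ ho' _, fun s => by simp only [h, h', RamExpr.eval]⟩

theorem neg {v : RamState → ℤ} (hv : Evaluable v) : Evaluable fun s => - v s := by
  simpa using (const 0).sub hv

/-- The machine cannot multiply; a fixed multiple is a fixed number of additions. -/
theorem const_mul {v : RamState → ℤ} (hv : Evaluable v) (z : ℤ) :
    Evaluable fun s => z * v s := by
  have key : ∀ n : ℕ, Evaluable fun s => (n : ℤ) * v s := by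
    intro n
    induction n with
    | zero => simpa using const 0
    | succ n ih => simpa [add_mul] using ih.add hv
  rcases Int.eq_nat_or_neg z with ⟨n, rfl | rfl⟩
  · exact key n
  · simpa using (key n).neg

theorem ite {φ : RamState → Prop} [∀ s, Decidable (φ s)] {v w : RamState → ℤ}
    (h : Observable φ) : Evaluable v → Evaluable w →
    Evaluable fun s => if φ s then v s else w s := by
  rintro ⟨o, ho, hv⟩ ⟨o', ho', hw⟩
  exact ⟨_, h.ite ho ho', fun s => by by_cases hs : φ s <;> simp [hs, hv, hw]⟩

/-- The only primitive test. The two continuations are compiled into the branches of one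
conditional, and all other tests are derived from it. -/
theorem observable_pos {v : RamState → ℤ} : Evaluable v → Observable fun s => 0 < v s := by
  rintro ⟨o, ho, h⟩ g hg
  simp only [h]
  refine ho (fun e s => g (0 < e.eval s) s) fun e => ?_
  obtain ⟨P, T, hP⟩ := hg True
  obtain ⟨Q, U, hQ⟩ := hg False
  refine ⟨.ite e P Q, e.cost + (T + U) + 1, fun s => ?_⟩
  by_cases hs : 0 < e.eval s
  · obtain ⟨t, ht, h'⟩ := hP s
    exact ⟨e.cost + t + 1, by omega, by simpa only [hs] using .ite_true hs h'⟩
  · obtain ⟨t, ht, h'⟩ := hQ s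
    exact ⟨e.cost + t + 1, by omega, by simpa only [hs] using .ite_false (not_lt.1 hs) h'⟩

theorem lt {v w : RamState → ℤ} (hv : Evaluable v) (hw : Evaluable w) :
    Observable fun s => v s < w s := by
  simpa using (hw.sub hv).observable_pos

theorem le {v w : RamState → ℤ} (hv : Evaluable v) (hw : Evaluable w) :
    Observable fun s => v s ≤ w s := by
  simpa using (hw.lt hv).not

theorem eq {v w : RamState → ℤ} (hv : Evaluable v) (hw : Evaluable w) :
    Observable fun s => v s = w s := by
  simpa only [le_antisymm_iff] using (hv.le hw).and (hw.le hv)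

end Evaluable

namespace Computes

theorem set (x : ℕ) {v : RamState → ℤ} : Evaluable v → Computes fun s => s.set x (v s) := by
  rintro ⟨o, ho, h⟩
  simp only [h]
  exact ho (fun e s => s.set x (e.eval s)) fun e =>
    ⟨.assign x e, e.cost + 1, fun s => ⟨_, le_rfl, .assign s x e⟩⟩

theorem put (a : ℕ) {i v : RamState → ℤ} : Evaluable i → Evaluable v →
    Computes fun s => s.put a (i s) (v s) := by
  rintro ⟨o, ho, h⟩ ⟨o', ho', h'⟩
  simp only [h, h']
  exact (ho.map₂ ho' Prod.mk) (fun e s => s.put a (e.1.eval s) (e.2.eval s)) fun e =>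
    ⟨.write a e.1 e.2, e.1.cost + e.2.cost + 1, fun s => ⟨_, le_rfl, .write s a e.1 e.2⟩⟩

theorem comp' {f g : RamState → RamState} (hg : Computes g) (hf : Computes f) :
    Computes (g ∘ f) := hg.comp hf

theorem ite {φ : RamState → Prop} [∀ s, Decidable (φ s)] {f g : RamState → RamState}
    (h : Observable φ) (hf : Computes f) (hg : Computes g) :
    Computes fun s => if φ s then f s else g s := by
  classical
  have := h (fun P s => if P then f s else g s) fun P => by
    by_cases hP : P <;> simpa only [hP, if_true, if_false]
  convert this

/-- Conditional stores into one array, at addresses that do not depend on that array. -/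
theorem exists_puts {ι : Type} (l : List ι) (a : ℕ) (φ : ι → Prop) (ad v : ι → RamState → ℤ)
    (had : ∀ i, Evaluable (ad i)) (hv : ∀ i, Evaluable (v i))
    (hadr : ∀ i s s', s'.reg = s.reg → ad i s' = ad i s)
    (hvr : ∀ i s s', s'.reg = s.reg → v i s' = v i s) :
    ∃ f : RamState → RamState, Computes f ∧ ∀ s, (f s).reg = s.reg ∧
      (∀ a' ≠ a, (f s).arr a' = s.arr a') ∧
      (∀ z, (∀ i ∈ l, φ i → ad i s ≠ z) → (f s).arr a z = s.arr a z) ∧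
      ∀ z, (∃ i ∈ l, φ i ∧ ad i s = z) → ∃ i ∈ l, φ i ∧ ad i s = z ∧ (f s).arr a z = v i s := by
  classical
  induction l with
  | nil => exact ⟨_, id, fun s => by simp⟩
  | cons i l ih =>
    obtain ⟨f, hf, h⟩ := ih
    by_cases hi : φ i
    · refine ⟨_, (put a (had i) (hv i)).comp hf, fun s => ?_⟩
      obtain ⟨h1, h2, h3, h4⟩ := h s
      have e1 : ad i (f s) = ad i s := hadr _ _ _ h1
      have e2 : v i (f s) = v i s := hvr _ _ _ h1
      refine ⟨h1, fun a' ha' => ?_, fun z hz => ?_, fun z hz => ?_⟩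
      · rw [RamState.put_arr_of_ne _ ha', h2 a' ha']
      · rw [RamState.put_arr_same, e1, if_neg fun e => hz i (by simp) hi e.symm]
        exact h3 z fun j hj => hz j (by simp [hj])
      · rw [RamState.put_arr_same, e1, e2]
        by_cases e : z = ad i s
        · exact ⟨i, by simp, hi, e.symm, by rw [if_pos e]⟩
        · rw [if_neg e]
          obtain ⟨j, hj, hj'⟩ := hz
          rcases List.mem_cons.1 hj with rfl | hj
          · exact absurd hj'.2.symm e
          · obtain ⟨j, hj, hj'⟩ := h4 z ⟨j, hj, hj'⟩
            exact ⟨j, by simp [hj], hj'⟩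
    · refine ⟨f, hf, fun s => ?_⟩
      obtain ⟨h1, h2, h3, h4⟩ := h s
      refine ⟨h1, h2, fun z hz => h3 z fun j hj => hz j (by simp [hj]), fun z hz => ?_⟩
      obtain ⟨j, hj, hj'⟩ := hz
      rcases List.mem_cons.1 hj with rfl | hj
      · exact absurd hj'.1 hi
      · obtain ⟨j, hj, hj'⟩ := h4 z ⟨j, hj, hj'⟩
        exact ⟨j, by simp [hj], hj'⟩

/-- A loop whose guard holds exactly `n` times iterates its body `n` times. -/
theorem exists_while {f : RamState → RamState} (hf : Computes f) (e : RamExpr) :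
    ∃ (P : RamProg) (T : ℕ), ∀ (n : ℕ) (s : RamState), (∀ i < n, 0 < e.eval (f^[i] s)) →
      e.eval (f^[n] s) ≤ 0 → ∃ t ≤ T * (n + 1), RamExec P s (f^[n] s) t := by
  obtain ⟨P, T, hP⟩ := hf
  refine ⟨.while e P, e.cost + T + 1, fun n => ?_⟩
  induction n with
  | zero => exact fun s _ h => ⟨e.cost + 1, by omega, .while_false h⟩
  | succ n ih =>
    intro s h1 h2
    obtain ⟨t, ht, h⟩ := hP s
    obtain ⟨u, hu, h'⟩ := ih (f s) (fun i hi => h1 (i + 1) (by omega)) h2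
    exact ⟨e.cost + t + u + 1, by linarith,
      .while_true (h1 0 (by omega)) h h'⟩

end Computes

end RandomAccessMachine

/-! ### Dynamic programming along a path -/

section PathDynamicProgram

/-- The number of sign changes among the first `t + 1` signs. -/
def switches (σ : ℕ → ℤˣ) (t : ℕ) : ℕ := ∑ i ∈ Finset.range t, if σ i ≠ σ (i + 1) then 1 else 0

theorem switches_succ (σ : ℕ → ℤˣ) (t : ℕ) :
    switches σ (t + 1) = switches σ t + if σ t ≠ σ (t + 1) then 1 else 0 :=
  Finset.sum_range_succ _ _

/-- When consecutive labelings agree on their shared vertices, all relative signs are 1, and the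
budget limits sign changes only. -/
theorem violations_pathGraph {N : ℕ} (S : Fin N → Fin N → ℤˣ)
    (hS : ∀ i j, (SimpleGraph.pathGraph N).Adj i j → S i j = 1) (σ : ℕ → ℤˣ) :
    violations (SimpleGraph.pathGraph N) S (fun i => σ i) = switches σ (N - 1) := by
  rcases N with _ | n
  · simp [violations, switches]
  rw [Nat.add_sub_cancel]
  unfold switches
  rw [← Finset.card_filter, ← Set.ncard_coe_finset]
  unfold violations
  symm
  refine Set.ncard_congr (fun i _ => s(Fin.ofNat (n + 1) i, Fin.ofNat (n + 1) (i + 1))) ?_ ?_ ?_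
  · intro i hi
    simp only [Finset.coe_filter, Finset.mem_range, Set.mem_ofPred_eq] at hi
    have e1 : ((Fin.ofNat (n + 1) i : Fin (n + 1)) : ℕ) = i := Nat.mod_eq_of_lt (by omega)
    have e2 : ((Fin.ofNat (n + 1) (i + 1) : Fin (n + 1)) : ℕ) = i + 1 :=
      Nat.mod_eq_of_lt (by omega)
    have hadj : (SimpleGraph.pathGraph (n + 1)).Adj (Fin.ofNat (n + 1) i)
        (Fin.ofNat (n + 1) (i + 1)) := by
      rw [SimpleGraph.pathGraph_adj, e1, e2]; exact Or.inl rfl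
    refine ⟨hadj, _, _, rfl, ?_⟩
    rw [hS _ _ hadj, mul_one]
    change σ _ ≠ σ _
    rw [e1, e2]
    exact hi.2
  · intro i j hi hj h
    simp only [Finset.coe_filter, Finset.mem_range, Set.mem_ofPred_eq] at hi hj
    have e1 : ((Fin.ofNat (n + 1) i : Fin (n + 1)) : ℕ) = i := Nat.mod_eq_of_lt (by omega)
    have e2 : ((Fin.ofNat (n + 1) (i + 1) : Fin (n + 1)) : ℕ) = i + 1 :=
      Nat.mod_eq_of_lt (by omega)
    have e3 : ((Fin.ofNat (n + 1) j : Fin (n + 1)) : ℕ) = j := Nat.mod_eq_of_lt (by omega)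
    have e4 : ((Fin.ofNat (n + 1) (j + 1) : Fin (n + 1)) : ℕ) = j + 1 :=
      Nat.mod_eq_of_lt (by omega)
    rcases Sym2.eq_iff.1 h with ⟨h1, h2⟩ | ⟨h1, h2⟩
    · rw [← e1, h1, e3]
    · have := congrArg Fin.val h1
      have := congrArg Fin.val h2
      omega
  · rintro e ⟨he, i, j, rfl, hij⟩
    have hadj : (SimpleGraph.pathGraph (n + 1)).Adj i j := he
    rw [hS _ _ hadj, mul_one] at hij
    rw [SimpleGraph.pathGraph_adj] at hadj
    simp only [Finset.coe_filter, Finset.mem_range, Set.mem_ofPred_eq]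
    rcases hadj with h | h
    · refine ⟨i, ⟨by omega, by rwa [h]⟩, ?_⟩
      rw [h]; simp
    · refine ⟨j, ⟨by omega, by rw [h]; exact hij.symm⟩, ?_⟩
      rw [h, Sym2.eq_swap]; simp

/-- The least cost of the first `t + 1` signs, the last of which is `a`, with at most `l` sign
changes. -/
def pathCost (cost : ℕ → ℤˣ → ℕ) : ℕ → ℕ → ℤˣ → ℕ
  | 0, _, a => cost 0 a
  | t + 1, 0, a => cost (t + 1) a + pathCost cost t 0 a
  | t + 1, l + 1, a =>
    cost (t + 1) a + min (pathCost cost t (l + 1) a) (pathCost cost t l (-a))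

/-- Optimality of the recursion: removing the last sign uses up one unit of the budget exactly when
it was a change. Attainment is proved along with the trace-back. -/
theorem pathCost_le (cost : ℕ → ℤˣ → ℕ) (τ : ℕ → ℤˣ) (t l : ℕ) (h : switches τ t ≤ l) :
    pathCost cost t l (τ t) ≤ ∑ i ∈ Finset.range (t + 1), cost i (τ i) := by
  induction t generalizing l with
  | zero => simp [pathCost]
  | succ t ih =>
    rw [Finset.sum_range_succ, add_comm (∑ _ ∈ _, _)]
    rw [switches_succ] at h
    by_cases hτ : τ t = τ (t + 1)
    · rw [if_neg (not_not.2 hτ)] at h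
      have := ih l h
      rw [hτ] at this
      cases l with
      | zero => exact Nat.add_le_add_left this _
      | succ l => exact Nat.add_le_add_left ((min_le_left _ _).trans this) _
    · rw [if_pos hτ] at h
      obtain ⟨l, rfl⟩ : ∃ l', l = l' + 1 := ⟨l - 1, by omega⟩
      have := ih l (by omega)
      rw [(Int.units_ne_iff_eq_neg' _ _).1 hτ] at this
      exact Nat.add_le_add_left ((min_le_right _ _).trans this) _

end PathDynamicProgram

/-! ### Programs for the dynamic program -/

section DynamicProgramming

/-- The value computed at the current position: the cost in array `a`, plus the better one of the
two preceding values in the arrays `d` (no sign change) and `d'` (sign change). -/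
def tableValue (a d d' : ℕ) (s : RamState) : ℤ :=
  s.arr a (s.reg 15) + if s.reg 15 ≤ 0 then 0 else
    if s.reg 14 ≤ 0 ∨ s.arr d (s.reg 13 - s.reg 12) ≤ s.arr d' (s.reg 13 - s.reg 12 - 1) then
      s.arr d (s.reg 13 - s.reg 12) else s.arr d' (s.reg 13 - s.reg 12 - 1)

theorem evaluable_tableValue (a d d' : ℕ) : Evaluable (tableValue a d d') :=
  have h := ((Evaluable.reg 13).sub (Evaluable.reg 12)).read d
  have h' := (((Evaluable.reg 13).sub (Evaluable.reg 12)).sub (.const 1)).read d'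
  ((Evaluable.reg 15).read a).add (.ite ((Evaluable.reg 15).le (.const 0)) (.const 0)
    (.ite (((Evaluable.reg 14).le (.const 0)).or (h.le h')) h h'))

/-- One entry of the table of path costs, which is stored in the arrays `7` and `8`. -/
def tableStep : RamState → RamState :=
  (fun s => if s.reg 14 = s.reg 12 then (s.set 14 0).set 15 (s.reg 15 + 1) else s) ∘
  (fun s => s.set 14 (s.reg 14 + 1)) ∘ (fun s => s.set 13 (s.reg 13 + 1)) ∘
  (fun s => s.put 8 (s.reg 13) (s.reg 21)) ∘ (fun s => s.put 7 (s.reg 13) (s.reg 20)) ∘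
  (fun s => s.set 21 (tableValue 5 8 7 s)) ∘ fun s => s.set 20 (tableValue 4 7 8 s)

theorem computes_tableStep : Computes tableStep :=
  .comp' (.ite ((Evaluable.reg 14).eq (.reg 12))
      ((Computes.set 15 ((Evaluable.reg 15).add (.const 1))).comp (.set 14 (.const 0)) |> fun h => by
        simpa using h) .id) <|
  .comp' (.set 14 ((Evaluable.reg 14).add (.const 1))) <|
  .comp' (.set 13 ((Evaluable.reg 13).add (.const 1))) <|
  .comp' (.put 8 (.reg 13) (.reg 21)) <| .comp' (.put 7 (.reg 13) (.reg 20)) <|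
  .comp' (.set 21 (evaluable_tableValue 5 8 7)) (.set 20 (evaluable_tableValue 4 7 8))

theorem tableStep_reg (s : RamState) :
    (tableStep s).reg 13 = s.reg 13 + 1 ∧
    (tableStep s).reg 14 = (if s.reg 14 + 1 = s.reg 12 then 0 else s.reg 14 + 1) ∧
    (tableStep s).reg 15 = (if s.reg 14 + 1 = s.reg 12 then s.reg 15 + 1 else s.reg 15) ∧
    ∀ x, x ≠ 13 → x ≠ 14 → x ≠ 15 → x ≠ 20 → x ≠ 21 → (tableStep s).reg x = s.reg x := by
  by_cases h : s.reg 14 + 1 = s.reg 12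
  · simp +contextual [tableStep, h]
  · simp +contextual [tableStep, h]

theorem tableStep_arr (s : RamState) :
    (∀ i, (tableStep s).arr 7 i = if i = s.reg 13 then tableValue 4 7 8 s else s.arr 7 i) ∧
    (∀ i, (tableStep s).arr 8 i = if i = s.reg 13 then tableValue 5 8 7 s else s.arr 8 i) ∧
    ∀ a, a ≠ 7 → a ≠ 8 → (tableStep s).arr a = s.arr a := by
  have key : (tableStep s).arr = ((((s.set 20 (tableValue 4 7 8 s)).set 21
      (tableValue 5 8 7 s)).put 7 (s.reg 13) (tableValue 4 7 8 s)).put 8 (s.reg 13)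
      (tableValue 5 8 7 s)).arr := by
    have : tableValue 5 8 7 (s.set 20 (tableValue 4 7 8 s)) = tableValue 5 8 7 s := by
      simp [tableValue]
    simp only [tableStep, Function.comp_apply]
    split_ifs <;> simp [this, RamState.put]
  rw [key]
  refine ⟨fun i => ?_, fun i => ?_, fun a h7 h8 => ?_⟩
  · rw [RamState.put_arr_of_ne _ (by norm_num), RamState.put_arr_same]; rfl
  · rw [RamState.put_arr_same, RamState.put_arr_of_ne _ (by norm_num)]; rfl
  · rw [RamState.put_arr_of_ne _ h8, RamState.put_arr_of_ne _ h7]; rfl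

/-- The first `n` entries of the table of path costs with at most `L` sign changes are stored. -/
def HoldsTable (cost : ℕ → ℤˣ → ℕ) (L n : ℕ) (s : RamState) : Prop :=
  ∀ t l, l ≤ L → t * (L + 1) + l < n →
    s.arr 7 ((t * (L + 1) + l : ℕ) : ℤ) = pathCost cost t l 1 ∧
    s.arr 8 ((t * (L + 1) + l : ℕ) : ℤ) = pathCost cost t l (-1)

/-- The loop invariant: register `13` is the running address, and the registers `14` and `15` are
its remainder and quotient by `L + 1`, maintained by counting since the machine cannot divide. -/
theorem tableStep_iterate {cost : ℕ → ℤˣ → ℕ} {N L : ℕ} {s : RamState}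
    (h12 : s.reg 12 = L + 1) (h13 : s.reg 13 = 0) (h14 : s.reg 14 = 0) (h15 : s.reg 15 = 0)
    (h4 : ∀ t < N, s.arr 4 (t : ℤ) = cost t 1) (h5 : ∀ t < N, s.arr 5 (t : ℤ) = cost t (-1))
    (n : ℕ) (hn : n ≤ N * (L + 1)) :
    (tableStep^[n] s).reg 13 = n ∧ (tableStep^[n] s).reg 14 = (n % (L + 1) : ℕ) ∧
    (tableStep^[n] s).reg 15 = (n / (L + 1) : ℕ) ∧
    (∀ x, x ≠ 13 → x ≠ 14 → x ≠ 15 → x ≠ 20 → x ≠ 21 → (tableStep^[n] s).reg x = s.reg x) ∧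
    (∀ a, a ≠ 7 → a ≠ 8 → (tableStep^[n] s).arr a = s.arr a) ∧
    HoldsTable cost L n (tableStep^[n] s) := by
  induction n with
  | zero => simp [h13, h14, h15, HoldsTable]
  | succ n ih =>
    obtain ⟨i13, i14, i15, ireg, iarr, itab⟩ := ih (by omega)
    rw [Function.iterate_succ_apply']
    set u := tableStep^[n] s
    obtain ⟨r13, r14, r15, rreg⟩ := tableStep_reg u
    obtain ⟨a7, a8, aarr⟩ := tableStep_arr u
    have i12 : u.reg 12 = L + 1 := by
      rw [ireg 12 (by norm_num) (by norm_num) (by norm_num) (by norm_num) (by norm_num), h12]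
    have hlt := Nat.mod_lt n (show 0 < L + 1 by omega)
    have hdm := Nat.div_add_mod' n (L + 1)
    have hN : n / (L + 1) < N := Nat.div_lt_of_lt_mul (by rw [mul_comm]; omega)
    obtain ⟨t, ht⟩ : ∃ t, t = n / (L + 1) := ⟨_, rfl⟩
    obtain ⟨l, hl⟩ : ∃ l, l = n % (L + 1) := ⟨_, rfl⟩
    rw [← ht, ← hl] at hdm
    rw [← ht] at i15 hN
    rw [← hl] at i14 hlt
    have hval : tableValue 4 7 8 u = pathCost cost t l 1 ∧
        tableValue 5 8 7 u = pathCost cost t l (-1) := by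
      unfold tableValue
      rw [i12, i13, i14, i15, iarr 4 (by norm_num) (by norm_num),
        iarr 5 (by norm_num) (by norm_num), h4 t hN, h5 t hN]
      rcases t with _ | t
      · simp [pathCost]
      -- Going back by `L + 1` addresses reaches the previous block with the same budget; one
      -- address further lies the smaller budget needed for a change.
      · have e1 : (n : ℤ) - (L + 1) = ((t * (L + 1) + l : ℕ) : ℤ) := by
          rw [← hdm]; push_cast; ring
        have hmul : (t + 1) * (L + 1) = t * (L + 1) + (L + 1) := by ring
        have e0 : ¬ ((t + 1 : ℕ) : ℤ) ≤ 0 := by push_cast; omega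
        obtain ⟨g7, g8⟩ := itab t l (by omega) (by omega)
        simp only [e0, if_false]
        rw [e1, g7, g8]
        rcases l with _ | l
        · simp [pathCost]
        · have e2 : ((t * (L + 1) + (l + 1) : ℕ) : ℤ) - 1 = ((t * (L + 1) + l : ℕ) : ℤ) := by
            push_cast; ring
          obtain ⟨k7, k8⟩ := itab t l (by omega) (by omega)
          have e3 : ¬ ((l + 1 : ℕ) : ℤ) ≤ 0 := by push_cast; omega
          rw [e2, k7, k8]
          simp only [e3, false_or, pathCost, neg_neg]
          push_cast
          constructor <;> rw [min_def]
    have hsucc := div_mod_succ n (L + 1) (by omega)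
    rw [← ht, ← hl] at hsucc
    refine ⟨by rw [r13, i13]; push_cast; rfl, ?_, ?_, ?_, ?_, ?_⟩
    · rw [r14, i14, i12]
      split_ifs with h <;> omega
    · rw [r15, i14, i12, i15]
      split_ifs with h <;> omega
    · intro x h1 h2 h3 h4 h5
      rw [rreg x h1 h2 h3 h4 h5, ireg x h1 h2 h3 h4 h5]
    · intro a h1 h2
      rw [aarr a h1 h2, iarr a h1 h2]
    · intro t' l' hl' h
      rw [a7, a8, i13]
      by_cases e : t' * (L + 1) + l' = n
      · have e1 : t' = t := by
          rw [ht, ← e, mul_comm, Nat.mul_add_div (by omega), Nat.div_eq_of_lt (by omega), add_zero]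
        subst e1
        have e2 : l' = l := by omega
        subst e2
        rw [e, if_pos rfl, if_pos rfl]
        exact hval
      · rw [if_neg (by exact_mod_cast e), if_neg (by exact_mod_cast e)]
        exact itab t' l' hl' (by omega)

/-- One step of the search for the optimal signs, from the last one to the first one; the signs
are stored in array `6`. -/
def traceStep : RamState → RamState :=
  (fun s => if 0 < s.reg 14 ∧ ((s.reg 16 = 1 ∧ s.arr 8 (s.reg 13 - 1) < s.arr 7 (s.reg 13)) ∨
      (¬ s.reg 16 = 1 ∧ s.arr 7 (s.reg 13 - 1) < s.arr 8 (s.reg 13))) then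
    ((s.set 16 (-s.reg 16)).set 14 (s.reg 14 - 1)).set 13 (s.reg 13 - 1) else s) ∘
  (fun s => s.set 13 (s.reg 13 - s.reg 12)) ∘ (fun s => s.set 15 (s.reg 15 - 1)) ∘
  fun s => s.put 6 (s.reg 15) (s.reg 16)

theorem computes_traceStep : Computes traceStep := by
  have h1 : Evaluable fun s => s.reg 13 - 1 := (Evaluable.reg 13).sub (.const 1)
  refine .comp' (.ite (.and ((Evaluable.const 0).lt (.reg 14)) (.or
    (.and ((Evaluable.reg 16).eq (.const 1)) ((h1.read 8).lt ((Evaluable.reg 13).read 7)))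
    (.and ((Evaluable.reg 16).eq (.const 1)).not
      ((h1.read 7).lt ((Evaluable.reg 13).read 8))))) ?_ .id)
    (.comp' (.set 13 ((Evaluable.reg 13).sub (.reg 12)))
      (.comp' (.set 15 ((Evaluable.reg 15).sub (.const 1))) (.put 6 (.reg 15) (.reg 16))))
  have := (Computes.set 13 h1).comp ((Computes.set 14 ((Evaluable.reg 14).sub (.const 1))).comp
    (.set 16 (Evaluable.reg 16).neg))
  simpa using this

theorem traceStep_iterate_reg (n : ℕ) (s : RamState) :
    (traceStep^[n] s).reg 15 = s.reg 15 - n ∧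
    (∀ x, x ≠ 13 → x ≠ 14 → x ≠ 15 → x ≠ 16 → (traceStep^[n] s).reg x = s.reg x) ∧
    ∀ a, a ≠ 6 → (traceStep^[n] s).arr a = s.arr a := by
  induction n with
  | zero => simp
  | succ n ih =>
    rw [Function.iterate_succ_apply']
    set u := traceStep^[n] s
    have h : (traceStep u).reg 15 = u.reg 15 - 1 ∧
        (∀ x, x ≠ 13 → x ≠ 14 → x ≠ 15 → x ≠ 16 → (traceStep u).reg x = u.reg x) ∧
        ∀ a, a ≠ 6 → (traceStep u).arr a = u.arr a := by
      unfold traceStep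
      simp only [Function.comp_apply]
      split_ifs <;> refine ⟨by simp, fun x _ _ _ _ => by simp [*], fun a ha => ?_⟩ <;>
        simp [RamState.put_arr_of_ne _ ha]
    refine ⟨by rw [h.1, ih.1]; push_cast; ring, fun x h1 h2 h3 h4 => ?_, fun a ha => ?_⟩
    · rw [h.2.1 x h1 h2 h3 h4, ih.2.1 x h1 h2 h3 h4]
    · rw [h.2.2 a ha, ih.2.2 a ha]

/-- Each step repeats the comparison that defined the minimum in the table, so the signs found
realize the tabulated cost within the budget. Ties keep the sign. The step at `t = 0` may read
meaningless entries, but these affect registers only. -/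
theorem traceStep_iterate_signs {cost : ℕ → ℤˣ → ℕ} {L : ℕ} (t l : ℕ) (a : ℤˣ) (s : RamState)
    (hl : l ≤ L) (h12 : s.reg 12 = L + 1) (h13 : s.reg 13 = (t * (L + 1) + l : ℕ))
    (h14 : s.reg 14 = l) (h15 : s.reg 15 = t) (h16 : s.reg 16 = (a : ℤ))
    (htab : HoldsTable cost L (t * (L + 1) + l + 1) s) :
    (∀ i : ℤ, t < i → (traceStep^[t + 1] s).arr 6 i = s.arr 6 i) ∧
    ∃ σ : ℕ → ℤˣ, (∀ i ≤ t, (traceStep^[t + 1] s).arr 6 (i : ℤ) = (σ i : ℤ)) ∧ σ t = a ∧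
      ∑ i ∈ Finset.range (t + 1), cost i (σ i) = pathCost cost t l a ∧ switches σ t ≤ l := by
  induction t generalizing l a s with
  | zero =>
    have h6 : ∀ i, (traceStep s).arr 6 i = if i = 0 then (a : ℤ) else s.arr 6 i := by
      intro i
      unfold traceStep
      simp only [Function.comp_apply]
      split_ifs <;> simp_all [RamState.put_arr_same]
    refine ⟨fun i hi => ?_, fun _ => a, fun i hi => ?_, rfl, by simp [pathCost], by simp [switches]⟩
    · change (traceStep s).arr 6 i = _
      rw [h6, if_neg (by push_cast at hi; omega)]
    · change (traceStep s).arr 6 i = _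
      rw [h6, if_pos (by omega)]
  | succ t ih =>
    rw [Function.iterate_succ_apply]
    have h6 : ∀ i, (traceStep s).arr 6 i = if i = (t + 1 : ℕ) then (a : ℤ) else s.arr 6 i := by
      intro i
      unfold traceStep
      simp only [Function.comp_apply]
      split_ifs <;> simp_all [RamState.put_arr_same]
    obtain ⟨-, hreg, harr⟩ := traceStep_iterate_reg 1 s
    change (∀ x, x ≠ 13 → x ≠ 14 → x ≠ 15 → x ≠ 16 → (traceStep s).reg x = s.reg x) at hreg
    change (∀ a, a ≠ 6 → (traceStep s).arr a = s.arr a) at harr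
    have k12 : (traceStep s).reg 12 = L + 1 := by
      rw [hreg 12 (by norm_num) (by norm_num) (by norm_num) (by norm_num), h12]
    have k15 : (traceStep s).reg 15 = t := by
      have := (traceStep_iterate_reg 1 s).1
      rw [h15] at this
      simpa using this
    have ktab : ∀ n, n ≤ (t + 1) * (L + 1) + l + 1 → HoldsTable cost L n (traceStep s) := by
      intro n hn t' l' hl' h
      rw [harr 7 (by norm_num), harr 8 (by norm_num)]
      exact htab t' l' hl' (by omega)
    have e1 : s.reg 13 - s.reg 12 = ((t * (L + 1) + l : ℕ) : ℤ) := by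
      rw [h13, h12]; push_cast; ring
    have hmul : (t + 1) * (L + 1) = t * (L + 1) + (L + 1) := by ring
    obtain ⟨g7, g8⟩ := htab t l hl (by omega)
    have key : ∃ l' a', l' ≤ l ∧ (traceStep s).reg 13 = ((t * (L + 1) + l' : ℕ) : ℤ) ∧
        (traceStep s).reg 14 = l' ∧ (traceStep s).reg 16 = ((a' : ℤˣ) : ℤ) ∧
        pathCost cost (t + 1) l a = cost (t + 1) a + pathCost cost t l' a' ∧
        (l' + if a' ≠ a then 1 else 0) ≤ l := by
      let u : RamState := ((s.put 6 (s.reg 15) (s.reg 16)).set 15 (s.reg 15 - 1)).set 13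
        (s.reg 13 - s.reg 12)
      have hu : traceStep s = if 0 < u.reg 14 ∧
          ((u.reg 16 = 1 ∧ u.arr 8 (u.reg 13 - 1) < u.arr 7 (u.reg 13)) ∨
          (¬ u.reg 16 = 1 ∧ u.arr 7 (u.reg 13 - 1) < u.arr 8 (u.reg 13))) then
          ((u.set 16 (-u.reg 16)).set 14 (u.reg 14 - 1)).set 13 (u.reg 13 - 1) else u := by
        simp [traceStep, u]
      have u13 : u.reg 13 = ((t * (L + 1) + l : ℕ) : ℤ) := by rw [← e1]; simp [u]
      have u14 : u.reg 14 = l := by simp [u, h14]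
      have u16 : u.reg 16 = (a : ℤ) := by simp [u, h16]
      have u7 : u.arr 7 = s.arr 7 :=
        s.put_arr_of_ne (a := 6) (a' := 7) (by norm_num) (s.reg 15) (s.reg 16)
      have u8 : u.arr 8 = s.arr 8 :=
        s.put_arr_of_ne (a := 6) (a' := 8) (by norm_num) (s.reg 15) (s.reg 16)
      rcases l with _ | l
      · rw [if_neg (by simp [u14])] at hu
        exact ⟨0, a, le_rfl, by rw [hu, u13], by rw [hu, u14], by rw [hu, u16], rfl, by simp⟩
      · have e2 : ((t * (L + 1) + (l + 1) : ℕ) : ℤ) - 1 = ((t * (L + 1) + l : ℕ) : ℤ) := by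
          push_cast; ring
        obtain ⟨k7, k8⟩ := htab t l (by omega) (by omega)
        have hcond : (0 < u.reg 14 ∧
            ((u.reg 16 = 1 ∧ u.arr 8 (u.reg 13 - 1) < u.arr 7 (u.reg 13)) ∨
            (¬ u.reg 16 = 1 ∧ u.arr 7 (u.reg 13 - 1) < u.arr 8 (u.reg 13)))) ↔
            pathCost cost t l (-a) < pathCost cost t (l + 1) a := by
          rw [u13, u14, u16, u7, u8, e2, k7, k8, g7, g8]
          rcases Int.units_eq_one_or a with rfl | rfl
          · simp
          · simp
        by_cases hlt : pathCost cost t l (-a) < pathCost cost t (l + 1) a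
        · rw [if_pos (hcond.2 hlt)] at hu
          refine ⟨l, -a, by omega, by rw [hu]; simp [u13, ← e2], by rw [hu]; simp [u14],
            by rw [hu]; simp [u16], ?_, by split_ifs <;> omega⟩
          rw [pathCost, min_eq_right hlt.le]
        · rw [if_neg fun h => hlt (hcond.1 h)] at hu
          refine ⟨l + 1, a, le_rfl, by rw [hu, u13], by rw [hu, u14], by rw [hu, u16], ?_,
            by simp⟩
          rw [pathCost, min_eq_left (not_lt.1 hlt)]
    obtain ⟨l', a', hl', k13, k14, k16, kc, ks⟩ := key
    obtain ⟨q1, σ, q2, q3, q4, q5⟩ := ih l' a' (traceStep s) (by omega) k12 k13 k14 k15 k16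
      (ktab _ (by omega))
    refine ⟨fun i hi => ?_, Function.update σ (t + 1) a, fun i hi => ?_, by simp, ?_, ?_⟩
    · rw [q1 i (by push_cast at hi; omega), h6, if_neg (by omega)]
    · rcases Nat.lt_or_ge t i with h | h
      · have : i = t + 1 := by omega
        subst this
        rw [q1 _ (by exact_mod_cast h), h6]; simp
      · rw [q2 i h, Function.update_of_ne (by omega)]
    · rw [Finset.sum_range_succ, kc, ← q4, add_comm]
      congr 1
      · simp
      · refine Finset.sum_congr rfl fun i hi => ?_
        rw [Function.update_of_ne (by have := Finset.mem_range.1 hi; omega)]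
    · rw [switches_succ]
      have : switches (Function.update σ (t + 1) a) t = switches σ t := by
        refine Finset.sum_congr rfl fun i hi => ?_
        have := Finset.mem_range.1 hi
        rw [Function.update_of_ne (by omega), Function.update_of_ne (by omega)]
      rw [this, Function.update_of_ne (by omega), Function.update_self, q3]
      omega

end DynamicProgramming

/-! ### The pass over the blocks of the zig-zag

The registers `3, …, 9` hold three times the number of the strip, the first row and the first
column of the current block, the address of the start of its first row, the position of the block
within the strip, the parity of the strip and the number of the block. Register `10` holds the
label that the preceding block gave to the shared vertex, and register `11` the guard of the loop.
Cells of the window around the block are given by their offsets from the corner of the block. -/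

section BlockPass

/-- The sign encoded by an integer. -/
def signOf (z : ℤ) : ℤˣ := if z = 1 then 1 else -1

theorem signOf_coe (u : ℤˣ) : signOf u = u := by
  rcases Int.units_eq_one_or u with rfl | rfl <;> rfl

/-- The offsets of the cells in the window. -/
noncomputable def window : Finset (ℤ × ℤ) := Finset.Icc (-1) 5 ×ˢ Finset.Icc (-1) 3

variable (b : ℕ)

/-- The cell with offset `(x, y)` lies in the block. -/
def InBlock (s : RamState) (x y : ℤ) : Prop :=
  0 ≤ x ∧ 0 ≤ y ∧ y < b ∧
    (x < 3 ∨ (s.reg 7 ≤ s.reg 1 - b ∧ s.reg 0 < s.reg 3 + 6 ∧ s.reg 4 + x < s.reg 0))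

/-- The cell with offset `(x, y)` has an edge to the right. -/
def HasRight (s : RamState) (x y : ℤ) : Prop :=
  0 ≤ s.reg 4 + x ∧ s.reg 4 + x < s.reg 0 ∧ 0 ≤ s.reg 5 + y ∧ s.reg 5 + y + 1 < s.reg 1

/-- The cell with offset `(x, y)` has a probed edge downwards. -/
def HasDown (s : RamState) (x y : ℤ) : Prop :=
  0 ≤ s.reg 4 + x ∧ s.reg 4 + x + 1 < s.reg 0 ∧ 0 ≤ s.reg 5 + y ∧ s.reg 5 + y < s.reg 1 ∧
    (s.reg 4 + x = s.reg 3 - 1 →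
      (s.reg 8 = 1 ∧ s.reg 1 ≤ s.reg 5 + y + b) ∨ (s.reg 8 = 0 ∧ s.reg 5 + y < b)) ∧
    (s.reg 4 + x = s.reg 3 + 2 ∧ s.reg 3 + 6 ≤ s.reg 0 →
      (s.reg 8 = 0 ∧ s.reg 1 ≤ s.reg 5 + y + b) ∨ (s.reg 8 = 1 ∧ s.reg 5 + y < b))

/-- The cell with offset `(x, y)` lies in the extended block. -/
def InExt (s : RamState) (x y : ℤ) : Prop :=
  InBlock b s x y ∨ (InBlock b s (x - 1) y ∧ HasDown b s (x - 1) y) ∨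
    (InBlock b s (x + 1) y ∧ HasDown b s x y) ∨ (InBlock b s x (y - 1) ∧ HasRight s x (y - 1)) ∨
    (InBlock b s x (y + 1) ∧ HasRight s x y)

/-- The address of the cell with offset `(x, y)`. -/
def cellAddress (s : RamState) (x y : ℤ) : ℤ := s.reg 6 + x * s.reg 1 + (s.reg 5 + y)

open Classical in
/-- The number of edges in the extended block that are violated by `β`. -/
noncomputable def windowDisagreement (s : RamState) (β : ℤ × ℤ → ℤˣ) : ℕ :=
  ∑ w ∈ window,
    ((if (HasRight s w.1 w.2 ∧ InExt b s w.1 w.2 ∧ InExt b s w.1 (w.2 + 1)) ∧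
        β w * β (w.1, w.2 + 1) ≠ signOf (s.arr 0 (cellAddress s w.1 w.2)) then 1 else 0) +
      if (HasDown b s w.1 w.2 ∧ InExt b s w.1 w.2 ∧ InExt b s (w.1 + 1) w.2) ∧
        β w * β (w.1 + 1, w.2) ≠ signOf (s.arr 1 (cellAddress s w.1 w.2)) then 1 else 0)

/-- The minimizer of `windowDisagreement` that agrees with register `10` on the shared vertex. -/
noncomputable def windowLabel (s : RamState) : ℤ × ℤ → ℤˣ := fun w =>
  Function.argmin (windowDisagreement b s) (0, if s.reg 8 = 0 then 0 else 1) *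
    signOf (s.reg 10) * Function.argmin (windowDisagreement b s) w

open Classical in
/-- The number of vertices of the block where `a * windowLabel` is different from the vertex
labels. -/
noncomputable def windowCost (s : RamState) (a : ℤˣ) : ℕ :=
  ∑ w ∈ window, if InBlock b s w.1 w.2 ∧
    a * windowLabel b s w ≠ signOf (s.arr 2 (cellAddress s w.1 w.2)) then 1 else 0

/-- The offset of the vertex that is shared with the next block. -/
def sharedOffset (s : RamState) : ℤ × ℤ :=
  if s.reg 7 < s.reg 1 - b then (0, if s.reg 8 = 0 then 1 else 0)
  else (1, if (s.reg 7 < s.reg 1 - b + 2 ↔ s.reg 8 = 0) then 0 else 1)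

/-- The update of the registers that describe the block. -/
def moveStep : RamState → RamState :=
  (fun s => s.set 11 (if (s.reg 7 ≤ s.reg 1 - b ∧ s.reg 3 + 3 ≤ s.reg 0) ∨ s.reg 3 + 6 ≤ s.reg 0
    then 1 else 0)) ∘
  (fun s => s.set 9 (s.reg 9 + 1)) ∘
  (fun s => s.set 7 (if s.reg 7 < s.reg 1 - b + 2 then s.reg 7 + 1 else 0)) ∘
  (fun s => s.set 8 (if s.reg 7 < s.reg 1 - b + 2 then s.reg 8 else 1 - s.reg 8)) ∘
  (fun s => s.set 3 (if s.reg 7 < s.reg 1 - b + 2 then s.reg 3 else s.reg 3 + 3)) ∘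
  (fun s => s.set 6 (if s.reg 7 < s.reg 1 - b then s.reg 6 else s.reg 6 + s.reg 1)) ∘
  (fun s => s.set 4 (if s.reg 7 < s.reg 1 - b then s.reg 4 else s.reg 4 + 1)) ∘
  fun s => s.set 5 (if s.reg 7 < s.reg 1 - b then
    (if s.reg 8 = 0 then s.reg 5 + 1 else s.reg 5 - 1) else s.reg 5)

theorem computes_moveStep : Computes (moveStep b) := by
  have h1 : Evaluable fun s => s.reg 1 - (b : ℤ) := (Evaluable.reg 1).sub (.const b)
  have g1 : Observable fun s => s.reg 7 < s.reg 1 - (b : ℤ) := (Evaluable.reg 7).lt h1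
  have g2 : Observable fun s => s.reg 7 < s.reg 1 - (b : ℤ) + 2 :=
    (Evaluable.reg 7).lt (h1.add (.const 2))
  refine .comp' (.set 11 (.ite (.or (.and ((Evaluable.reg 7).le h1)
      (((Evaluable.reg 3).add (.const 3)).le (.reg 0)))
      (((Evaluable.reg 3).add (.const 6)).le (.reg 0))) (.const 1) (.const 0))) <|
    .comp' (.set 9 ((Evaluable.reg 9).add (.const 1))) <|
    .comp' (.set 7 (.ite g2 ((Evaluable.reg 7).add (.const 1)) (.const 0))) <|
    .comp' (.set 8 (.ite g2 (.reg 8) ((Evaluable.const 1).sub (.reg 8)))) <|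
    .comp' (.set 3 (.ite g2 (.reg 3) ((Evaluable.reg 3).add (.const 3)))) <|
    .comp' (.set 6 (.ite g1 (.reg 6) ((Evaluable.reg 6).add (.reg 1)))) <|
    .comp' (.set 4 (.ite g1 (.reg 4) ((Evaluable.reg 4).add (.const 1)))) <|
    .set 5 (.ite g1 (.ite ((Evaluable.reg 8).eq (.const 0)) ((Evaluable.reg 5).add (.const 1))
      ((Evaluable.reg 5).sub (.const 1))) (.reg 5))

theorem moveStep_arr (s : RamState) : (moveStep b s).arr = s.arr := rfl

theorem moveStep_reg (s : RamState) :
    (moveStep b s).reg 3 = (if s.reg 7 < s.reg 1 - b + 2 then s.reg 3 else s.reg 3 + 3) ∧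
    (moveStep b s).reg 4 = (if s.reg 7 < s.reg 1 - b then s.reg 4 else s.reg 4 + 1) ∧
    (moveStep b s).reg 5 = (if s.reg 7 < s.reg 1 - b then
      (if s.reg 8 = 0 then s.reg 5 + 1 else s.reg 5 - 1) else s.reg 5) ∧
    (moveStep b s).reg 6 = (if s.reg 7 < s.reg 1 - b then s.reg 6 else s.reg 6 + s.reg 1) ∧
    (moveStep b s).reg 7 = (if s.reg 7 < s.reg 1 - b + 2 then s.reg 7 + 1 else 0) ∧
    (moveStep b s).reg 8 = (if s.reg 7 < s.reg 1 - b + 2 then s.reg 8 else 1 - s.reg 8) ∧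
    (moveStep b s).reg 9 = s.reg 9 + 1 ∧
    (moveStep b s).reg 11 = (if ((moveStep b s).reg 7 ≤ s.reg 1 - b ∧
      (moveStep b s).reg 3 + 3 ≤ s.reg 0) ∨ (moveStep b s).reg 3 + 6 ≤ s.reg 0 then 1 else 0) ∧
    ∀ x, (x < 3 ∨ x = 10 ∨ 11 < x) → (moveStep b s).reg x = s.reg x := by
  refine ⟨by simp [moveStep], by simp [moveStep], by simp [moveStep], by simp [moveStep],
    by simp [moveStep], by simp [moveStep], by simp [moveStep], by simp [moveStep], ?_⟩
  intro x hx
  simp only [moveStep, Function.comp_apply, RamState.set_reg]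
  rw [if_neg (by omega), if_neg (by omega), if_neg (by omega), if_neg (by omega),
    if_neg (by omega), if_neg (by omega), if_neg (by omega), if_neg (by omega)]

theorem observable_inBlock (x y : ℤ) : Observable fun s => InBlock b s x y :=
  .and (.const _) (.and (.const _) (.and (.const _) (.or (.const _)
    (.and ((Evaluable.reg 7).le ((Evaluable.reg 1).sub (.const b)))
      (.and ((Evaluable.reg 0).lt ((Evaluable.reg 3).add (.const 6)))
        (((Evaluable.reg 4).add (.const x)).lt (.reg 0)))))))

theorem observable_hasRight (x y : ℤ) : Observable fun s => HasRight s x y :=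
  have h4 := (Evaluable.reg 4).add (.const x)
  have h5 := (Evaluable.reg 5).add (.const y)
  .and ((Evaluable.const 0).le h4) (.and (h4.lt (.reg 0)) (.and ((Evaluable.const 0).le h5)
    ((h5.add (.const 1)).lt (.reg 1))))

theorem observable_hasDown (x y : ℤ) : Observable fun s => HasDown b s x y :=
  have h4 := (Evaluable.reg 4).add (.const x)
  have h5 := (Evaluable.reg 5).add (.const y)
  have e0 := (Evaluable.reg 8).eq (.const 0)
  have e1 := (Evaluable.reg 8).eq (.const 1)
  have g1 := (Evaluable.reg 1).le (h5.add (.const b))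
  have g2 := h5.lt (.const b)
  .and ((Evaluable.const 0).le h4) (.and ((h4.add (.const 1)).lt (.reg 0))
    (.and ((Evaluable.const 0).le h5) (.and (h5.lt (.reg 1))
    (.and (.imp (h4.eq ((Evaluable.reg 3).sub (.const 1))) (.or (.and e1 g1) (.and e0 g2)))
      (.imp (.and (h4.eq ((Evaluable.reg 3).add (.const 2)))
        (((Evaluable.reg 3).add (.const 6)).le (.reg 0))) (.or (.and e0 g1) (.and e1 g2)))))))

theorem observable_inExt (x y : ℤ) : Observable fun s => InExt b s x y :=
  .or (observable_inBlock b x y) (.or (.and (observable_inBlock b _ y) (observable_hasDown b _ y))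
    (.or (.and (observable_inBlock b _ y) (observable_hasDown b x y))
      (.or (.and (observable_inBlock b x _) (observable_hasRight x _))
        (.and (observable_inBlock b x _) (observable_hasRight x y)))))

theorem evaluable_cellAddress (x y : ℤ) : Evaluable fun s => cellAddress s x y :=
  ((Evaluable.reg 6).add ((Evaluable.reg 1).const_mul x)).add ((Evaluable.reg 5).add (.const y))

theorem Evaluable.observable_signOf {v : RamState → ℤ} (hv : Evaluable v) :
    Observable fun s => signOf (v s) :=
  .ite (hv.eq (.const 1)) (.const _) (.const _)

/-- The whole function of `β` is observed at once: it is determined by finitely many tests, since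
the window is finite and independent of the grid. -/
theorem observable_windowDisagreement : Observable (windowDisagreement b) := by
  classical
  have key : ∀ {φ : RamState → Prop} {z : RamState → ℤˣ} (w w' : ℤ × ℤ), Observable φ →
      Observable z → Observable fun s => fun β : ℤ × ℤ → ℤˣ =>
        if φ s ∧ β w * β w' ≠ z s then 1 else 0 := fun w w' hφ hz => by
    have := hφ.map₂ hz fun (P : Prop) u => fun β : ℤ × ℤ → ℤˣ =>
      if P ∧ β w * β w' ≠ u then 1 else 0
    convert this
  have := Observable.sum window fun w => (key w (w.1, w.2 + 1)
    ((observable_hasRight w.1 w.2).and ((observable_inExt b w.1 w.2).and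
      (observable_inExt b w.1 (w.2 + 1))))
    ((evaluable_cellAddress w.1 w.2).read 0).observable_signOf).map₂ (key w (w.1 + 1, w.2)
    ((observable_hasDown b w.1 w.2).and ((observable_inExt b w.1 w.2).and
      (observable_inExt b (w.1 + 1) w.2)))
    ((evaluable_cellAddress w.1 w.2).read 1).observable_signOf) (· + ·)
  convert this with s
  ext β
  simp only [windowDisagreement, Finset.sum_apply, Pi.add_apply]
  congr!

/-- The minimizer is a fixed function of the observed disagreement function, so no search has to be
programmed. -/
theorem observable_windowLabel : Observable (windowLabel b) :=
  (observable_windowDisagreement b).map₂ (.map₂ (.ite ((Evaluable.reg 8).eq (.const 0))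
    (.const (0 : ℤ)) (.const 1)) (Evaluable.reg 10).observable_signOf Prod.mk)
    fun D x w => Function.argmin D (0, x.1) * x.2 * Function.argmin D w

theorem observable_windowCost (a : ℤˣ) : Observable fun s => windowCost b s a := by
  classical
  refine .sum window fun w => ?_
  have := ((observable_inBlock b w.1 w.2).map₂ (.map₂ (observable_windowLabel b)
    ((evaluable_cellAddress w.1 w.2).read 2).observable_signOf Prod.mk))
    fun (P : Prop) x => if P ∧ a * x.1 w ≠ x.2 then 1 else 0
  convert this

theorem observable_sharedOffset : Observable (sharedOffset b) :=
  have h1 : Evaluable fun s => s.reg 1 - (b : ℤ) := (Evaluable.reg 1).sub (.const b)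
  have h8 := (Evaluable.reg 8).eq (.const 0)
  .ite ((Evaluable.reg 7).lt h1) (.map (.ite h8 (.const 1) (.const 0)) (Prod.mk 0))
    (.map (.ite (.map₂ ((Evaluable.reg 7).lt (h1.add (.const 2))) h8 Iff) (.const 0) (.const 1))
      (Prod.mk 1))

open Classical in
theorem observable_window_filter :
    Observable fun s => window.filter fun w => InBlock b s w.1 w.2 := by
  generalize window = S
  induction S using Finset.induction_on with
  | empty => simpa using Observable.const (∅ : Finset (ℤ × ℤ))
  | insert w S hw ih =>
    simp only [Finset.filter_insert]
    exact .ite (observable_inBlock b w.1 w.2) (ih.map (insert w)) ih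

/-- Register `10` is exempt because the block update overwrites it before moving on. -/
theorem moveStep_reg_congr {s s' : RamState} (h : ∀ x < 12, x ≠ 10 → s'.reg x = s.reg x)
    (x : ℕ) (hx : x < 12) (h10 : x ≠ 10) : (moveStep b s').reg x = (moveStep b s).reg x := by
  obtain ⟨a3, a4, a5, a6, a7, a8, a9, a11, a⟩ := moveStep_reg b s
  obtain ⟨a3', a4', a5', a6', a7', a8', a9', a11', a'⟩ := moveStep_reg b s'
  have k : ∀ x ∈ [0, 1, 3, 4, 5, 6, 7, 8, 9], s'.reg x = s.reg x := fun x hx =>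
    h x (by simp at hx; omega) (by rintro rfl; simp at hx)
  simp only [List.mem_cons, List.not_mem_nil, or_false, forall_eq_or_imp, forall_eq] at k
  obtain ⟨k0, k1, k3, k4, k5, k6, k7, k8, k9⟩ := k
  by_cases hx3 : x < 3
  · rw [a x (Or.inl hx3), a' x (Or.inl hx3), h x hx h10]
  · have : x = 3 ∨ x = 4 ∨ x = 5 ∨ x = 6 ∨ x = 7 ∨ x = 8 ∨ x = 9 ∨ x = 11 := by omega
    rcases this with rfl | rfl | rfl | rfl | rfl | rfl | rfl | rfl
    · rw [a3, a3', k1, k3, k7]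
    · rw [a4, a4', k1, k4, k7]
    · rw [a5, a5', k1, k5, k7, k8]
    · rw [a6, a6', k1, k6, k7]
    · rw [a7, a7', k1, k7]
    · rw [a8, a8', k1, k7, k8]
    · rw [a9, a9', k9]
    · rw [a11, a11', a7, a7', a3, a3', k0, k1, k3, k7]

/-- The update for a block with the cells `F`, labels `lab` and costs `k`, `k'`. -/
theorem exists_blockUpdate (F : Finset (ℤ × ℤ)) (lab : ℤ × ℤ → ℤˣ) (k k' : ℕ) (o : ℤ × ℤ) :
    ∃ f : RamState → RamState, Computes f ∧ ∀ s,
    (∀ x, x ≠ 10 → x ≠ 17 → (f s).reg x = (moveStep b s).reg x) ∧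
    (f s).reg 10 = lab o ∧
    (∀ a, a ≠ 3 → a ≠ 4 → a ≠ 5 → (f s).arr a = s.arr a) ∧
    (∀ i, (f s).arr 4 i = if i = s.reg 9 then (k : ℤ) else s.arr 4 i) ∧
    (∀ i, (f s).arr 5 i = if i = s.reg 9 then (k' : ℤ) else s.arr 5 i) ∧
    (∀ z, (∀ w ∈ F, cellAddress s w.1 w.2 ≠ z) → (f s).arr 3 z = s.arr 3 z) ∧
    ∀ z, (∃ w ∈ F, cellAddress s w.1 w.2 = z) →
      ∃ w ∈ F, cellAddress s w.1 w.2 = z ∧ (f s).arr 3 z = lab w * s.arr 6 (s.reg 9) := by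
  obtain ⟨put, hputc, hputs⟩ := Computes.exists_puts F.toList 3 (fun _ => True)
    (fun w s => cellAddress s w.1 w.2)
    (fun w s => (lab w : ℤ) * s.reg 17) (fun w => evaluable_cellAddress w.1 w.2)
    (fun w => (Evaluable.reg 17).const_mul _)
    (fun w s s' h => by simp only [cellAddress, h]) (fun w s s' h => by simp only [h])
  -- The sign of the block is first copied to register `17`, so that the values stored in array `3`
  -- depend on registers only.
  refine ⟨moveStep b ∘ (fun s => s.set 10 (lab o)) ∘ (fun s => s.put 5 (s.reg 9) k') ∘
      (fun s => s.put 4 (s.reg 9) k) ∘ put ∘ fun s => s.set 17 (s.arr 6 (s.reg 9)),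
    .comp' (computes_moveStep b) <| .comp' (.set 10 (.const _)) <|
      .comp' (.put 5 (.reg 9) (.const _)) <| .comp' (.put 4 (.reg 9) (.const _)) <|
      .comp' hputc (.set 17 ((Evaluable.reg 9).read 6)), fun s => ?_⟩
  simp only [Function.comp_apply]
  obtain ⟨s₁, hs₁⟩ : ∃ s₁, s₁ = s.set 17 (s.arr 6 (s.reg 9)) := ⟨_, rfl⟩
  rw [← hs₁]
  obtain ⟨p1, p2, p3, p4⟩ := hputs s₁
  generalize put s₁ = s₂ at *
  have hr : ∀ x, x ≠ 17 → s₂.reg x = s.reg x := fun x hx => by rw [p1]; simp [hs₁, hx]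
  have ha : ∀ x y, cellAddress s₁ x y = cellAddress s x y := fun x y => by
    simp [cellAddress, hs₁]
  have hr1 : s₁.reg 17 = s.arr 6 (s.reg 9) := by simp [hs₁]
  have ha1 : s₁.arr = s.arr := by rw [hs₁, RamState.set_arr]
  rw [ha1] at p2 p3
  simp only [ha, Finset.mem_toList, forall_const, true_and, hr1] at p3 p4
  simp only [moveStep_arr, RamState.set_arr, RamState.put_reg, hr 9 (by norm_num)]
  have e3 : ((s₂.put 4 (s.reg 9) k).put 5 (s.reg 9) k').arr 3 = s₂.arr 3 := by
    rw [RamState.put_arr_of_ne _ (by norm_num), RamState.put_arr_of_ne _ (by norm_num)]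
  rw [e3]
  refine ⟨fun x h10 h17 => ?_, ?_, fun a h3 h4 h5 => ?_, fun i => ?_, fun i => ?_, p3, p4⟩
  · by_cases hx : x < 12
    · refine moveStep_reg_congr b (fun y hy hy' => ?_) x hx h10
      simp [hy', hr y (by omega)]
    · rw [(moveStep_reg b _).2.2.2.2.2.2.2.2 x (by omega),
        (moveStep_reg b s).2.2.2.2.2.2.2.2 x (by omega)]
      simp [h10, hr x h17]
  · rw [(moveStep_reg b _).2.2.2.2.2.2.2.2 10 (by simp)]
    simp
  · rw [RamState.put_arr_of_ne _ h5, RamState.put_arr_of_ne _ h4, p2 a h3]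
  · rw [RamState.put_arr_of_ne _ (by norm_num), RamState.put_arr_same, p2 4 (by norm_num)]
  · rw [RamState.put_arr_same, RamState.put_arr_of_ne _ (by norm_num), p2 5 (by norm_num)]

open Classical in
/-- `step` treats one block: its costs are stored in the arrays `4` and `5`, its labels, multiplied
by the sign of the block in array `6`, in array `3`. -/
structure IsBlockStep (step : RamState → RamState) : Prop where
  reg : ∀ s x, x ≠ 10 → x ≠ 17 → (step s).reg x = (moveStep b s).reg x
  shared : ∀ s, (step s).reg 10 = windowLabel b s (sharedOffset b s)
  arr : ∀ s a, a ≠ 3 → a ≠ 4 → a ≠ 5 → (step s).arr a = s.arr a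
  cost_pos : ∀ s i, (step s).arr 4 i = if i = s.reg 9 then (windowCost b s 1 : ℤ) else s.arr 4 i
  cost_neg : ∀ s i, (step s).arr 5 i = if i = s.reg 9 then (windowCost b s (-1) : ℤ) else s.arr 5 i
  output_of_ne : ∀ s z, (∀ w ∈ window.filter fun w => InBlock b s w.1 w.2,
    cellAddress s w.1 w.2 ≠ z) → (step s).arr 3 z = s.arr 3 z
  output : ∀ s z, (∃ w ∈ window.filter fun w => InBlock b s w.1 w.2, cellAddress s w.1 w.2 = z) →
    ∃ w ∈ window.filter fun w => InBlock b s w.1 w.2, cellAddress s w.1 w.2 = z ∧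
      (step s).arr 3 z = windowLabel b s w * s.arr 6 (s.reg 9)

/-- For every possible outcome of the observations there is a fixed straight-line update;
observability selects the right one in bounded time. -/
theorem exists_isBlockStep : ∃ step, Computes step ∧ IsBlockStep b step := by
  choose f hf hs using exists_blockUpdate b
  have h := (observable_window_filter b) (fun F s => f F (windowLabel b s) (windowCost b s 1)
    (windowCost b s (-1)) (sharedOffset b s) s) fun F => (observable_windowLabel b) (fun lab s =>
      f F lab (windowCost b s 1) (windowCost b s (-1)) (sharedOffset b s) s) fun lab =>
    (observable_windowCost b 1) (fun k s => f F lab k (windowCost b s (-1)) (sharedOffset b s) s)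
      fun k => (observable_windowCost b (-1)) (fun k' s => f F lab k k' (sharedOffset b s) s)
      fun k' => (observable_sharedOffset b) (fun o s => f F lab k k' o s)
      fun o => hf F lab k k' o
  exact ⟨_, h, fun s => (hs _ _ _ _ _ s).1, fun s => (hs _ _ _ _ _ s).2.1,
    fun s => (hs _ _ _ _ _ s).2.2.1, fun s => (hs _ _ _ _ _ s).2.2.2.1,
    fun s => (hs _ _ _ _ _ s).2.2.2.2.1, fun s => (hs _ _ _ _ _ s).2.2.2.2.2.1,
    fun s => (hs _ _ _ _ _ s).2.2.2.2.2.2⟩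

end BlockPass

/-! ### Registers and window offsets describe the geometry of the blocks. -/

section BlockGeometry

variable {c m b t : ℕ}

/-- The registers describe block `t`. -/
structure BlockState (c m b t : ℕ) (s : RamState) : Prop where
  height : s.reg 0 = c
  width : s.reg 1 = m
  strip : s.reg 3 = (3 * (t / (m - b + 3)) : ℕ)
  row : s.reg 4 = blockRow m b t
  col : s.reg 5 = blockCol m b t
  rowAddress : s.reg 6 = (blockRow m b t : ℤ) * m
  position : s.reg 7 = (t % (m - b + 3) : ℕ)
  parity : s.reg 8 = (t / (m - b + 3) % 2 : ℕ)
  index : s.reg 9 = t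
  guard : s.reg 11 = if t < c / 3 * (m - b + 3) - 2 then 1 else 0

/-- The loop guard in terms of quantities that the machine maintains; the number of blocks is a
product that it never computes. -/
theorem lt_numBags_iff : t < c / 3 * (m - b + 3) - 2 ↔
    (t % (m - b + 3) ≤ m - b ∧ 3 * (t / (m - b + 3)) + 3 ≤ c) ∨
      3 * (t / (m - b + 3)) + 6 ≤ c := by
  constructor
  · intro h
    have := zigzag_index h
    omega
  · generalize m - b = M
    have h1 := Nat.div_add_mod' t (M + 3)
    have h2 := Nat.mod_lt t (show 0 < M + 3 by omega)
    rintro (⟨h3, h4⟩ | h4)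
    · have := Nat.mul_le_mul_right (M + 3) (show t / (M + 3) + 1 ≤ c / 3 by omega)
      rw [add_mul] at this
      omega
    · have := Nat.mul_le_mul_right (M + 3) (show t / (M + 3) + 2 ≤ c / 3 by omega)
      rw [add_mul] at this
      omega

namespace BlockState

theorem congr {s s' : RamState} (h : BlockState c m b t s)
    (hr : ∀ x, x ≠ 10 → x ≠ 17 → s'.reg x = s.reg x) : BlockState c m b t s' where
  height := by rw [hr 0 (by norm_num) (by norm_num), h.height]
  width := by rw [hr 1 (by norm_num) (by norm_num), h.width]
  strip := by rw [hr 3 (by norm_num) (by norm_num), h.strip]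
  row := by rw [hr 4 (by norm_num) (by norm_num), h.row]
  col := by rw [hr 5 (by norm_num) (by norm_num), h.col]
  rowAddress := by rw [hr 6 (by norm_num) (by norm_num), h.rowAddress]
  position := by rw [hr 7 (by norm_num) (by norm_num), h.position]
  parity := by rw [hr 8 (by norm_num) (by norm_num), h.parity]
  index := by rw [hr 9 (by norm_num) (by norm_num), h.index]
  guard := by rw [hr 11 (by norm_num) (by norm_num), h.guard]

theorem move (hp : ZigzagParams c m b) {s : RamState} (h : BlockState c m b t s) :
    BlockState c m b (t + 1) (moveStep b s) := by
  obtain ⟨r3, r4, r5, r6, r7, r8, r9, r11, r⟩ := moveStep_reg b s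
  obtain ⟨h0, h1, h3, h4, h5, h6, h7, h8, h9, -⟩ := h
  have hbm : b ≤ m := by have := hp.three_le; have := hp.le_width; have := hp.block; omega
  have hM : (m : ℤ) - b = (m - b : ℕ) := by push_cast [hbm]; ring
  obtain ⟨g1, g2⟩ := block_step m b t
  have hN := lt_numBags_iff (c := c) (m := m) (b := b) (t := t + 1)
  have hd := div_mod_succ t (m - b + 3) (by omega)
  rw [h1, hM, h7] at r3 r4 r5 r6 r7 r8
  rw [h1, hM] at r11
  have q3 : (moveStep b s).reg 3 = (3 * ((t + 1) / (m - b + 3)) : ℕ) := by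
    rw [r3, h3]; split_ifs <;> omega
  have q7 : (moveStep b s).reg 7 = ((t + 1) % (m - b + 3) : ℕ) := by
    rw [r7]; split_ifs <;> omega
  refine ⟨by rw [r 0 (by simp), h0], by rw [r 1 (by simp), h1], q3, ?_, ?_, ?_, q7, ?_,
    by rw [r9, h9]; push_cast; rfl, ?_⟩
  · rw [r4, h4]
    split_ifs with h
    · rw [(g1 (by omega)).1]
    · rw [(g2 (by omega)).1]; push_cast; rfl
  · rw [r5, h5, h8]
    split_ifs with h h'
    · have := (g1 (by omega)).2.1 (by omega)
      omega
    · have := (g1 (by omega)).2.2 (by omega)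
      omega
    · rw [(g2 (by omega)).2]
  · rw [r6, h6]
    split_ifs with h
    · rw [(g1 (by omega)).1]
    · rw [(g2 (by omega)).1]; push_cast; ring
  · rw [r8, h8]
    split_ifs <;> omega
  · rw [r11, q3, q7, h0]
    refine if_congr ?_ rfl rfl
    rw [hN]
    omega

end BlockState

/-- The offset of `v` from the corner of block `t`. -/
def blockOffset (b t : ℕ) (v : Fin c × Fin m) : ℤ × ℤ :=
  ((v.1 : ℤ) - blockRow m b t, (v.2 : ℤ) - blockCol m b t)

namespace BlockState

variable {s : RamState}

theorem inBlock_iff (h : BlockState c m b t s) (hp : ZigzagParams c m b)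
    (ht : t < c / 3 * (m - b + 3) - 2) (x y : ℤ) : InBlock b s x y ↔
      0 ≤ x ∧ 0 ≤ y ∧ x < blockHeight c m b t ∧ y < b := by
  have hbm : b ≤ m := by have := hp.three_le; have := hp.le_width; have := hp.block; omega
  have hM : (m : ℤ) - b = (m - b : ℕ) := by push_cast [hbm]; ring
  have hb := block_bounds hp ht
  have hi := zigzag_index ht
  unfold InBlock
  rw [h.position, h.width, h.height, h.strip, h.row, hM]
  unfold blockHeight blockRow at *
  split_ifs at * <;> omega

theorem inBlock_offset_iff (h : BlockState c m b t s) (hp : ZigzagParams c m b)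
    (ht : t < c / 3 * (m - b + 3) - 2) (v : Fin c × Fin m) :
    InBlock b s (blockOffset b t v).1 (blockOffset b t v).2 ↔ InRect c m b t v := by
  rw [h.inBlock_iff hp ht]
  unfold blockOffset InRect
  simp only
  omega

theorem hasRight_offset_iff (h : BlockState c m b t s) (v : Fin c × Fin m) :
    HasRight s (blockOffset b t v).1 (blockOffset b t v).2 ↔ (v.2 : ℕ) + 1 < m := by
  unfold HasRight blockOffset
  rw [h.row, h.col, h.height, h.width]
  simp only
  omega

/-- Near block `t` only the boundaries above and below its own strip can matter. The upper one
belongs to the preceding strip, hence the opposite parity in `HasDown`. -/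
theorem hasDown_offset_iff (h : BlockState c m b t s) (hp : ZigzagParams c m b)
    (ht : t < c / 3 * (m - b + 3) - 2) {v v' : Fin c × Fin m} (h₁ : (v.1 : ℕ) + 1 = v'.1)
    (h₂ : (v.2 : ℕ) = v'.2) (hlo : blockRow m b t ≤ v.1 + 1)
    (hhi : (v.1 : ℕ) < blockRow m b t + blockHeight c m b t) :
    HasDown b s (blockOffset b t v).1 (blockOffset b t v).2 ↔ (zigzagGraph c m b).Adj v v' := by
  rw [zigzag_adj_down_iff h₁ h₂, isTurnColumn_iff]
  have hi := zigzag_index ht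
  have hb := block_bounds hp ht
  have hv := v.1.2
  have hv' := v'.1.2
  have hw := v.2.2
  have hk := Nat.mod_lt t (show 0 < m - b + 3 by omega)
  unfold HasDown blockOffset
  rw [h.row, h.col, h.height, h.width, h.parity, h.strip]
  have e1 : (blockRow m b t : ℤ) + ((v.1 : ℤ) - blockRow m b t) = (v.1 : ℕ) := by ring
  have e2 : (blockCol m b t : ℤ) + ((v.2 : ℤ) - blockCol m b t) = (v.2 : ℕ) := by ring
  simp only [e1, e2]
  unfold blockHeight blockRow stripOf at *
  rw [← h₁] at hv' ⊢
  clear e1 e2 h₁ h₂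
  generalize (v.1 : ℕ) = r at *
  generalize (v.2 : ℕ) = j at *
  generalize t / (m - b + 3) = a at *
  generalize t % (m - b + 3) = k at *
  rcases Nat.lt_or_ge (r + 1) (3 * a) with g | g
  · omega
  · rcases Nat.lt_or_ge (3 * a) (r + 1) with g' | g'
    · have e3 : ¬ ((r : ℤ) = ((3 * a : ℕ) : ℤ) - 1) := by omega
      simp only [e3, false_imp_iff, true_and]
      split_ifs at hhi hb <;> omega
    · omega

theorem inExt_offset_iff (h : BlockState c m b t s) (hp : ZigzagParams c m b)
    (ht : t < c / 3 * (m - b + 3) - 2) (v : Fin c × Fin m) :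
    InExt b s (blockOffset b t v).1 (blockOffset b t v).2 ↔
      InRect c m b t v ∨ ∃ u, InRect c m b t u ∧ (zigzagGraph c m b).Adj u v := by
  have hoff : ∀ (u : Fin c × Fin m) (i j : ℤ), (u.1 : ℤ) = v.1 + i → (u.2 : ℤ) = v.2 + j →
      blockOffset b t u = ((blockOffset b t v).1 + i, (blockOffset b t v).2 + j) := by
    intro u i j h1 h2
    unfold blockOffset
    rw [h1, h2]
    ext <;> simp only <;> ring
  have hup : ∀ u : Fin c × Fin m, (u.1 : ℕ) + 1 = v.1 → (u.2 : ℕ) = v.2 →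
      (InBlock b s ((blockOffset b t v).1 - 1) (blockOffset b t v).2 ∧
        HasDown b s ((blockOffset b t v).1 - 1) (blockOffset b t v).2 ↔
        InRect c m b t u ∧ (zigzagGraph c m b).Adj u v) := by
    intro u h1 h2
    have e := hoff u (-1) 0 (by omega) (by omega)
    have e1 : (blockOffset b t v).1 - 1 = (blockOffset b t u).1 := by rw [e]; ring
    have e2 : (blockOffset b t v).2 = (blockOffset b t u).2 := by rw [e]; ring
    rw [e1, e2, h.inBlock_offset_iff hp ht]
    refine and_congr_right fun hu => h.hasDown_offset_iff hp ht h1 h2 ?_ ?_ <;>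
      unfold InRect at hu <;> omega
  have hdown : ∀ u : Fin c × Fin m, (v.1 : ℕ) + 1 = u.1 → (v.2 : ℕ) = u.2 →
      (InBlock b s ((blockOffset b t v).1 + 1) (blockOffset b t v).2 ∧
        HasDown b s (blockOffset b t v).1 (blockOffset b t v).2 ↔
        InRect c m b t u ∧ (zigzagGraph c m b).Adj u v) := by
    intro u h1 h2
    have e := hoff u 1 0 (by omega) (by omega)
    have e1 : (blockOffset b t v).1 + 1 = (blockOffset b t u).1 := by rw [e]
    have e2 : (blockOffset b t v).2 = (blockOffset b t u).2 := by rw [e]; ring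
    rw [e1]
    nth_rewrite 1 [e2]
    rw [h.inBlock_offset_iff hp ht, SimpleGraph.adj_comm]
    refine and_congr_right fun hu => h.hasDown_offset_iff hp ht h1 h2 ?_ ?_ <;>
      unfold InRect at hu <;> omega
  have hleft : ∀ u : Fin c × Fin m, (u.1 : ℕ) = v.1 → (u.2 : ℕ) + 1 = v.2 →
      (InBlock b s (blockOffset b t v).1 ((blockOffset b t v).2 - 1) ∧
        HasRight s (blockOffset b t v).1 ((blockOffset b t v).2 - 1) ↔ InRect c m b t u) := by
    intro u h1 h2
    have e := hoff u 0 (-1) (by omega) (by omega)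
    have e1 : (blockOffset b t v).1 = (blockOffset b t u).1 := by rw [e]; ring
    have e2 : (blockOffset b t v).2 - 1 = (blockOffset b t u).2 := by rw [e]; ring
    rw [e1, e2, h.inBlock_offset_iff hp ht, h.hasRight_offset_iff]
    exact and_iff_left (by omega)
  have hright : ∀ u : Fin c × Fin m, (v.1 : ℕ) = u.1 → (v.2 : ℕ) + 1 = u.2 →
      (InBlock b s (blockOffset b t v).1 ((blockOffset b t v).2 + 1) ∧
        HasRight s (blockOffset b t v).1 (blockOffset b t v).2 ↔ InRect c m b t u) := by
    intro u h1 h2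
    have e := hoff u 0 1 (by omega) (by omega)
    have e1 : (blockOffset b t v).1 = (blockOffset b t u).1 := by rw [e]; ring
    have e2 : (blockOffset b t v).2 + 1 = (blockOffset b t u).2 := by rw [e]
    have := h.inBlock_offset_iff hp ht u
    rw [h.hasRight_offset_iff, e2, e1, this]
    exact and_iff_left (by omega)
  have hv1 := v.1.2
  have hv2 := v.2.2
  unfold InExt
  rw [h.inBlock_offset_iff hp ht]
  constructor
  · rintro (h1 | h1 | h1 | h1 | h1)
    · exact Or.inl h1
    · have := h1.2
      unfold HasDown blockOffset at this
      rw [h.row] at this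
      obtain ⟨u, g1, g2⟩ := exists_vertex (c := c) (m := m) (r := v.1 - 1) (j := v.2)
        (by omega) hv2
      exact Or.inr ⟨u, (hup u (by simp only at this; omega) g2).1 h1⟩
    · have := h1.2
      unfold HasDown blockOffset at this
      rw [h.row, h.height] at this
      obtain ⟨u, g1, g2⟩ := exists_vertex (c := c) (m := m) (r := v.1 + 1) (j := v.2)
        (by simp only at this; omega) hv2
      exact Or.inr ⟨u, (hdown u g1.symm g2.symm).1 h1⟩
    · have := h1.2
      unfold HasRight blockOffset at this
      rw [h.col] at this
      obtain ⟨u, g1, g2⟩ := exists_vertex (c := c) (m := m) (r := v.1) (j := v.2 - 1)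
        hv1 (by omega)
      have g3 : (u.2 : ℕ) + 1 = v.2 := by simp only at this; omega
      exact Or.inr ⟨u, (hleft u g1 g3).1 h1, zigzag_adj_right g1 g3⟩
    · have := h1.2
      unfold HasRight blockOffset at this
      rw [h.col, h.width] at this
      obtain ⟨u, g1, g2⟩ := exists_vertex (c := c) (m := m) (r := v.1) (j := v.2 + 1)
        hv1 (by simp only at this; omega)
      exact Or.inr ⟨u, (hright u g1.symm g2.symm).1 h1,
        (zigzag_adj_right g1.symm g2.symm).symm⟩
  · rintro (h1 | ⟨u, hu, huv⟩)
    · exact Or.inl h1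
    · rcases (grid_adj_iff u v).1 huv.1 with ⟨g1, g2 | g2⟩ | ⟨g1, g2 | g2⟩
      · exact Or.inr (Or.inr (Or.inr (Or.inl ((hleft u g1 g2).2 hu))))
      · exact Or.inr (Or.inr (Or.inr (Or.inr ((hright u g1.symm g2).2 hu))))
      · exact Or.inr (Or.inl ((hup u g2 g1).2 ⟨hu, huv⟩))
      · exact Or.inr (Or.inr (Or.inl ((hdown u g2 g1.symm).2 ⟨hu, huv⟩)))

/-- Cells of the extended block are vertices of the grid and lie in the window. -/
theorem exists_of_inExt (h : BlockState c m b t s) (hp : ZigzagParams c m b)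
    (ht : t < c / 3 * (m - b + 3) - 2) {x y : ℤ} (hxy : InExt b s x y) :
    ∃ v : Fin c × Fin m, blockOffset b t v = (x, y) := by
  have hb := block_bounds hp ht
  have : 0 ≤ (blockRow m b t : ℤ) + x ∧ (blockRow m b t : ℤ) + x < c ∧
      0 ≤ (blockCol m b t : ℤ) + y ∧ (blockCol m b t : ℤ) + y < m := by
    unfold InExt at hxy
    simp only [h.inBlock_iff hp ht, HasDown, HasRight, h.row, h.col, h.height, h.width] at hxy
    omega
  obtain ⟨v, h1, h2⟩ := exists_vertex (c := c) (m := m) (r := (blockRow m b t + x).toNat)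
    (j := (blockCol m b t + y).toNat) (by omega) (by omega)
  refine ⟨v, ?_⟩
  unfold blockOffset
  ext <;> simp only <;> omega

theorem mem_window_of_inExt (h : BlockState c m b t s) (hp : ZigzagParams c m b)
    (ht : t < c / 3 * (m - b + 3) - 2) {x y : ℤ} (hxy : InExt b s x y) : (x, y) ∈ window := by
  have hb := block_bounds hp ht
  have hb' := hp.block
  unfold InExt at hxy
  simp only [h.inBlock_iff hp ht] at hxy
  simp only [window, Finset.mem_product, Finset.mem_Icc]
  omega

theorem cellAddress_offset (h : BlockState c m b t s) (v : Fin c × Fin m) :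
    cellAddress s (blockOffset b t v).1 (blockOffset b t v).2 = gridAddress v := by
  unfold cellAddress blockOffset gridAddress
  rw [h.rowAddress, h.col, h.width]
  simp only
  ring

end BlockState

theorem blockOffset_injective : Function.Injective (blockOffset (c := c) (m := m) b t) := by
  intro u v h
  unfold blockOffset at h
  simp only [Prod.mk.injEq] at h
  exact vertex_ext (by omega) (by omega)

theorem gridAddress_injective : Function.Injective (gridAddress (c := c) (m := m)) := by
  intro u v h
  unfold gridAddress at h
  have hu := u.2.2
  have hv := v.2.2
  have h1 : (u.1 : ℕ) * m + u.2 = v.1 * m + v.2 := by exact_mod_cast h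
  have h2 := congrArg (· / m) h1
  have h3 := congrArg (· % m) h1
  simp only [Nat.mul_add_mod', Nat.mod_eq_of_lt hu, Nat.mod_eq_of_lt hv] at h3
  have h4 : ∀ k l : ℕ, l < m → (k * m + l) / m = k := fun k l hl => by
    rw [mul_comm, Nat.mul_add_div (by omega), Nat.div_eq_of_lt hl, add_zero]
  simp only [h4 _ _ hu, h4 _ _ hv] at h2
  exact vertex_ext h2 h3

end BlockGeometry

/-! ### Window computations agree with the decoder's local quantities. -/

section BlockLabels

variable {c m b L : ℕ} {X : (grid c m).edgeSet → ℤˣ} {Z : Fin c × Fin m → ℤˣ} {s : RamState}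
  {t : Fin (zigzagDecomposition c m b).numBags}

namespace BlockState

theorem inExt_offset_iff_mem (h : BlockState c m b t s) (hp : ZigzagParams c m b)
    (v : Fin c × Fin m) : InExt b s (blockOffset b t v).1 (blockOffset b t v).2 ↔
      v ∈ (zigzagDecomposition c m b).ext t := by
  rw [mem_zigzag_ext hp, h.inExt_offset_iff hp t.2]

theorem blockOffset_mem_window (h : BlockState c m b t s) (hp : ZigzagParams c m b)
    {v : Fin c × Fin m} (hv : v ∈ (zigzagDecomposition c m b).ext t) :
    blockOffset b t v ∈ window :=
  h.mem_window_of_inExt hp t.2 ((h.inExt_offset_iff_mem hp v).2 hv)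

open Classical in
-- A bijection between violated edges and pairs of a direction and a cell: each edge is stored at
-- its left or upper end.
theorem localDisagreement_eq (h : BlockState c m b t s) (hp : ZigzagParams c m b)
    (hE : EncodesInput c m L X Z s) (y : Fin c × Fin m → ℤˣ) (β : ℤ × ℤ → ℤˣ)
    (hβ : ∀ v ∈ (zigzagDecomposition c m b).ext t, y v = β (blockOffset b t v)) :
    (zigzagDecomposition c m b).localDisagreement X t y = windowDisagreement b s β := by
  let T : Finset (Bool × ℤ × ℤ) := (Finset.univ ×ˢ window).filter fun z =>
    if z.1 then (HasRight s z.2.1 z.2.2 ∧ InExt b s z.2.1 z.2.2 ∧ InExt b s z.2.1 (z.2.2 + 1)) ∧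
      β z.2 * β (z.2.1, z.2.2 + 1) ≠ signOf (s.arr 0 (cellAddress s z.2.1 z.2.2))
    else (HasDown b s z.2.1 z.2.2 ∧ InExt b s z.2.1 z.2.2 ∧ InExt b s (z.2.1 + 1) z.2.2) ∧
      β z.2 * β (z.2.1 + 1, z.2.2) ≠ signOf (s.arr 1 (cellAddress s z.2.1 z.2.2))
  have hT : windowDisagreement b s β = T.card := by
    rw [Finset.card_filter, Finset.sum_product, Fintype.sum_bool, ← Finset.sum_add_distrib]
    rfl
  let Spec : Bool × ℤ × ℤ → (grid c m).edgeSet → Prop := fun z e =>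
    ∃ u v, e.1 = s(u, v) ∧ blockOffset b t u = z.2 ∧
      ((z.1 = true ∧ (u.1 : ℕ) = v.1 ∧ (u.2 : ℕ) + 1 = v.2) ∨
        (z.1 = false ∧ (u.1 : ℕ) + 1 = v.1 ∧ (u.2 : ℕ) = v.2))
  have hmem : ∀ z e, Spec z e → (z ∈ T ↔
      e.1 ∈ (zigzagDecomposition c m b).extEdges t ∧ edgeSign y e.1 ≠ X e) := by
    rintro ⟨d, z⟩ ⟨e, he⟩ ⟨u, v, rfl, hz, hd⟩
    simp only at hz hd
    subst hz
    have hext : s(u, v) ∈ (zigzagDecomposition c m b).extEdges t ↔ (zigzagGraph c m b).Adj u v ∧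
        u ∈ (zigzagDecomposition c m b).ext t ∧ v ∈ (zigzagDecomposition c m b).ext t := by
      change _ ∧ _ ↔ _
      simp only [Sym2.mem_iff, forall_eq_or_imp, forall_eq]
      rfl
    have hsign : edgeSign y s(u, v) = y u * y v := rfl
    rw [hext, hsign]
    simp only [T, Finset.mem_filter, Finset.mem_product, Finset.mem_univ, true_and]
    rcases hd with ⟨rfl, h1, h2⟩ | ⟨rfl, h1, h2⟩
    · have hoff : ((blockOffset b t u).1, (blockOffset b t u).2 + 1) = blockOffset b t v := by
        unfold blockOffset
        rw [← h1, ← h2]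
        push_cast
        ext <;> simp only
        ring
      have hv := h.inExt_offset_iff_mem hp v
      rw [← hoff] at hv
      rw [if_pos rfl, h.hasRight_offset_iff, h.inExt_offset_iff_mem hp, hv, hoff,
        h.cellAddress_offset, hE.horizontal u v he (Fin.ext h1) (Fin.lt_def.2 (by omega)),
        signOf_coe]
      have hadj : (zigzagGraph c m b).Adj u v := zigzag_adj_right h1 h2
      have hm : (u.2 : ℕ) + 1 < m := by have := v.2.2; omega
      constructor
      · rintro ⟨-, ⟨-, k2, k3⟩, k4⟩
        rw [hβ u k2, hβ v k3]
        exact ⟨⟨hadj, k2, k3⟩, k4⟩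
      · rintro ⟨⟨-, k2, k3⟩, k4⟩
        rw [hβ u k2, hβ v k3] at k4
        exact ⟨h.blockOffset_mem_window hp k2, ⟨hm, k2, k3⟩, k4⟩
    · have hoff : ((blockOffset b t u).1 + 1, (blockOffset b t u).2) = blockOffset b t v := by
        unfold blockOffset
        rw [← h1, ← h2]
        push_cast
        ext <;> simp only
        ring
      have hv := h.inExt_offset_iff_mem hp v
      rw [← hoff] at hv
      rw [if_neg (by simp), h.inExt_offset_iff_mem hp, hv, hoff,
        h.cellAddress_offset, hE.vertical u v he (Fin.ext h2) (Fin.lt_def.2 (by omega)),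
        signOf_coe]
      have hdown : u ∈ (zigzagDecomposition c m b).ext t → v ∈ (zigzagDecomposition c m b).ext t →
          (HasDown b s (blockOffset b t u).1 (blockOffset b t u).2 ↔
            (zigzagGraph c m b).Adj u v) := fun k2 k3 => by
        have b1 := zigzag_ext_bounds hp t k2
        have b2 := zigzag_ext_bounds hp t k3
        exact h.hasDown_offset_iff hp t.2 h1 h2 (by omega) (by omega)
      constructor
      · rintro ⟨-, ⟨k1, k2, k3⟩, k4⟩
        rw [hβ u k2, hβ v k3]
        exact ⟨⟨(hdown k2 k3).1 k1, k2, k3⟩, k4⟩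
      · rintro ⟨⟨k1, k2, k3⟩, k4⟩
        rw [hβ u k2, hβ v k3] at k4
        exact ⟨h.blockOffset_mem_window hp k2, ⟨(hdown k2 k3).2 k1, k2, k3⟩, k4⟩
  have hex : ∀ z ∈ T, ∃ e, Spec z e := by
    rintro ⟨d, x, y⟩ hz
    simp only [T, Finset.mem_filter] at hz
    cases d
    · rw [if_neg (by simp)] at hz
      obtain ⟨u, hu⟩ := h.exists_of_inExt hp t.2 hz.2.1.2.1
      obtain ⟨v, hv⟩ := h.exists_of_inExt hp t.2 hz.2.1.2.2
      unfold blockOffset at hu hv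
      simp only [Prod.mk.injEq] at hu hv
      have h1 : (u.1 : ℕ) + 1 = v.1 := by omega
      have h2 : (u.2 : ℕ) = v.2 := by omega
      exact ⟨⟨s(u, v), (grid_adj_iff u v).2 (Or.inr ⟨h2, Or.inl h1⟩)⟩, u, v, rfl,
        Prod.ext hu.1 hu.2, Or.inr ⟨rfl, h1, h2⟩⟩
    · rw [if_pos rfl] at hz
      obtain ⟨u, hu⟩ := h.exists_of_inExt hp t.2 hz.2.1.2.1
      obtain ⟨v, hv⟩ := h.exists_of_inExt hp t.2 hz.2.1.2.2
      unfold blockOffset at hu hv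
      simp only [Prod.mk.injEq] at hu hv
      have h1 : (u.1 : ℕ) = v.1 := by omega
      have h2 : (u.2 : ℕ) + 1 = v.2 := by omega
      exact ⟨⟨s(u, v), (grid_adj_iff u v).2 (Or.inl ⟨h1, Or.inl h2⟩)⟩, u, v, rfl,
        Prod.ext hu.1 hu.2, Or.inl ⟨rfl, h1, h2⟩⟩
  have hex' : ∀ e, ∃ z, Spec z e := by
    rintro ⟨e, he⟩
    induction e using Sym2.ind with
    | _ u v =>
    rcases (grid_adj_iff u v).1 he with ⟨g1, g2 | g2⟩ | ⟨g1, g2 | g2⟩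
    · exact ⟨(true, blockOffset b t u), u, v, rfl, rfl, Or.inl ⟨rfl, g1, g2⟩⟩
    · exact ⟨(true, blockOffset b t v), v, u, Sym2.eq_swap, rfl, Or.inl ⟨rfl, g1.symm, g2⟩⟩
    · exact ⟨(false, blockOffset b t u), u, v, rfl, rfl, Or.inr ⟨rfl, g2, g1⟩⟩
    · exact ⟨(false, blockOffset b t v), v, u, Sym2.eq_swap, rfl, Or.inr ⟨rfl, g2, g1.symm⟩⟩
  have hinj : ∀ z z' e, Spec z e → Spec z' e → z = z' := by
    rintro ⟨d, z⟩ ⟨d', z'⟩ e ⟨u, v, h1, h2, h3⟩ ⟨u', v', h1', h2', h3'⟩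
    simp only at h2 h2' h3 h3'
    rw [h1, Sym2.eq_iff] at h1'
    rcases h1' with ⟨rfl, rfl⟩ | ⟨rfl, rfl⟩
    · rw [← h2, ← h2']
      rcases h3 with h3 | h3 <;> rcases h3' with h3' | h3'
      · rw [h3.1, h3'.1]
      · omega
      · omega
      · rw [h3.1, h3'.1]
    · omega
  have huniq : ∀ z e e', Spec z e → Spec z e' → e = e' := by
    rintro ⟨d, z⟩ e e' ⟨u, v, h1, h2, h3⟩ ⟨u', v', h1', h2', h3'⟩
    simp only at h2 h2' h3 h3'
    obtain rfl := blockOffset_injective (h2.trans h2'.symm)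
    have : v = v' := by
      rcases h3 with h3 | h3 <;> rcases h3' with h3' | h3'
      · exact vertex_ext (by omega) (by omega)
      · have := h3.1.symm.trans h3'.1; simp at this
      · have := h3.1.symm.trans h3'.1; simp at this
      · exact vertex_ext (by omega) (by omega)
    exact Subtype.ext (by rw [h1, h1', this])
  rw [hT, ← Set.ncard_coe_finset]
  symm
  refine Set.ncard_congr (fun z hz => (hex z hz).choose) (fun z hz => ?_)
    (fun z z' hz hz' hzz => ?_) (fun e he => ?_)
  · exact (hmem z _ (hex z hz).choose_spec).1 hz
  · have := (hex z hz).choose_spec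
    rw [hzz] at this
    exact hinj _ _ _ this (hex z' hz').choose_spec
  · obtain ⟨z, hz⟩ := hex' e
    have hzT := (hmem z e hz).2 he
    exact ⟨z, hzT, huniq _ _ _ (hex z hzT).choose_spec hz⟩

/-- The labels of block `t` as a labeling of the grid. -/
noncomputable def _root_.blockLabeling (b t : ℕ) (s : RamState) (v : Fin c × Fin m) : ℤˣ :=
  windowLabel b s (blockOffset b t v)

/-- A grid labeling becomes a labeling of all offsets by inverting `blockOffset`, with arbitrary
values elsewhere; the disagreement sees only the extended block. Normalization on the shared vertex
multiplies by a global sign, which changes no edge product. -/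
theorem blockLabeling_isMin (h : BlockState c m b t s) (hp : ZigzagParams c m b)
    (hE : EncodesInput c m L X Z s) (y : Fin c × Fin m → ℤˣ) :
    (zigzagDecomposition c m b).localDisagreement X t (blockLabeling b t s) ≤
      (zigzagDecomposition c m b).localDisagreement X t y := by
  have : Nonempty (Fin c × Fin m) :=
    ⟨⟨0, by have := hp.three_le; omega⟩, ⟨0, by have := hp.three_le; have := hp.le_width; omega⟩⟩
  rw [h.localDisagreement_eq hp hE (blockLabeling b t s) (windowLabel b s) fun v _ => rfl,
    h.localDisagreement_eq hp hE y (fun z => y (Function.invFun (blockOffset b t) z)) fun v _ => by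
      rw [Function.leftInverse_invFun blockOffset_injective v]]
  have hsign : ∀ (a : ℤˣ) (β : ℤ × ℤ → ℤˣ),
      windowDisagreement b s (fun w => a * β w) = windowDisagreement b s β := by
    intro a β
    have : ∀ x y : ℤˣ, a * x * (a * y) = x * y := fun x y => by
      rw [mul_mul_mul_comm, Int.units_mul_self, one_mul]
    unfold windowDisagreement
    refine Finset.sum_congr rfl fun w _ => ?_
    rw [this, this]
  exact (hsign _ _).le.trans (Function.argmin_le _ _)

open Classical in
theorem windowCost_eq (h : BlockState c m b t s) (hp : ZigzagParams c m b)
    (hE : EncodesInput c m L X Z s) (a : ℤˣ) : windowCost b s a =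
      (((zigzagDecomposition c m b).bag t).filter fun v => a * blockLabeling b t s v ≠ Z v).card := by
  unfold windowCost
  rw [← Finset.card_filter]
  symm
  refine Finset.card_nbij (blockOffset b t) ?_ blockOffset_injective.injOn ?_
  · intro v hv
    rw [Finset.mem_coe, Finset.mem_filter] at hv ⊢
    refine ⟨h.blockOffset_mem_window hp (zigzag_bag_subset_ext hp t hv.1),
      (h.inBlock_offset_iff hp t.2 v).2 ((mem_zigzag_bag hp t v).1 hv.1), ?_⟩
    rw [h.cellAddress_offset, hE.side, signOf_coe]
    exact hv.2
  · rintro ⟨x, y⟩ hz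
    rw [Finset.mem_coe, Finset.mem_filter] at hz
    obtain ⟨v, hv⟩ := h.exists_of_inExt hp t.2 (Or.inl hz.2.1)
    refine ⟨v, ?_, hv⟩
    have h1 := hz.2.1
    have h2 := hz.2.2
    rw [← hv] at h1 h2
    rw [h.cellAddress_offset, hE.side, signOf_coe] at h2
    rw [Finset.mem_coe, Finset.mem_filter, mem_zigzag_bag hp]
    exact ⟨(h.inBlock_offset_iff hp t.2 v).1 h1, h2⟩

end BlockState

/-- In an even strip the corner of the new block is shared. In an odd strip the first column of a
block moved left is new, and the second one is shared because `b ≥ 2`. -/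
theorem exists_shared_vertex {t : ℕ} (hp : ZigzagParams c m b)
    (ht : t + 1 < c / 3 * (m - b + 3) - 2) : ∃ r : Fin c × Fin m,
      InRect c m b t r ∧ InRect c m b (t + 1) r ∧
      (r.1 : ℕ) = blockRow m b (t + 1) ∧
      (r.2 : ℕ) = blockCol m b (t + 1) + (t + 1) / (m - b + 3) % 2 := by
  have h1 := block_bounds hp (show t < c / 3 * (m - b + 3) - 2 by omega)
  have h2 := block_bounds hp ht
  have hb := hp.block
  obtain ⟨g1, g2⟩ := block_step m b t
  have hd := div_mod_succ t (m - b + 3) (by omega)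
  obtain ⟨r, hr1, hr2⟩ := exists_vertex (c := c) (m := m) (r := blockRow m b (t + 1))
    (j := blockCol m b (t + 1) + (t + 1) / (m - b + 3) % 2) (by omega) (by omega)
  refine ⟨r, ?_, ?_, hr1, hr2⟩ <;> unfold InRect <;> omega

theorem BlockState.sharedOffset_eq {t : ℕ} (h : BlockState c m b t s) (hp : ZigzagParams c m b)
    {r : Fin c × Fin m} (h1 : (r.1 : ℕ) = blockRow m b (t + 1))
    (h2 : (r.2 : ℕ) = blockCol m b (t + 1) + (t + 1) / (m - b + 3) % 2) :
    sharedOffset b s = blockOffset b t r := by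
  have hbm : b ≤ m := by have := hp.three_le; have := hp.le_width; have := hp.block; omega
  have hM : (m : ℤ) - b = (m - b : ℕ) := by push_cast [hbm]; ring
  obtain ⟨g1, g2⟩ := block_step m b t
  have hd := div_mod_succ t (m - b + 3) (by omega)
  unfold sharedOffset blockOffset
  rw [h.width, h.position, h.parity, hM, h1, h2]
  split_ifs <;> ext <;> simp only <;> omega

theorem BlockState.blockLabeling_shared {t : ℕ} (h : BlockState c m b t s) {r : Fin c × Fin m}
    (h1 : (r.1 : ℕ) = blockRow m b t)
    (h2 : (r.2 : ℕ) = blockCol m b t + t / (m - b + 3) % 2) :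
    blockLabeling b t s r = signOf (s.reg 10) := by
  have : blockOffset b t r = (0, if s.reg 8 = 0 then 0 else 1) := by
    unfold blockOffset
    rw [h.parity, h1, h2]
    split_ifs <;> ext <;> simp only <;> omega
  unfold blockLabeling windowLabel
  rw [this, mul_comm, ← mul_assoc, Int.units_mul_self, one_mul]

end BlockLabels

/-! ### Invariants of a full pass over the blocks. -/

section BlockLoop

/-- The states agree on all that the labels of the blocks depend on. -/
structure SameBlocks (s s' : RamState) : Prop where
  reg : ∀ x < 12, s'.reg x = s.reg x
  arr : ∀ a < 3, s'.arr a = s.arr a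

variable {b : ℕ}

namespace SameBlocks

variable {s s' : RamState}

theorem inBlock (h : SameBlocks s s') : InBlock b s' = InBlock b s := by
  unfold InBlock
  rw [h.reg 0 (by norm_num), h.reg 1 (by norm_num), h.reg 3 (by norm_num), h.reg 4 (by norm_num),
    h.reg 7 (by norm_num)]

theorem hasRight (h : SameBlocks s s') : HasRight s' = HasRight s := by
  unfold HasRight
  rw [h.reg 0 (by norm_num), h.reg 1 (by norm_num), h.reg 4 (by norm_num), h.reg 5 (by norm_num)]

theorem hasDown (h : SameBlocks s s') : HasDown b s' = HasDown b s := by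
  unfold HasDown
  rw [h.reg 0 (by norm_num), h.reg 1 (by norm_num), h.reg 3 (by norm_num), h.reg 4 (by norm_num),
    h.reg 5 (by norm_num), h.reg 8 (by norm_num)]

theorem cellAddress (h : SameBlocks s s') : cellAddress s' = cellAddress s := by
  unfold _root_.cellAddress
  rw [h.reg 1 (by norm_num), h.reg 5 (by norm_num), h.reg 6 (by norm_num)]

theorem windowLabel (h : SameBlocks s s') : windowLabel b s' = windowLabel b s := by
  have hE : InExt b s' = InExt b s := by
    unfold InExt
    rw [h.inBlock, h.hasDown, h.hasRight]
  have hD : windowDisagreement b s' = windowDisagreement b s := by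
    unfold windowDisagreement
    rw [hE, h.hasDown, h.hasRight, h.cellAddress, h.arr 0 (by norm_num), h.arr 1 (by norm_num)]
  unfold _root_.windowLabel
  rw [hD, h.reg 8 (by norm_num), h.reg 10 (by norm_num)]

theorem sharedOffset (h : SameBlocks s s') : sharedOffset b s' = sharedOffset b s := by
  unfold _root_.sharedOffset
  rw [h.reg 1 (by norm_num), h.reg 7 (by norm_num), h.reg 8 (by norm_num)]

/-- A second pass reproduces the labels of the first one although the working arrays have changed
meanwhile. -/
theorem step {step : RamState → RamState} (hstep : IsBlockStep b step) (h : SameBlocks s s') :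
    SameBlocks (step s) (step s') where
  reg x hx := by
    by_cases hx' : x = 10
    · subst hx'
      rw [hstep.shared, hstep.shared, h.windowLabel, h.sharedOffset]
    · rw [hstep.reg s x hx' (by omega), hstep.reg s' x hx' (by omega)]
      exact moveStep_reg_congr b (fun y hy _ => h.reg y hy) x hx hx'
  arr a ha := by
    rw [hstep.arr s a (by omega) (by omega) (by omega),
      hstep.arr s' a (by omega) (by omega) (by omega), h.arr a ha]

theorem iterate {step : RamState → RamState} (hstep : IsBlockStep b step) (h : SameBlocks s s')
    (n : ℕ) : SameBlocks (step^[n] s) (step^[n] s') := by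
  induction n with
  | zero => exact h
  | succ n ih =>
    rw [Function.iterate_succ_apply', Function.iterate_succ_apply']
    exact ih.step hstep

end SameBlocks

variable {c m L : ℕ} {X : (grid c m).edgeSet → ℤˣ} {Z : Fin c × Fin m → ℤˣ}

theorem EncodesInput.congr {s s' : RamState} (h : EncodesInput c m L X Z s)
    (hr : ∀ x < 3, s'.reg x = s.reg x) (ha : ∀ a < 3, s'.arr a = s.arr a) :
    EncodesInput c m L X Z s' where
  height := by rw [hr 0 (by norm_num), h.height]
  width := by rw [hr 1 (by norm_num), h.width]
  budget := by rw [hr 2 (by norm_num), h.budget]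
  horizontal := by rw [ha 0 (by norm_num)]; exact h.horizontal
  vertical := by rw [ha 1 (by norm_num)]; exact h.vertical
  side := by rw [ha 2 (by norm_num)]; exact h.side

namespace IsBlockStep

variable {step : RamState → RamState} {s : RamState}

theorem iterate_frame (hstep : IsBlockStep b step) (n : ℕ) :
    (∀ x, x < 3 ∨ (11 < x ∧ x ≠ 17) → (step^[n] s).reg x = s.reg x) ∧
    ∀ a, a ≠ 3 → a ≠ 4 → a ≠ 5 → (step^[n] s).arr a = s.arr a := by
  induction n with
  | zero => exact ⟨fun _ _ => rfl, fun _ _ _ _ => rfl⟩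
  | succ n ih =>
    rw [Function.iterate_succ_apply']
    refine ⟨fun x hx => ?_, fun a h3 h4 h5 => ?_⟩
    · rw [hstep.reg _ x (by omega) (by omega),
        (moveStep_reg b _).2.2.2.2.2.2.2.2 x (by omega), ih.1 x hx]
    · rw [hstep.arr _ a h3 h4 h5, ih.2 a h3 h4 h5]

theorem iterate_encodesInput (hstep : IsBlockStep b step) (hE : EncodesInput c m L X Z s) (n : ℕ) :
    EncodesInput c m L X Z (step^[n] s) :=
  hE.congr (fun x hx => (hstep.iterate_frame n).1 x (Or.inl hx))
    fun a ha => (hstep.iterate_frame n).2 a (by omega) (by omega) (by omega)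

theorem iterate_blockState (hstep : IsBlockStep b step) (hp : ZigzagParams c m b)
    (h : BlockState c m b 0 s) (n : ℕ) : BlockState c m b n (step^[n] s) := by
  induction n with
  | zero => exact h
  | succ n ih =>
    rw [Function.iterate_succ_apply']
    exact (ih.move hp).congr fun x h10 h17 => hstep.reg _ x h10 h17

theorem iterate_cost (hstep : IsBlockStep b step) (hp : ZigzagParams c m b)
    (h : BlockState c m b 0 s) (n : ℕ) : ∀ i < n,
    (step^[n] s).arr 4 (i : ℤ) = windowCost b (step^[i] s) 1 ∧
    (step^[n] s).arr 5 (i : ℤ) = windowCost b (step^[i] s) (-1) := by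
  induction n with
  | zero => intro i hi; omega
  | succ n ih =>
    intro i hi
    rw [Function.iterate_succ_apply', hstep.cost_pos, hstep.cost_neg,
      (hstep.iterate_blockState hp h n).index]
    by_cases hin : i = n
    · rw [hin, if_pos rfl, if_pos rfl]
      exact ⟨rfl, rfl⟩
    · rw [if_neg (by exact_mod_cast hin), if_neg (by exact_mod_cast hin)]
      exact ih i (by omega)

open Classical in
-- Later blocks overwrite earlier ones. The decoder may use any block containing the vertex, so it
-- suffices that the stored value comes from one of them; injectivity of addresses excludes writes
-- by other blocks.
theorem iterate_output (hstep : IsBlockStep b step) (hp : ZigzagParams c m b)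
    (h : BlockState c m b 0 s) (n : ℕ) (hn : n ≤ c / 3 * (m - b + 3) - 2) (v : Fin c × Fin m)
    (hv : ∃ i < n, InRect c m b i v) : ∃ i < n, InRect c m b i v ∧
      (step^[n] s).arr 3 (gridAddress v) = blockLabeling b i (step^[i] s) v * s.arr 6 (i : ℤ) := by
  induction n with
  | zero => obtain ⟨i, hi, -⟩ := hv; omega
  | succ n ih =>
    have hs := hstep.iterate_blockState hp h n
    have hcell : ∀ w : ℤ × ℤ, InBlock b (step^[n] s) w.1 w.2 →
        cellAddress (step^[n] s) w.1 w.2 = gridAddress v → w = blockOffset b n v := by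
      intro w hw hwv
      obtain ⟨u, hu⟩ := hs.exists_of_inExt hp (by omega) (Or.inl hw)
      rw [show w = (w.1, w.2) from rfl, ← hu] at hwv ⊢
      rw [hs.cellAddress_offset] at hwv
      rw [gridAddress_injective hwv]
    rw [Function.iterate_succ_apply']
    by_cases hvn : InRect c m b n v
    · have hB := (hs.inBlock_offset_iff hp (by omega) v).2 hvn
      obtain ⟨w, hw, hwv, hval⟩ := hstep.output (step^[n] s) (gridAddress v)
        ⟨blockOffset b n v, Finset.mem_filter.2
          ⟨hs.mem_window_of_inExt hp (by omega) (Or.inl hB), hB⟩, hs.cellAddress_offset v⟩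
      refine ⟨n, by omega, hvn, ?_⟩
      rw [hval, hcell w (Finset.mem_filter.1 hw).2 hwv, hs.index,
        (hstep.iterate_frame n).2 6 (by norm_num) (by norm_num) (by norm_num)]
      rfl
    · obtain ⟨i, hi, hvi⟩ := hv
      obtain ⟨j, hj, hvj, hval⟩ := ih (by omega) ⟨i, by
        rcases Nat.lt_succ_iff_lt_or_eq.1 hi with hi | rfl
        · exact hi
        · exact absurd hvi hvn, hvi⟩
      refine ⟨j, by omega, hvj, ?_⟩
      rw [← hval]
      refine hstep.output_of_ne _ _ fun w hw hwv => hvn ?_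
      have hw' := (Finset.mem_filter.1 hw).2
      rw [hcell w hw' hwv] at hw'
      exact (hs.inBlock_offset_iff hp (by omega) v).1 hw'

theorem iterate_shared (hstep : IsBlockStep b step) (hp : ZigzagParams c m b)
    (h : BlockState c m b 0 s) (n : ℕ) {r : Fin c × Fin m}
    (h1 : (r.1 : ℕ) = blockRow m b (n + 1))
    (h2 : (r.2 : ℕ) = blockCol m b (n + 1) + (n + 1) / (m - b + 3) % 2) :
    blockLabeling b (n + 1) (step^[n + 1] s) r = blockLabeling b n (step^[n] s) r := by
  rw [(hstep.iterate_blockState hp h (n + 1)).blockLabeling_shared h1 h2,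
    Function.iterate_succ_apply', hstep.shared, signOf_coe,
    (hstep.iterate_blockState hp h n).sharedOffset_eq hp h1 h2]
  rfl

end IsBlockStep

end BlockLoop

/-! ### The decoder program -/

section DecoderProgram

/-- The initialization of a pass over the blocks. -/
def passInit : RamState → RamState :=
  (fun s => s.set 11 1) ∘ (fun s => s.set 10 1) ∘ (fun s => s.set 9 0) ∘ (fun s => s.set 8 0) ∘
  (fun s => s.set 7 0) ∘ (fun s => s.set 6 0) ∘ (fun s => s.set 5 0) ∘ (fun s => s.set 4 0) ∘
  fun s => s.set 3 0

/-- The initialization of the table of path costs. -/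
def tableInit : RamState → RamState :=
  (fun s => s.set 15 0) ∘ (fun s => s.set 14 0) ∘ (fun s => s.set 13 0) ∘
  fun s => s.set 12 (s.reg 2 + 1)

/-- The initialization of the search for the optimal signs. -/
def traceInit : RamState → RamState :=
  (fun s => s.set 16 (if s.arr 7 (s.reg 13) ≤ s.arr 8 (s.reg 13) then 1 else -1)) ∘
  (fun s => s.set 14 (s.reg 2)) ∘ (fun s => s.set 15 (s.reg 15 - 1)) ∘
  fun s => s.set 13 (s.reg 13 - 1)

theorem computes_passInit : Computes passInit :=
  .comp' (.set 11 (.const 1)) <| .comp' (.set 10 (.const 1)) <| .comp' (.set 9 (.const 0)) <|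
  .comp' (.set 8 (.const 0)) <| .comp' (.set 7 (.const 0)) <| .comp' (.set 6 (.const 0)) <|
  .comp' (.set 5 (.const 0)) <| .comp' (.set 4 (.const 0)) (.set 3 (.const 0))

theorem computes_tableInit : Computes tableInit :=
  .comp' (.set 15 (.const 0)) <| .comp' (.set 14 (.const 0)) <| .comp' (.set 13 (.const 0))
    (.set 12 ((Evaluable.reg 2).add (.const 1)))

theorem computes_traceInit : Computes traceInit :=
  .comp' (.set 16 (.ite (((Evaluable.reg 13).read 7).le ((Evaluable.reg 13).read 8)) (.const 1)
    (.const (-1)))) <| .comp' (.set 14 (.reg 2)) <|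
    .comp' (.set 15 ((Evaluable.reg 15).sub (.const 1)))
      (.set 13 ((Evaluable.reg 13).sub (.const 1)))

theorem passInit_reg (s : RamState) (x : ℕ) (hx : x < 3 ∨ 11 < x) :
    (passInit s).reg x = s.reg x := by
  simp only [passInit, Function.comp_apply, RamState.set_reg]
  rw [if_neg (by omega), if_neg (by omega), if_neg (by omega), if_neg (by omega),
    if_neg (by omega), if_neg (by omega), if_neg (by omega), if_neg (by omega), if_neg (by omega)]

variable {c m b L : ℕ} {X : (grid c m).edgeSet → ℤˣ} {Z : Fin c × Fin m → ℤˣ}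

theorem passInit_encodesInput {s : RamState} (hE : EncodesInput c m L X Z s) :
    EncodesInput c m L X Z (passInit s) :=
  hE.congr (fun x hx => passInit_reg s x (Or.inl hx)) fun _ _ => rfl

theorem passInit_blockState (hp : ZigzagParams c m b) {s : RamState}
    (hE : EncodesInput c m L X Z s) : BlockState c m b 0 (passInit s) where
  height := (passInit_encodesInput hE).height
  width := (passInit_encodesInput hE).width
  strip := by simp [passInit]
  row := by simp [passInit, blockRow]
  col := by simp [passInit, blockCol]
  rowAddress := by simp [passInit, blockRow]
  position := by simp [passInit]
  parity := by simp [passInit]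
  index := by simp [passInit]
  guard := by rw [if_pos (show 0 < c / 3 * (m - b + 3) - 2 from numBags_pos hp)]; simp [passInit]

theorem passInit_sameBlocks {s s' : RamState} (hr : ∀ x < 3, s'.reg x = s.reg x)
    (ha : ∀ a < 3, s'.arr a = s.arr a) : SameBlocks (passInit s) (passInit s') where
  reg x hx := by
    simp only [passInit, Function.comp_apply, RamState.set_reg]
    by_cases h : x < 3
    · simp [hr x h]
    · have : x = 3 ∨ x = 4 ∨ x = 5 ∨ x = 6 ∨ x = 7 ∨ x = 8 ∨ x = 9 ∨ x = 10 ∨ x = 11 := by omega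
      rcases this with rfl | rfl | rfl | rfl | rfl | rfl | rfl | rfl | rfl <;> simp
  arr := ha

/-- The program resolves the arbitrary choices by the normalized block labels and their shared
vertices. Then every relative sign is 1, violations are sign changes, and the constrained
minimization is the one solved by dynamic programming. -/
theorem isDecoderOutput_of_signs (hp : ZigzagParams c m b) {step : RamState → RamState}
    (hstep : IsBlockStep b step) {s : RamState} (hs : BlockState c m b 0 s)
    (hE : EncodesInput c m L X Z s) {K : ℝ} (hK : 0 ≤ K) (hL : L = ⌊K⌋₊) (σ : ℕ → ℤˣ)
    (hσ : switches σ ((zigzagDecomposition c m b).numBags - 1) ≤ L)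
    (hmin : ∀ τ : ℕ → ℤˣ, switches τ ((zigzagDecomposition c m b).numBags - 1) ≤ L →
      ∑ i ∈ Finset.range (zigzagDecomposition c m b).numBags,
        windowCost b (step^[i] s) (σ i) ≤
      ∑ i ∈ Finset.range (zigzagDecomposition c m b).numBags, windowCost b (step^[i] s) (τ i))
    (y : Fin c × Fin m → ℤˣ)
    (hy : ∀ v, ∃ i < (zigzagDecomposition c m b).numBags, InRect c m b i v ∧
      y v = blockLabeling b i (step^[i] s) v * σ i) :
    IsDecoderOutput (zigzagDecomposition c m b) K X Z y := by
  classical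
  have hne : Nonempty (Fin c × Fin m) :=
    ⟨⟨0, by have := hp.three_le; omega⟩, ⟨0, by have := hp.three_le; have := hp.le_width; omega⟩⟩
  let P : Fin (zigzagDecomposition c m b).numBags → Fin c × Fin m → Prop := fun j r =>
    (r.1 : ℕ) = blockRow m b j ∧ (r.2 : ℕ) = blockCol m b j + (j : ℕ) / (m - b + 3) % 2
  -- The shared vertex must be a function of the unordered edge; the later of the two blocks,
  -- recovered as the supremum, determines it.
  let r : Sym2 (Fin (zigzagDecomposition c m b).numBags) → Fin c × Fin m := fun e =>
    Classical.epsilon (P e.sup)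
  have hrs : ∀ i j : Fin (zigzagDecomposition c m b).numBags, (i : ℕ) + 1 = j →
      r s(i, j) ∈ (zigzagDecomposition c m b).bag i ∧
      r s(i, j) ∈ (zigzagDecomposition c m b).bag j ∧
      blockLabeling b j (step^[j] s) (r s(i, j)) = blockLabeling b i (step^[i] s) (r s(i, j)) := by
    intro i j hij
    have hsup : (s(i, j) : Sym2 _).sup = j := by
      rw [Sym2.sup_mk]
      exact sup_eq_right.2 (Fin.le_def.2 (by omega))
    obtain ⟨v, h1, h2, h3, h4⟩ := exists_shared_vertex (t := i) hp (by rw [hij]; exact j.2)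
    rw [hij] at h2 h3 h4
    have hv : P j v := ⟨h3, h4⟩
    have hr : P j (r s(i, j)) := by
      have := Classical.epsilon_spec (p := P j) ⟨v, hv⟩
      simp only [r, hsup]
      exact this
    have hrv : r s(i, j) = v := vertex_ext (hr.1.trans hv.1.symm) (hr.2.trans hv.2.symm)
    rw [hrv, mem_zigzag_bag hp, mem_zigzag_bag hp, ← hij]
    rw [← hij] at h2 h3 h4
    exact ⟨h1, h2, hstep.iterate_shared hp hs i h3 h4⟩
  refine ⟨fun i => blockLabeling b i (step^[i] s), r, fun i => σ i, fun i y' =>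
    (hstep.iterate_blockState hp hs i).blockLabeling_isMin hp (hstep.iterate_encodesInput hE i) y',
    fun i j hij => ?_, ?_, fun v => ?_⟩
  · rcases SimpleGraph.pathGraph_adj.1 hij with h | h
    · exact ⟨(hrs i j h).1, (hrs i j h).2.1⟩
    · rw [Sym2.eq_swap]
      exact ⟨(hrs j i h).2.1, (hrs j i h).1⟩
  · have hS : ∀ i j, (SimpleGraph.pathGraph (zigzagDecomposition c m b).numBags).Adj i j →
        blockLabeling b i (step^[i] s) (r s(i, j)) * blockLabeling b j (step^[j] s) (r s(i, j)) =
          1 := by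
      intro i j hij
      rcases SimpleGraph.pathGraph_adj.1 hij with h | h
      · rw [(hrs i j h).2.2, Int.units_mul_self]
      · rw [Sym2.eq_swap, (hrs j i h).2.2, Int.units_mul_self]
    have hviol := violations_pathGraph _ hS
    have hcost : ∀ τ : ℕ → ℤˣ, ∑ i : Fin (zigzagDecomposition c m b).numBags,
        (((zigzagDecomposition c m b).bag i).filter fun v =>
          τ i * blockLabeling b i (step^[i] s) v ≠ Z v).card =
        ∑ i ∈ Finset.range (zigzagDecomposition c m b).numBags,
          windowCost b (step^[i] s) (τ i) := by
      intro τ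
      rw [Finset.sum_range]
      refine Finset.sum_congr rfl fun i _ => ?_
      rw [(hstep.iterate_blockState hp hs i).windowCost_eq hp (hstep.iterate_encodesInput hE i)]
    refine ⟨?_, fun τ hτ => ?_⟩
    · refine le_trans ?_ (Nat.floor_le hK)
      rw [← hL]
      exact_mod_cast (hviol σ).le.trans hσ
    · obtain ⟨τ', rfl⟩ : ∃ τ' : ℕ → ℤˣ,
          τ = fun i : Fin (zigzagDecomposition c m b).numBags => τ' i :=
        ⟨fun n => if h : n < _ then τ ⟨n, h⟩ else 1, by ext i; simp⟩
      -- The number of violations is an integer, so the real budget and its floor allow the same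
      -- sign vectors.
      have h1 : switches τ' ((zigzagDecomposition c m b).numBags - 1) ≤ L := by
        rw [← hviol τ', hL]
        exact Nat.le_floor hτ
      exact (hcost σ).le.trans ((hmin τ' h1).trans (hcost τ').ge)
  · obtain ⟨i, hi, h1, h2⟩ := hy v
    exact ⟨⟨i, hi⟩, (mem_zigzag_bag hp _ v).2 h1, by rw [h2, mul_comm]⟩

/-- Tracing back the table of path costs finds signs of least cost. -/
theorem exists_optimal_signs {cost : ℕ → ℤˣ → ℕ} {N : ℕ} (hN : 0 < N) {s : RamState}
    (h2 : s.reg 2 = L) (h12 : s.reg 12 = L + 1) (h13 : s.reg 13 = (N * (L + 1) : ℕ))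
    (h15 : s.reg 15 = N) (htab : HoldsTable cost L (N * (L + 1)) s) : ∃ σ : ℕ → ℤˣ,
      (∀ i < N, (traceStep^[N] (traceInit s)).arr 6 (i : ℤ) = σ i) ∧ switches σ (N - 1) ≤ L ∧
      ∀ τ : ℕ → ℤˣ, switches τ (N - 1) ≤ L →
        ∑ i ∈ Finset.range N, cost i (σ i) ≤ ∑ i ∈ Finset.range N, cost i (τ i) := by
  obtain ⟨n, rfl⟩ : ∃ n, N = n + 1 := ⟨N - 1, by omega⟩
  have hmul : (n + 1) * (L + 1) = n * (L + 1) + L + 1 := by ring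
  rw [hmul] at htab
  have e13 : s.reg 13 - 1 = ((n * (L + 1) + L : ℕ) : ℤ) := by rw [h13, hmul]; push_cast; ring
  obtain ⟨g7, g8⟩ := htab n L le_rfl (by omega)
  obtain ⟨a, ha⟩ : ∃ a : ℤˣ, a = if pathCost cost n L 1 ≤ pathCost cost n L (-1) then 1 else -1 :=
    ⟨_, rfl⟩
  have k16 : (traceInit s).reg 16 = (a : ℤ) := by
    have : (traceInit s).reg 16 = if s.arr 7 (s.reg 13 - 1) ≤ s.arr 8 (s.reg 13 - 1)
        then 1 else -1 := by simp [traceInit]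
    rw [this, e13, g7, g8, ha]
    simp only [Nat.cast_le]
    split_ifs <;> rfl
  obtain ⟨-, σ, q1, q2, q3, q4⟩ := traceStep_iterate_signs n L a (traceInit s) le_rfl
    (by simp [traceInit, h12]) (by rw [← e13]; simp [traceInit]) (by simp [traceInit, h2])
    (by simp [traceInit, h15]) k16 htab
  refine ⟨σ, fun i hi => q1 i (by omega), q4, fun τ hτ => ?_⟩
  rw [q3]
  refine le_trans ?_ (pathCost_le cost τ n L hτ)
  rw [ha]
  rcases Int.units_eq_one_or (τ n) with h | h <;> rw [h] <;> split_ifs <;> omega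

variable (b) in
/-- There is a program for the tree decomposition decoder on the zig-zag decomposition. -/
theorem exists_decoder_program : ∃ (P : RamProg) (T : ℕ), ∀ (c m L : ℕ)
    (X : (grid c m).edgeSet → ℤˣ) (Z : Fin c × Fin m → ℤˣ) (s : RamState) (K : ℝ),
    ZigzagParams c m b → EncodesInput c m L X Z s → 0 ≤ K → L = ⌊K⌋₊ →
    ∃ (s' : RamState) (t : ℕ) (y : Fin c × Fin m → ℤˣ), RamExec P s s' t ∧
      t ≤ T * ((zigzagDecomposition c m b).numBags * (L + 1) + 1) ∧ HoldsOutput s' y ∧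
      IsDecoderOutput (zigzagDecomposition c m b) K X Z y := by
  obtain ⟨step, hc, hstep⟩ := exists_isBlockStep b
  obtain ⟨P1, T1, h1⟩ := hc.exists_while (.var 11)
  obtain ⟨P2, T2, h2⟩ := computes_tableStep.exists_while (.sub (.var 9) (.var 15))
  obtain ⟨P3, T3, h3⟩ := computes_traceStep.exists_while (.add (.var 15) (.const 1))
  obtain ⟨I1, U1, i1⟩ := computes_passInit
  obtain ⟨I2, U2, i2⟩ := computes_tableInit
  obtain ⟨I3, U3, i3⟩ := computes_traceInit
  -- The pass over the blocks runs twice with the same code. The first run supplies the costs, and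
  -- its output is discarded, as array `6` does not yet hold the signs. The second run writes the
  -- labeling.
  refine ⟨.seq I1 (.seq P1 (.seq I2 (.seq P2 (.seq I3 (.seq P3 (.seq I1 P1)))))),
    2 * T1 + T2 + T3 + 2 * U1 + U2 + U3 + 7, fun c m L X Z s K hp hE hK hL => ?_⟩
  obtain ⟨N, hN⟩ : ∃ N, N = c / 3 * (m - b + 3) - 2 := ⟨_, rfl⟩
  have hN' : (zigzagDecomposition c m b).numBags = N := hN.symm
  have hN0 : 0 < N := by have := numBags_pos hp; omega
  have hguard : ∀ {u : RamState}, BlockState c m b 0 u → (∀ i < N, 0 < (step^[i] u).reg 11) ∧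
      (step^[N] u).reg 11 ≤ 0 := fun hu => by
    refine ⟨fun i hi => ?_, ?_⟩
    · rw [(hstep.iterate_blockState hp hu i).guard, if_pos (by omega)]; norm_num
    · rw [(hstep.iterate_blockState hp hu N).guard, if_neg (by omega)]
  set s₀ := passInit s with hs₀
  have hB₀ : BlockState c m b 0 s₀ := passInit_blockState hp hE
  have hE₀ : EncodesInput c m L X Z s₀ := passInit_encodesInput hE
  set s₁ := step^[N] s₀ with hs₁
  have hE₁ : EncodesInput c m L X Z s₁ := hstep.iterate_encodesInput hE₀ N
  have hcost := hstep.iterate_cost hp hB₀ N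
  set cost : ℕ → ℤˣ → ℕ := fun i a => windowCost b (step^[i] s₀) a with hcostdef
  set s₂ := tableInit s₁ with hs₂
  have f2 : ∀ x, x < 12 → s₂.reg x = s₁.reg x := fun x hx => by
    simp only [hs₂, tableInit, Function.comp_apply, RamState.set_reg]
    rw [if_neg (by omega), if_neg (by omega), if_neg (by omega), if_neg (by omega)]
  have f212 : s₂.reg 12 = L + 1 := by simp [hs₂, tableInit, hE₁.budget]
  have htable := fun n hn => tableStep_iterate (cost := cost) (N := N) (L := L) (s := s₂) f212
    (by simp [hs₂, tableInit]) (by simp [hs₂, tableInit]) (by simp [hs₂, tableInit])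
    (fun i hi => (hcost i hi).1) (fun i hi => (hcost i hi).2) n hn
  have f9 : ∀ n ≤ N * (L + 1), (tableStep^[n] s₂).reg 9 = N := fun n hn => by
    rw [(htable n hn).2.2.2.1 9 (by norm_num) (by norm_num) (by norm_num) (by norm_num)
      (by norm_num), f2 9 (by norm_num), (hstep.iterate_blockState hp hB₀ N).index]
  set s₃ := tableStep^[N * (L + 1)] s₂ with hs₃
  obtain ⟨k13, -, k15, kreg, karr, ktab⟩ := htable _ le_rfl
  rw [← hs₃] at k13 k15 kreg karr ktab
  rw [Nat.mul_div_cancel _ (by omega : 0 < L + 1)] at k15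
  have k9 : s₃.reg 9 = N := f9 _ le_rfl
  have k2 : s₃.reg 2 = L := by
    rw [kreg 2 (by norm_num) (by norm_num) (by norm_num) (by norm_num) (by norm_num),
      f2 2 (by norm_num), hE₁.budget]
  have k12 : s₃.reg 12 = L + 1 := by
    rw [kreg 12 (by norm_num) (by norm_num) (by norm_num) (by norm_num) (by norm_num), f212]
  obtain ⟨σ, hσ, hσL, hσmin⟩ := exists_optimal_signs hN0 k2 k12 k13 k15 ktab
  set s₄ := traceInit s₃ with hs₄
  have k415 : s₄.reg 15 = N - 1 := by simp [hs₄, traceInit, k15]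
  set s₅ := traceStep^[N] s₄ with hs₅
  obtain ⟨-, g5reg, g5arr⟩ := traceStep_iterate_reg N s₄
  have r5 : ∀ x < 3, s₅.reg x = s.reg x := fun x hx => by
    rw [g5reg x (by omega) (by omega) (by omega) (by omega)]
    have : s₄.reg x = s₃.reg x := by
      simp only [hs₄, traceInit, Function.comp_apply, RamState.set_reg]
      rw [if_neg (by omega), if_neg (by omega), if_neg (by omega), if_neg (by omega)]
    rw [this, kreg x (by omega) (by omega) (by omega) (by omega) (by omega), f2 x (by omega),
      (hstep.iterate_frame N).1 x (Or.inl hx), passInit_reg s x (Or.inl hx)]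
  have a5 : ∀ a < 3, s₅.arr a = s.arr a := fun a ha => by
    rw [g5arr a (by omega)]
    change s₃.arr a = _
    rw [karr a (by omega) (by omega)]
    exact (hstep.iterate_frame N).2 a (by omega) (by omega) (by omega)
  have hE₅ : EncodesInput c m L X Z s₅ := hE.congr r5 a5
  set s₆ := passInit s₅ with hs₆
  have hB₆ : BlockState c m b 0 s₆ := passInit_blockState hp hE₅
  have hsame := (passInit_sameBlocks r5 a5).iterate hstep
  set s₇ := step^[N] s₆ with hs₇
  obtain ⟨t0, ht0, x0⟩ := i1 s
  obtain ⟨t1, ht1, x1⟩ := h1 N s₀ (hguard hB₀).1 (hguard hB₀).2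
  obtain ⟨t2, ht2, x2⟩ := i2 s₁
  -- The guard compares the current row of the table with register `9`, where the first pass has
  -- left the number of blocks.
  obtain ⟨t3, ht3, x3⟩ := h2 (N * (L + 1)) s₂ (fun i hi => by
      have := (htable i hi.le).2.2.1
      have hlt : i / (L + 1) < N := Nat.div_lt_of_lt_mul (by rw [mul_comm]; omega)
      simp only [RamExpr.eval, f9 i hi.le, this]
      omega) (by simp only [RamExpr.eval, ← hs₃, k9, k15]; omega)
  obtain ⟨t4, ht4, x4⟩ := i3 s₃
  obtain ⟨t5, ht5, x5⟩ := h3 N s₄ (fun i hi => by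
      simp only [RamExpr.eval, (traceStep_iterate_reg i s₄).1, k415]
      omega) (by
      simp only [RamExpr.eval, (traceStep_iterate_reg N s₄).1, k415]
      omega)
  obtain ⟨t6, ht6, x6⟩ := i1 s₅
  obtain ⟨t7, ht7, x7⟩ := h1 N s₆ (hguard hB₆).1 (hguard hB₆).2
  have hout : ∀ v : Fin c × Fin m, ∃ i < N, InRect c m b i v ∧
      s₇.arr 3 (gridAddress v) = (blockLabeling b i (step^[i] s₀) v * σ i : ℤˣ) := by
    intro v
    obtain ⟨i₀, hi₀⟩ := (zigzag_isTreeDecomposition hp).vertex_mem v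
    obtain ⟨i, hi, hvi, hval⟩ := hstep.iterate_output hp hB₆ N hN.le v
      ⟨i₀, by rw [← hN']; exact i₀.2, (mem_zigzag_bag hp i₀ v).1 hi₀⟩
    refine ⟨i, hi, hvi, ?_⟩
    rw [hval]
    have e1 : s₆.arr 6 (i : ℤ) = σ i := hσ i hi
    have e2 : blockLabeling b i (step^[i] s₆) v = blockLabeling b i (step^[i] s₀) v := by
      unfold blockLabeling
      rw [(hsame i).windowLabel]
    rw [e1, e2]
    push_cast
    rfl
  refine ⟨s₇, _, fun v => signOf (s₇.arr 3 (gridAddress v)),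
    .seq x0 (.seq x1 (.seq x2 (.seq x3 (.seq x4 (.seq x5 (.seq x6 x7)))))), ?_, fun v => ?_, ?_⟩
  · rw [hN']
    have e1 : T1 * (N + 1) ≤ T1 * (N * (L + 1) + 1) :=
      Nat.mul_le_mul_left _ (by have := Nat.le_mul_of_pos_right N (by omega : 0 < L + 1); omega)
    have e3 : T3 * (N + 1) ≤ T3 * (N * (L + 1) + 1) :=
      Nat.mul_le_mul_left _ (by have := Nat.le_mul_of_pos_right N (by omega : 0 < L + 1); omega)
    have e4 : (2 * U1 + U2 + U3 + 7) ≤ (2 * U1 + U2 + U3 + 7) * (N * (L + 1) + 1) :=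
      Nat.le_mul_of_pos_right _ (by omega)
    have e5 : (2 * T1 + T2 + T3 + 2 * U1 + U2 + U3 + 7) * (N * (L + 1) + 1) =
      2 * (T1 * (N * (L + 1) + 1)) + T2 * (N * (L + 1) + 1) + T3 * (N * (L + 1) + 1) +
        (2 * U1 + U2 + U3 + 7) * (N * (L + 1) + 1) := by ring
    omega
  · obtain ⟨i, -, -, hval⟩ := hout v
    beta_reduce
    rw [hval, signOf_coe]
  · refine isDecoderOutput_of_signs hp hstep hB₀ hE₀ hK hL σ (by rw [hN']; exact hσL)
      (by rw [hN']; exact hσmin) _ fun v => ?_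
    obtain ⟨i, hi, hvi, hval⟩ := hout v
    exact ⟨i, by rw [hN']; exact hi, hvi, by rw [hval, signOf_coe]⟩

end DecoderProgram

/-! ### Final assembly. -/

theorem zigzagParams_of_le_sqrt {c m b : ℕ} (hb : b = 2 ∨ b = 3) (hc : 3 ≤ c)
    (h : (c : ℝ) ≤ √((c : ℝ) * m)) : ZigzagParams c m b := by
  refine ⟨hc, ?_, hb⟩
  have hc0 : (0 : ℝ) < c := by exact_mod_cast (by omega : 0 < c)
  have h1 : (c : ℝ) ^ 2 ≤ c * m := (Real.le_sqrt hc0.le (by positivity)).1 h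
  have h2 : (c : ℝ) ≤ m := le_of_mul_le_mul_left (by linarith) hc0
  exact_mod_cast h2

/-- There are at most `2 * n` blocks and the budget is `O(Q)`. As `Q ≥ log 2 > 1 / 2`, the additive
constants are absorbed as well. -/
theorem zigzag_running_time {c m b : ℕ} (hp : ZigzagParams c m b) {p δ : ℝ} (h0 : 0 < p)
    (h1 : p ≤ 1) (hδ : 0 < δ) (hδ1 : δ < 1) {t T : ℕ}
    (ht : t ≤ T * ((zigzagDecomposition c m b).numBags *
      (⌊(zigzagDecomposition c m b).budget p δ⌋₊ + 1) + 1)) :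
    (t : ℝ) ≤ 2 ^ 48 * T * (p ^ 2 * ((c : ℝ) * m) + Real.log (2 / δ)) * ((c : ℝ) * m) := by
  have hl := log_two_le_log_two_div hδ hδ1
  have hl2 := Real.log_two_gt_d9
  have hL := (Nat.floor_le (zigzag_budget_nonneg (c := c) (m := m) (b := b) h0 hδ hδ1)).trans
    (zigzag_budget_le hp h0 h1 hδ hδ1)
  have hN : ((zigzagDecomposition c m b).numBags : ℝ) + 2 ≤ 2 * ((c : ℝ) * m) := by
    exact_mod_cast zigzag_numBags_le hp
  have hN0 : (0 : ℝ) ≤ (zigzagDecomposition c m b).numBags := Nat.cast_nonneg _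
  have ht' : (t : ℝ) ≤ T * ((zigzagDecomposition c m b).numBags *
      ((⌊(zigzagDecomposition c m b).budget p δ⌋₊ : ℝ) + 1) + 1) := by exact_mod_cast ht
  have hp0 : 0 ≤ p ^ 2 * ((c : ℝ) * m) := by positivity
  set Q := p ^ 2 * ((c : ℝ) * m) + Real.log (2 / δ)
  set n := (c : ℝ) * m
  have hQ : 1 / 2 ≤ Q := by linarith
  have hb : ((zigzagDecomposition c m b).numBags : ℝ) *
      ((⌊(zigzagDecomposition c m b).budget p δ⌋₊ : ℝ) + 1) + 1 ≤ 2 * n * (2 ^ 41 * Q) := by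
    have h2 : (⌊(zigzagDecomposition c m b).budget p δ⌋₊ : ℝ) + 1 ≤ 2 ^ 41 * Q := by linarith
    have h3 := mul_le_mul_of_nonneg_left h2 hN0
    have h4 : ((zigzagDecomposition c m b).numBags + 2 : ℝ) * (2 ^ 41 * Q) ≤
        2 * n * (2 ^ 41 * Q) := mul_le_mul_of_nonneg_right hN (by linarith)
    linarith
  have hn : 0 ≤ n := by linarith
  have h5 : (T : ℝ) * (2 * n * (2 ^ 41 * Q)) ≤ 2 ^ 48 * T * Q * n := by
    have h6 : 0 ≤ (T : ℝ) * Q * n := by positivity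
    nlinarith
  exact ht'.trans ((mul_le_mul_of_nonneg_left hb (Nat.cast_nonneg T)).trans h5)

theorem mainTheorem5 :
    ∃ C c₀ : ℝ, 0 < C ∧ 0 < c₀ ∧
      -- upper bound, for blocks of two and of three columns
      (∀ b : ℕ, b = 2 ∨ b = 3 → ∃ P : RamProg, ∀ c m : ℕ, 3 ≤ c → (c : ℝ) ≤ √((c : ℝ) * m) →
        (zigzagDecomposition c m b).IsTreeDecomposition ∧
        (zigzagDecomposition c m b).IsAdmissible (grid c m) C ∧
        ∀ p q δ : ℝ, 0 < p → p < q → q < 1 / 2 → 0 < δ → δ < 1 →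
          -- error
          (∀ Y : Fin c × Fin m → ℤˣ,
            1 - δ ≤ (obsLaw (grid c m) p q Y).real
              {ω | ∀ y, IsDecoderOutput (zigzagDecomposition c m b)
                  ((zigzagDecomposition c m b).budget p δ) ω.1 ω.2 y →
                (hammingDist y Y : ℝ) ≤
                  C / (1 / 2 - q) ^ 2 * (p ^ 2 * ((c : ℝ) * m) + Real.log (2 / δ))
                    * Real.log (Real.exp 1 / p)}) ∧
          -- running time
          (∀ (X : (grid c m).edgeSet → ℤˣ) (Z : Fin c × Fin m → ℤˣ) (s : RamState),
            EncodesInput c m ⌊(zigzagDecomposition c m b).budget p δ⌋₊ X Z s →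
              ∃ (s' : RamState) (t : ℕ) (y : Fin c × Fin m → ℤˣ),
                RamExec P s s' t ∧
                (t : ℝ) ≤ C * (p ^ 2 * ((c : ℝ) * m) + Real.log (2 / δ)) * ((c : ℝ) * m) ∧
                HoldsOutput s' y ∧
                IsDecoderOutput (zigzagDecomposition c m b)
                  ((zigzagDecomposition c m b).budget p δ) X Z y)) ∧
      -- lower bound for height at least three
      (∀ c m : ℕ, 3 ≤ c → (c : ℝ) ≤ √((c : ℝ) * m) →
        ∀ p q : ℝ, 0 < p → p < q → q < 1 / 2 →
          ∀ est : Observation (grid c m) → PMF (Fin c × Fin m → ℤˣ),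
            ∃ Y : Fin c × Fin m → ℤˣ,
              c₀ * q * p ^ 2 * ((c : ℝ) * m) ≤ expectedError (grid c m) p q est Y) ∧
      -- lower bound for height one
      (∀ n : ℕ, 1 ≤ n → ∀ p q : ℝ, 0 < p → p < q → q < 1 / 2 →
          ∀ est : Observation (grid 1 n) → PMF (Fin 1 × Fin n → ℤˣ),
            ∃ Y : Fin 1 × Fin n → ℤˣ,
              c₀ * q * p * (n : ℝ) ≤ expectedError (grid 1 n) p q est Y) := by
  obtain ⟨P₂, T₂, h₂⟩ := exists_decoder_program 2
  obtain ⟨P₃, T₃, h₃⟩ := exists_decoder_program 3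
  -- One constant serves both block widths: `2 ^ 48` suffices for the error, and the time constants
  -- of the two programs enter for the running time. The value `1 / 4` comes from `(p / 2) ^ 2`, and
  -- `p / 2 ≥ p / 4` covers height one.
  refine ⟨2 ^ 48 * (T₂ + T₃ + 1), 1 / 4, by positivity, by norm_num, ?_, ?_, ?_⟩
  · have hC : (2 : ℝ) ^ 48 ≤ 2 ^ 48 * (T₂ + T₃ + 1) :=
      le_mul_of_one_le_right (by positivity) (le_add_of_nonneg_left (by positivity))
    intro b hb
    obtain ⟨P, T, hT, hP⟩ : ∃ (P : RamProg) (T : ℕ), T ≤ T₂ + T₃ ∧ ∀ (c m L : ℕ)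
        (X : (grid c m).edgeSet → ℤˣ) (Z : Fin c × Fin m → ℤˣ) (s : RamState) (K : ℝ),
        ZigzagParams c m b → EncodesInput c m L X Z s → 0 ≤ K → L = ⌊K⌋₊ →
        ∃ (s' : RamState) (t : ℕ) (y : Fin c × Fin m → ℤˣ), RamExec P s s' t ∧
          t ≤ T * ((zigzagDecomposition c m b).numBags * (L + 1) + 1) ∧ HoldsOutput s' y ∧
          IsDecoderOutput (zigzagDecomposition c m b) K X Z y := by
      rcases hb with rfl | rfl
      · exact ⟨P₂, T₂, by omega, h₂⟩
      · exact ⟨P₃, T₃, by omega, h₃⟩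
    refine ⟨P, fun c m hc hcm => ?_⟩
    have hp := zigzagParams_of_le_sqrt hb hc hcm
    refine ⟨zigzag_isTreeDecomposition hp, zigzag_isAdmissible hp (le_trans (by norm_num) hC),
      fun p q δ h0 hpq hq hδ hδ1 => ⟨zigzag_decoder_error hp h0 hpq hq hδ hδ1 hC, ?_⟩⟩
    intro X Z s hE
    obtain ⟨s', t, y, h1, h2, h3, h4⟩ := hP c m _ X Z s _ hp hE
      (zigzag_budget_nonneg h0 hδ hδ1) rfl
    refine ⟨s', t, y, h1, ?_, h3, h4⟩
    refine (zigzag_running_time hp h0 (by linarith) hδ hδ1 h2).trans ?_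
    have hT' : (T : ℝ) ≤ T₂ + T₃ := by exact_mod_cast hT
    have hl := log_two_le_log_two_div hδ hδ1
    have hl2 := Real.log_two_gt_d9
    have hQ : 0 ≤ p ^ 2 * ((c : ℝ) * m) + Real.log (2 / δ) := by
      have : 0 ≤ p ^ 2 * ((c : ℝ) * m) := by positivity
      linarith
    refine mul_le_mul_of_nonneg_right (mul_le_mul_of_nonneg_right ?_ hQ) (by positivity)
    exact mul_le_mul_of_nonneg_left (by linarith) (by positivity)
  · intro c m hc hcm p q h0 hpq hq est
    exact grid_exists_le_expectedError c m h0 hpq hq est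
  · intro n hn p q h0 hpq hq est
    exact grid_one_exists_le_expectedError n h0 hpq hq est
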